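/- **Conventions.** Let $\overline M$ be a Riemannian seven-manifold with Levi-Civita connection $\overline\nabla$, equipped with a $\mathrm G_2$-structure: a smooth three-form $\varphi$ such that each tangent space has an orthonormal basis $e_0,\dots,e_6$ (a Cayley basis) with $\varphi=\sum_{i\in\mathbb Z/7} e_i\wedge e_{i+1}\wedge e_{i+3}$. Let $\ast$ be the Hodge star for the volume form $e_0\wedge\dots\wedge e_6$, so that $\ast\varphi=-\sum_{i\in\mathbb Z/7}e_{i+2}\wedge e_{i+4}\wedge e_{i+5}\wedge e_{i+6}$, and let $P$ be the cross product, $\langle P(x,y),z\rangle=\varphi(x,y,z)$. Forms carry the scalar product in which the $e_{i_1}\wedge\dots\wedge e_{i_k}$ with $i_1<\dots<i_k$ are orthonormal. At each point, $\overline\nabla\varphi$ lies in $\mathcal X=V^*\otimes\{y\lrcorner\ast\varphi : y\in V\}$, where $V$ is the tangent space. The map $\alpha\mapsto\overline r(\alpha)$, $\overline r(\alpha)(x,y)=\tfrac14\langle x\lrcorner\alpha,\;y\lrcorner\ast\varphi\rangle$, is an isomorphism of $\mathcal X$ with the bilinear forms on $V$; let $\mathcal X_1,\mathcal X_2,\mathcal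 X_3,\mathcal X_4\subset\mathcal X$ be the subspaces that it maps onto, respectively, the multiples of the metric, the Lie algebra $\mathfrak g_2\subset\Lambda^2V^*$, the trace-free symmetric forms, and the orthogonal complement $\mathfrak g_2^{\perp}$ of $\mathfrak g_2$ in $\Lambda^2V^*$. The $\mathrm G_2$-structure is of type $\mathcal X_i+\mathcal X_j$ if $\overline\nabla\varphi$ lies in $\mathcal X_i\oplus\mathcal X_j$ at every point. Let $p_\varphi$ be the vector field dual to the one-form $\ast(\ast d\varphi\wedge\varphi)$. Let $\iota:M\to\overline M$ be an orientable hypersurface with the induced metric, with Levi-Civita connection $\nabla$ and smooth unit normal vector field $n$, and let $\theta$ be a smooth real function on $M$. Equip $M$ with the $\mathrm{SU}(3)$-structure given by the almost complex structure $Ix=P(n,x)$, the Kähler form $\omega(x,y)=\langle x,Iy\rangle$ and $$\psi_+=\cos\theta\,\iota^*\varphi-\sin\theta\,\iota^*(n\lrcorner\ast\varphi),\qquad \psi_-=\sin\theta\,\iota^*\varphi+\cos\theta\,\iota^*(n\lrcorner\ast\varphi).$$ At each point, with tangent space $T$ of $M$, let $\mathcal W$ be the space of trilinear forms $a$ on $T$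 with $a(x,y,z)=-a(x,z,y)=-a(x,Iy,Iz)$; put $\bar a(z)=\sum_i a(e_i,e_i,z)$ for an orthonormal basis $e_1,\dots,e_6$ of $T$, and $r(a)(x,y)=\tfrac12\langle a(x,\cdot,\cdot),\,y\lrcorner\psi_+\rangle$. Then * $\mathcal W_1$ consists of the totally skew-symmetric $a\in\mathcal W$, and $\mathcal W_2$ of the $a\in\mathcal W$ with vanishing cyclic sum; for $i=1,2$, $\mathcal W_i^+$ (respectively $\mathcal W_i^-$) consists of the $a\in\mathcal W_i$ for which $r(a)$ is symmetric (respectively skew-symmetric); * $\mathcal W_3$ consists of the $a\in\mathcal W$ with $a(x,y,z)=a(Ix,Iy,z)$ and $\bar a=0$; * $\mathcal W_4$ consists of the $a\in\mathcal W$ with $4\,a(x,y,z)=\langle x,y\rangle\bar a(z)-\langle x,z\rangle\bar a(y)-\langle x,Iy\rangle\bar a(Iz)+\langle x,Iz\rangle\bar a(Iy)$; * $\mathcal W_5=T^*$. The intrinsic torsion of the $\mathrm{SU}(3)$-structure is identified with the pair $(\nabla\omega,\eta)\in\mathcal W\oplus\mathcal W_5$, where $\eta(x)=-\tfrac1{12}\langle\nabla_{Ix}\psi_+,\psi_-\rangle$.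 The $\mathrm{SU}(3)$-structure is of type a given sum of the modules $\mathcal W_1^\pm,\mathcal W_2^\pm,\mathcal W_3,\mathcal W_4,\mathcal W_5$ if its intrinsic torsion lies in that sum at every point. Finally let $B(x,y)=\langle \mathrm{II}(x,y),n\rangle$ be the second fundamental form of $M$ and $IB(x,y)=B(Ix,Iy)$; $M$ is minimal if $\operatorname{Tr}B=0$ everywhere. **Theorem.** (i) If the $\mathrm G_2$-structure on $\overline M$ is of type $\mathcal X_1+\mathcal X_3$, then the $\mathrm{SU}(3)$-structure on $M$ is of type $\mathcal W_1^++\mathcal W_1^-+\mathcal W_2^++\mathcal W_2^-+\mathcal W_3+\mathcal W_5$. (ii) If the $\mathrm G_2$-structure on $\overline M$ is of type $\mathcal X_2+\mathcal X_4$ and $p_\varphi$ is tangent to $M$ at every point of $M$, then the $\mathrm{SU}(3)$-structure on $M$ is of type $\mathcal W_2^++\mathcal W_2^-+\mathcal W_3+\mathcal W_4+\mathcal W_5$ if and only if $M$ is minimal. (iii) If the $\mathrm G_2$-structure on $\overline M$ is of type $\mathcal X_2+\mathcal X_4$, then the $\mathrm{SU}(3)$-structure on $M$ is of type $\mathcal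 W_1^++\mathcal W_1^-+\mathcal W_2^++\mathcal W_2^-+\mathcal W_4+\mathcal W_5$ if and only if $IB=B$. -/

import Mathlib

open scoped Manifold ContDiff Topology
open Bundle

noncomputable section

namespace G2Hyp

/-! ### The Levi-Civita connection -/

section LeviCivita

/-- The vector `v` with `⟪v, x⟫ = f x` for all `x`, where `f` is a linear functional on a
finite-dimensional Euclidean space. -/
def vecOf {V : Type*} [NormedAddCommGroup V] [InnerProductSpace ℝ V] [FiniteDimensional ℝ V]
    (f : V → ℝ) : V :=
  ∑ i, f (stdOrthonormalBasis ℝ V i) • stdOrthonormalBasis ℝ V i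

theorem inner_vecOf {V : Type*} [NormedAddCommGroup V] [InnerProductSpace ℝ V]
    [FiniteDimensional ℝ V] (f : V →ₗ[ℝ] ℝ) (x : V) : inner ℝ (vecOf f) x = f x := by
  conv_rhs => rw [← (stdOrthonormalBasis ℝ V).sum_repr' x]
  simp [vecOf, sum_inner, inner_smul_left, mul_comm]

variable {E : Type*} [NormedAddCommGroup E] [NormedSpace ℝ E]
  {M : Type*} [TopologicalSpace M] [ChartedSpace E M] [IsManifold 𝓘(ℝ, E) ∞ M]

instance [FiniteDimensional ℝ E] (p : M) : FiniteDimensional ℝ (TangentSpace 𝓘(ℝ, E) p) :=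
  inferInstanceAs (FiniteDimensional ℝ E)

/-- The components of a tangent vector at `q` in the chart at `p`. -/
def comps (p q : M) : TangentSpace 𝓘(ℝ, E) q →L[ℝ] E :=
  (trivializationAt E (TangentSpace 𝓘(ℝ, E)) p).continuousLinearMapAt ℝ q

/-- The tangent vector at `q` with given components in the chart at `p`. -/
def ofComps (p q : M) : E →L[ℝ] TangentSpace 𝓘(ℝ, E) q :=
  (trivializationAt E (TangentSpace 𝓘(ℝ, E)) p).symmL ℝ q

/-- The vector field (near `p`) that extends the tangent vector `y` at `p` and has constant
components in the chart at `p`. -/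
def constField (p : M) (y : TangentSpace 𝓘(ℝ, E) p) (q : M) : TangentSpace 𝓘(ℝ, E) q :=
  ofComps p q (comps p p y)

/-- The derivative at `p` of the components, in the chart at `p`, of a vector field. -/
def flatDeriv (σ : ∀ p : M, TangentSpace 𝓘(ℝ, E) p) (p : M) :
    TangentSpace 𝓘(ℝ, E) p →L[ℝ] TangentSpace 𝓘(ℝ, E) p :=
  ofComps p p ∘L mvfderiv 𝓘(ℝ, E) (fun q => comps p q (σ q)) p

theorem mem_base (p : M) :
    p ∈ (trivializationAt E (TangentSpace 𝓘(ℝ, E) : M → Type _) p).baseSet :=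
  FiberBundle.mem_baseSet_trivializationAt' p

theorem base_nhds (p : M) :
    (trivializationAt E (TangentSpace 𝓘(ℝ, E) : M → Type _) p).baseSet ∈ 𝓝 p :=
  (Trivialization.open_baseSet _).mem_nhds (mem_base p)

theorem ofComps_comps (p : M) (y : TangentSpace 𝓘(ℝ, E) p) : ofComps p p (comps p p y) = y :=
  Trivialization.symmL_continuousLinearMapAt _ (mem_base p) y

theorem constField_self (p : M) (y : TangentSpace 𝓘(ℝ, E) p) : constField p y p = y :=
  ofComps_comps p y

theorem constField_eq_extend (p : M) (y : TangentSpace 𝓘(ℝ, E) p) :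
    ∀ᶠ q in 𝓝 p, constField p y q = FiberBundle.extend E y q := by
  filter_upwards [base_nhds (E := E) p] with q hq
  have h1 : comps p p y = (trivializationAt E (TangentSpace 𝓘(ℝ, E) : M → Type _) p ⟨p, y⟩).2 :=
    congrFun (Trivialization.coe_linearMapAt_of_mem _ (mem_base p)) y
  rw [constField, h1]
  exact Trivialization.symmL_apply _ hq _

theorem mdiffAt_constField (p : M) (y : TangentSpace 𝓘(ℝ, E) p) :
    MDiffAt (T% (constField p y)) p := by
  refine (FiberBundle.mdifferentiableAt_extend 𝓘(ℝ, E) E y).congr_of_eventuallyEq ?_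
  filter_upwards [constField_eq_extend p y] with q hq
  rw [hq]

theorem comps_mdiffAt {σ : ∀ p : M, TangentSpace 𝓘(ℝ, E) p} {p : M} (h : MDiffAt (T% σ) p) :
    MDiffAt (fun q => comps p q (σ q)) p := by
  have h1 := (Trivialization.mdifferentiableAt_section_iff 𝓘(ℝ, E)
    (trivializationAt E (TangentSpace 𝓘(ℝ, E) : M → Type _) p) σ (mem_base p)).1 h
  refine h1.congr_of_eventuallyEq ?_
  filter_upwards [base_nhds (E := E) p] with q hq
  exact congrFun (Trivialization.coe_linearMapAt_of_mem _ hq) (σ q)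

theorem flatDeriv_isCovariantDerivativeOn :
    IsCovariantDerivativeOn (I := 𝓘(ℝ, E)) (M := M) E
      (V := fun p : M => TangentSpace 𝓘(ℝ, E) p) flatDeriv := by
  constructor
  · intro σ τ x h h' _
    have : (fun q => comps x q ((σ + τ) q)) =
        (fun q => comps x q (σ q)) + fun q => comps x q (τ q) := by
      ext q; simp
    rw [flatDeriv, this, mvfderiv_add (comps_mdiffAt h) (comps_mdiffAt h')]
    simp [flatDeriv]
  · intro σ g x h hg _
    have : (fun q => comps x q ((g • σ) q)) = g • fun q => comps x q (σ q) := by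
      ext q; simp
    rw [flatDeriv, this, mvfderiv_smul hg (comps_mdiffAt h)]
    ext v
    simp [flatDeriv, ofComps_comps]

theorem flatDeriv_constField (p : M) (y : TangentSpace 𝓘(ℝ, E) p) :
    flatDeriv (constField p y) p = 0 := by
  have : (fun q => comps p q (constField p y q)) =ᶠ[𝓝 p] fun _ => comps p p y := by
    filter_upwards [base_nhds (E := E) p] with q hq
    exact Trivialization.continuousLinearMapAt_symmL _ hq _
  have h0 : mvfderiv 𝓘(ℝ, E) (fun q => comps p q (constField p y q)) p = 0 := by
    rw [mvfderiv, this.mfderiv_eq]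
    exact mvfderiv_const (I := 𝓘(ℝ, E)) (comps p p y)
  simp [flatDeriv, h0]

open VectorField in
theorem mlieBracket_constField [CompleteSpace E] (p : M) (y z : TangentSpace 𝓘(ℝ, E) p) :
    mlieBracket 𝓘(ℝ, E) (constField p y) (constField p z) p = 0 := by
  have key : ∀ w : TangentSpace 𝓘(ℝ, E) p,
      (mpullbackWithin 𝓘(ℝ, E) 𝓘(ℝ, E) (extChartAt 𝓘(ℝ, E) p).symm (constField p w)
        (Set.range 𝓘(ℝ, E))) =ᶠ[𝓝 (extChartAt 𝓘(ℝ, E) p p)] fun _ => comps p p w := by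
    intro w
    filter_upwards [extChartAt_target_mem_nhds (I := 𝓘(ℝ, E)) p] with u hu
    have hs : (extChartAt 𝓘(ℝ, E) p).symm u ∈ (chartAt E p).source := by
      simpa using (extChartAt 𝓘(ℝ, E) p).map_target hu
    have := TangentBundle.symmL_trivializationAt (I := 𝓘(ℝ, E)) hs
    rw [(extChartAt 𝓘(ℝ, E) p).right_inv hu] at this
    have hinv := isInvertible_mfderivWithin_extChartAt_symm (I := 𝓘(ℝ, E)) hu
    rw [mpullbackWithin_apply, constField, ofComps, this]
    exact hinv.inverse_apply_eq.2 rfl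
  rw [← mlieBracketWithin_univ, mlieBracketWithin_apply]
  rw [Filter.EventuallyEq.lieBracketWithin_vectorField_eq_nhds (key y) (key z)]
  have h0 : lieBracketWithin ℝ (fun _ : E => comps p p y) (fun _ : E => comps p p z)
      ((extChartAt 𝓘(ℝ, E) p).symm ⁻¹' Set.univ ∩ Set.range 𝓘(ℝ, E))
      (extChartAt 𝓘(ℝ, E) p p) = 0 := by
    simp [lieBracketWithin]
  exact (congrArg (mfderiv 𝓘(ℝ, E) 𝓘(ℝ, E) (extChartAt 𝓘(ℝ, E) p) p).inverse h0).trans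
    (ContinuousLinearMap.map_zero
      (M₁ := TangentSpace 𝓘(ℝ, E) (extChartAt 𝓘(ℝ, E) p p)) (M₂ := TangentSpace 𝓘(ℝ, E) p) _)

variable [RiemannianBundle (fun p : M => TangentSpace 𝓘(ℝ, E) p)]
  [IsContMDiffRiemannianBundle 𝓘(ℝ, E) ∞ E (fun p : M => TangentSpace 𝓘(ℝ, E) p)]

theorem mdiffAt_inner_constField (p : M) (y z : TangentSpace 𝓘(ℝ, E) p) :
    MDiffAt (fun q : M => inner ℝ (constField p y q) (constField p z q)) p :=
  MDifferentiableAt.inner_bundle (E := fun p : M => TangentSpace 𝓘(ℝ, E) p) (F := E)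
    (mdiffAt_constField p y) (mdiffAt_constField p z)

/-- The first derivatives of the metric in the chart at `p`:
`metricDeriv p y z x` is the derivative in the direction `x` of `⟪Y, Z⟫`, where `Y` and `Z` are the
fields with constant components in the chart at `p` that extend `y` and `z`. -/
def metricDeriv (p : M) : TangentSpace 𝓘(ℝ, E) p →ₗ[ℝ] TangentSpace 𝓘(ℝ, E) p →ₗ[ℝ]
    TangentSpace 𝓘(ℝ, E) p →ₗ[ℝ] ℝ :=
  LinearMap.mk₂ ℝ
    (fun y z => (mvfderiv 𝓘(ℝ, E)
      (fun q : M => inner ℝ (constField p y q) (constField p z q)) p).toLinearMap)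
    (fun y y' z => by
      have : (fun q : M => inner ℝ (constField p (y + y') q) (constField p z q)) =
          (fun q => inner ℝ (constField p y q) (constField p z q)) +
            fun q => inner ℝ (constField p y' q) (constField p z q) := by
        ext q; simp [constField, inner_add_left]
      rw [this, mvfderiv_add (mdiffAt_inner_constField p y z) (mdiffAt_inner_constField p y' z)]
      simp)
    (fun c y z => by
      have : (fun q : M => inner ℝ (constField p (c • y) q) (constField p z q)) =
          (fun _ : M => c) • (fun q => inner ℝ (constField p y q) (constField p z q)) := by
        ext q; simp [constField, inner_smul_left]
      rw [this, mvfderiv_smul mdifferentiableAt_const (mdiffAt_inner_constField p y z),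
        mvfderiv_const]
      ext; simp)
    (fun z y y' => by
      have : (fun q : M => inner ℝ (constField p z q) (constField p (y + y') q)) =
          (fun q => inner ℝ (constField p z q) (constField p y q)) +
            fun q => inner ℝ (constField p z q) (constField p y' q) := by
        ext q; simp [constField, inner_add_right]
      rw [this, mvfderiv_add (mdiffAt_inner_constField p z y) (mdiffAt_inner_constField p z y')]
      simp)
    (fun c z y => by
      have : (fun q : M => inner ℝ (constField p z q) (constField p (c • y) q)) =
          (fun _ : M => c) • (fun q => inner ℝ (constField p z q) (constField p y q)) := by
        ext q; simp [constField, inner_smul_right]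
      rw [this, mvfderiv_smul mdifferentiableAt_const (mdiffAt_inner_constField p z y),
        mvfderiv_const]
      ext; simp)

/-- The Christoffel symbols of the first kind at `p`, in the chart at `p`:
`christoffelFst p x y z = (x ⟪Y, Z⟫ + y ⟪X, Z⟫ - z ⟪X, Y⟫) / 2`. -/
def christoffelFst (p : M) : TangentSpace 𝓘(ℝ, E) p →ₗ[ℝ] TangentSpace 𝓘(ℝ, E) p →ₗ[ℝ]
    TangentSpace 𝓘(ℝ, E) p →ₗ[ℝ] ℝ :=
  LinearMap.mk₂ ℝ
    (fun x y => (1 / 2 : ℝ) •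
      ((metricDeriv p y).flip x + (metricDeriv p x).flip y - metricDeriv p x y))
    (fun x x' y => by ext z; simp; ring)
    (fun c x y => by ext z; simp; ring)
    (fun x y y' => by ext z; simp; ring)
    (fun c x y => by ext z; simp; ring)

variable [FiniteDimensional ℝ E]

/-- The Christoffel symbols of the second kind at `p`, in the chart at `p`: `christoffel p y x` is
`∇_x Y` for the field `Y` with constant components that extends `y`. -/
def christoffel (p : M) : TangentSpace 𝓘(ℝ, E) p →L[ℝ] TangentSpace 𝓘(ℝ, E) p →L[ℝ]
    TangentSpace 𝓘(ℝ, E) p :=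
  LinearMap.toContinuousLinearMap
    (LinearMap.toContinuousLinearMap.toLinearMap ∘ₗ
      LinearMap.mk₂ ℝ (fun y x => vecOf (christoffelFst p x y))
      (fun y y' x => by simp [vecOf, add_smul, Finset.sum_add_distrib])
      (fun c y x => by simp [vecOf, mul_smul, Finset.smul_sum])
      (fun y x x' => by simp [vecOf, add_smul, Finset.sum_add_distrib])
      (fun c y x => by simp [vecOf, mul_smul, Finset.smul_sum]))

theorem inner_christoffel (p : M) (x y z : TangentSpace 𝓘(ℝ, E) p) :
    inner ℝ (christoffel p y x) z = christoffelFst p x y z :=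
  inner_vecOf (christoffelFst p x y) z

variable (E M) in
/-- The Levi-Civita connection of a Riemannian manifold; `leviCivita E M σ p x` is `∇_x σ` at `p`.
It is metric and torsion-free by the two theorems below. -/
def leviCivita : CovariantDerivative 𝓘(ℝ, E) E (TangentSpace 𝓘(ℝ, E) : M → Type _) where
  toFun σ p := flatDeriv σ p + christoffel p (σ p)
  isCovariantDerivativeOnUniv := flatDeriv_isCovariantDerivativeOn.add_one_form christoffel

theorem leviCivita_constField (p : M) (x y : TangentSpace 𝓘(ℝ, E) p) :
    leviCivita E M (constField p y) p x = christoffel p y x := by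
  simp [leviCivita, flatDeriv_constField, constField_self]

theorem leviCivita_isMetricCompatible :
    CovariantDerivative.IsMetricCompatible (V := fun p : M => TangentSpace 𝓘(ℝ, E) p)
      (leviCivita E M) := by
  ext p y z x
  have h := CovariantDerivative.derivMetricTensor_apply
    (V := fun p : M => TangentSpace 𝓘(ℝ, E) p) (cov := leviCivita E M) (X := constField p x) p
    (mdiffAt_constField p y) (mdiffAt_constField p z)
  simp only [constField_self] at h
  rw [h, leviCivita_constField, leviCivita_constField, inner_christoffel, real_inner_comm,
    inner_christoffel]
  have hs : metricDeriv p z y = metricDeriv p y z := by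
    simp only [metricDeriv, LinearMap.mk₂_apply]
    simp_rw [real_inner_comm]
  have : mvfderiv 𝓘(ℝ, E) (fun q : M => inner ℝ (constField p y q) (constField p z q)) p x =
    metricDeriv p y z x := rfl
  rw [this]
  simp [christoffelFst, hs]
  ring

theorem leviCivita_torsion : (leviCivita E M).torsion = 0 := by
  ext p x y
  have h := (leviCivita E M).torsion_apply (mdiffAt_constField p x) (mdiffAt_constField p y)
  simp only [constField_self] at h
  rw [h, mlieBracket_constField, leviCivita_constField, leviCivita_constField]
  have hs : metricDeriv p x y = metricDeriv p y x := by
    simp only [metricDeriv, LinearMap.mk₂_apply]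
    simp_rw [real_inner_comm]
  have : christoffelFst p x y = christoffelFst p y x := by
    ext z; simp [christoffelFst, hs]; ring
  change vecOf (christoffelFst p x y) - vecOf (christoffelFst p y x) - 0 = 0
  rw [this, sub_self, sub_zero]

variable (E) in
/-- The covariant derivative `∇_x α` of a tensor field `α` of type `(0, k)` at `p`, evaluated on
`v`: with `V i` the field of constant components extending `v i`, it is
`x (α (V 0, ..., V (k - 1))) - ∑ i, α (v 0, ..., ∇_x (V i), ..., v (k - 1))`. -/
def nabla {k : ℕ} (α : ∀ q : M, (Fin k → TangentSpace 𝓘(ℝ, E) q) → ℝ) (p : M)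
    (x : TangentSpace 𝓘(ℝ, E) p) (v : Fin k → TangentSpace 𝓘(ℝ, E) p) : ℝ :=
  mvfderiv 𝓘(ℝ, E) (fun q => α q fun i => constField p (v i) q) p x -
    ∑ i, α p (Function.update v i (leviCivita E M (constField p (v i)) p x))

/-- The covariant derivative `∇_x V` at `p` of a vector field `V` along a map `f : N → M`
(that is, `V q` is tangent to `M` at `f q`) in a direction `x` tangent to `N` at `p`, for the
pull-back by `f` of the Levi-Civita connection of `M`: the derivative of the components of `V` in
the chart at `f p`, plus the Christoffel term `∇_{df x} (constant extension of V p)`. -/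
def nablaAlong {E' : Type*} [NormedAddCommGroup E'] [NormedSpace ℝ E']
    {N : Type*} [TopologicalSpace N] [ChartedSpace E' N] (f : N → M)
    (V : ∀ q : N, TangentSpace 𝓘(ℝ, E) (f q)) (p : N) (x : TangentSpace 𝓘(ℝ, E') p) :
    TangentSpace 𝓘(ℝ, E) (f p) :=
  ofComps (f p) (f p) (mvfderiv 𝓘(ℝ, E') (fun q => comps (f p) (f q) (V q)) p x) +
    leviCivita E M (constField (f p) (V p)) (f p) (mfderiv 𝓘(ℝ, E') 𝓘(ℝ, E) f p x)

end LeviCivita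

/-- The exterior derivative of a `k`-form at `p`, computed in the chart at `p`. -/
def extDer {E : Type*} [NormedAddCommGroup E] [NormedSpace ℝ E]
    {M : Type*} [TopologicalSpace M] [ChartedSpace E M] [IsManifold 𝓘(ℝ, E) ∞ M] {k : ℕ}
    (α : ∀ q : M, (Fin k → TangentSpace 𝓘(ℝ, E) q) → ℝ) (p : M)
    (v : Fin (k + 1) → TangentSpace 𝓘(ℝ, E) p) : ℝ :=
  ∑ i : Fin (k + 1), (-1 : ℝ) ^ (i : ℕ) *
    mvfderiv 𝓘(ℝ, E) (fun q => α q fun j => constField p (v (i.succAbove j)) q) p (v i)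

/-! ### Forms on a Euclidean space

A `k`-form on `V` is treated here as a function `(Fin k → V) → ℝ`. -/

section Forms

variable {V : Type*} [NormedAddCommGroup V] [InnerProductSpace ℝ V]

/-- The scalar product of two `k`-forms, `(1 / k!) ∑ a(e_{i₁}, ..., e_{iₖ}) b(e_{i₁}, ..., e_{iₖ})`
over an orthonormal basis. -/
def formInner [FiniteDimensional ℝ V] {k : ℕ} (a b : (Fin k → V) → ℝ) : ℝ :=
  (1 / (k.factorial : ℝ)) * ∑ i : Fin k → Fin (Module.finrank ℝ V),
    a (fun j => stdOrthonormalBasis ℝ V (i j)) * b (fun j => stdOrthonormalBasis ℝ V (i j))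

/-- The interior product of a vector and a form. -/
def interior {k : ℕ} (x : V) (a : (Fin (k + 1) → V) → ℝ) : (Fin k → V) → ℝ :=
  fun v => a (Matrix.vecCons x v)

/-- The wedge product of a `k`-form and an `l`-form. -/
def wedge {k l : ℕ} (a : (Fin k → V) → ℝ) (b : (Fin l → V) → ℝ) : (Fin (k + l) → V) → ℝ :=
  fun v => (1 / ((k.factorial : ℝ) * (l.factorial : ℝ))) *
    ∑ σ : Equiv.Perm (Fin (k + l)), ((Equiv.Perm.sign σ : ℤ) : ℝ) *
      (a (fun i => v (σ (Fin.castAdd l i))) * b (fun j => v (σ (Fin.natAdd k j))))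

/-- The Hodge star of a `k`-form on an `m`-dimensional Euclidean space, for the volume form
`e₁ ∧ ... ∧ eₘ`, where `e` is an orthonormal basis. -/
def hodge {m : ℕ} (e : OrthonormalBasis (Fin m) ℝ V) (k l : ℕ) (h : k + l = m)
    (a : (Fin k → V) → ℝ) : (Fin l → V) → ℝ :=
  fun v => (1 / (k.factorial : ℝ)) * ∑ i : Fin k → Fin m,
    a (fun j => e (i j)) *
      e.toBasis.det (fun j => Fin.append (fun s => e (i s)) v (Fin.cast h.symm j))

end Forms

/-! ### Linear algebra of `G₂`-structures -/

section G2Linear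

variable {V : Type*} [NormedAddCommGroup V] [InnerProductSpace ℝ V]

/-- `e` is a Cayley basis for `φ`: `φ = ∑_{i ∈ ℤ/7} eᵢ ∧ eᵢ₊₁ ∧ eᵢ₊₃`. -/
def IsCayley (e : OrthonormalBasis (Fin 7) ℝ V) (φ : V [⋀^Fin 3]→ₗ[ℝ] ℝ) : Prop :=
  ∀ v : Fin 3 → V, φ v = ∑ i : Fin 7,
    Matrix.det (Matrix.of fun a b : Fin 3 => inner ℝ (e (![i, i + 1, i + 3] a)) (v b))

variable [FiniteDimensional ℝ V]

/-- The cross product `P`, `⟪P(x, y), z⟫ = φ(x, y, z)`. -/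
def cross (φ : V [⋀^Fin 3]→ₗ[ℝ] ℝ) (x y : V) : V := vecOf fun z => φ ![x, y, z]

/-- The four-form `∗φ`, given in terms of the cross product by
`∗φ(x, y, z, u) = -(1/3) 𝔖_{yzu} ⟪P(x, y), P(z, u)⟫` (cyclic sum). In a Cayley basis it is
`-∑ eᵢ₊₂ ∧ eᵢ₊₄ ∧ eᵢ₊₅ ∧ eᵢ₊₆`, the Hodge dual of `φ` for the volume form `e₀ ∧ ... ∧ e₆`. -/
def starPhi (φ : V [⋀^Fin 3]→ₗ[ℝ] ℝ) : (Fin 4 → V) → ℝ := fun v =>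
  -(1 / 3) * (inner ℝ (cross φ (v 0) (v 1)) (cross φ (v 2) (v 3)) +
    inner ℝ (cross φ (v 0) (v 2)) (cross φ (v 3) (v 1)) +
    inner ℝ (cross φ (v 0) (v 3)) (cross φ (v 1) (v 2)))

/-- The map `α ↦ r̄(α)`, `r̄(α)(x, y) = ¼ ⟪x ⌟ α, y ⌟ ∗φ⟫`, for `α ∈ V* ⊗ Λ³V*`. -/
def rBar (φ : V [⋀^Fin 3]→ₗ[ℝ] ℝ) : (V → (Fin 3 → V) → ℝ) →ₗ[ℝ] (V → V → ℝ) where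
  toFun α := fun x y => (1 / 4) * formInner (α x) (interior y (starPhi φ))
  map_add' α β := by
    ext x y
    simp [formInner, add_mul, Finset.sum_add_distrib, mul_add]
  map_smul' c α := by
    ext x y
    simp only [formInner, Pi.smul_apply, smul_eq_mul, RingHom.id_apply, mul_assoc,
      ← Finset.mul_sum]
    ring

/-- The space `𝒳 = V* ⊗ 𝔤₂^⊥ ⊆ V* ⊗ Λ³V*` of covariant derivatives of `φ`, where
`𝔤₂^⊥ = {y ⌟ ∗φ}`. -/
def spaceX (φ : V [⋀^Fin 3]→ₗ[ℝ] ℝ) : Submodule ℝ (V → (Fin 3 → V) → ℝ) :=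
  Submodule.span ℝ {α | ∃ (f : V →ₗ[ℝ] ℝ) (y : V), α = fun x v => f x * interior y (starPhi φ) v}

/-- A bilinear form regarded as a function. -/
def bilinFun : LinearMap.BilinForm ℝ V →ₗ[ℝ] (V → V → ℝ) where
  toFun b := fun x y => b x y
  map_add' _ _ := rfl
  map_smul' _ _ := rfl

/-- The line spanned by the metric. -/
def scalarForms : Submodule ℝ (LinearMap.BilinForm ℝ V) := Submodule.span ℝ {innerₗ V}

/-- The space `S²₀V*` of trace-free symmetric bilinear forms. -/
def symForms₀ : Submodule ℝ (LinearMap.BilinForm ℝ V) where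
  carrier := {b | (∀ x y, b x y = b y x) ∧
    ∑ i, b (stdOrthonormalBasis ℝ V i) (stdOrthonormalBasis ℝ V i) = 0}
  add_mem' := by
    rintro a b ⟨ha, ha'⟩ ⟨hb, hb'⟩
    exact ⟨fun x y => by simp [ha x y, hb x y], by simp [Finset.sum_add_distrib, ha', hb']⟩
  zero_mem' := by simp
  smul_mem' := by
    rintro c b ⟨hb, hb'⟩
    exact ⟨fun x y => by simp [hb x y], by simp [← Finset.mul_sum, hb']⟩

/-- The Lie algebra `𝔤₂`, as a space of skew-symmetric bilinear forms `b`: those with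
`∑_{j,k} φ(x, e_j, e_k) b(e_j, e_k) = 0` for all `x`. -/
def g₂ (φ : V [⋀^Fin 3]→ₗ[ℝ] ℝ) : Submodule ℝ (LinearMap.BilinForm ℝ V) where
  carrier := {b | (∀ x y, b x y = -b y x) ∧
    ∀ x, ∑ j, ∑ k, φ ![x, stdOrthonormalBasis ℝ V j, stdOrthonormalBasis ℝ V k] *
      b (stdOrthonormalBasis ℝ V j) (stdOrthonormalBasis ℝ V k) = 0}
  add_mem' := by
    rintro a b ⟨ha, ha'⟩ ⟨hb, hb'⟩
    refine ⟨fun x y => ?_, fun x => ?_⟩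
    · rw [LinearMap.add_apply, LinearMap.add_apply, LinearMap.add_apply, LinearMap.add_apply,
        ha x y, hb x y]
      ring
    · simp [mul_add, Finset.sum_add_distrib, ha', hb']
  zero_mem' := by simp
  smul_mem' := by
    rintro c b ⟨hb, hb'⟩
    refine ⟨fun x y => ?_, fun x => ?_⟩
    · rw [LinearMap.smul_apply, LinearMap.smul_apply, LinearMap.smul_apply, LinearMap.smul_apply,
        hb x y, smul_neg]
    · simp only [LinearMap.smul_apply, smul_eq_mul, mul_left_comm _ c, ← Finset.mul_sum, hb' x,
        mul_zero]

/-- The orthogonal complement of `𝔤₂` in the space of skew-symmetric bilinear forms. -/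
def g₂Perp (φ : V [⋀^Fin 3]→ₗ[ℝ] ℝ) : Submodule ℝ (LinearMap.BilinForm ℝ V) where
  carrier := {b | (∀ x y, b x y = -b y x) ∧
    ∀ c ∈ g₂ φ, ∑ j, ∑ k, c (stdOrthonormalBasis ℝ V j) (stdOrthonormalBasis ℝ V k) *
      b (stdOrthonormalBasis ℝ V j) (stdOrthonormalBasis ℝ V k) = 0}
  add_mem' := by
    rintro a b ⟨ha, ha'⟩ ⟨hb, hb'⟩
    refine ⟨fun x y => ?_, fun c hc => ?_⟩
    · rw [LinearMap.add_apply, LinearMap.add_apply, LinearMap.add_apply, LinearMap.add_apply,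
        ha x y, hb x y]
      ring
    · simp [mul_add, Finset.sum_add_distrib, ha' c hc, hb' c hc]
  zero_mem' := by simp
  smul_mem' := by
    rintro t b ⟨hb, hb'⟩
    refine ⟨fun x y => ?_, fun c hc => ?_⟩
    · rw [LinearMap.smul_apply, LinearMap.smul_apply, LinearMap.smul_apply, LinearMap.smul_apply,
        hb x y, smul_neg]
    · simp only [LinearMap.smul_apply, smul_eq_mul, mul_left_comm _ t, ← Finset.mul_sum, hb' c hc,
        mul_zero]

/-- The four basic classes of `G₂`-structures. -/
inductive G2Class
  | X₁ | X₂ | X₃ | X₄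

/-- The irreducible `G₂`-submodules `𝒳₁ ≅ ℝ`, `𝒳₂ ≅ 𝔤₂`, `𝒳₃ ≅ S²₀V*`, `𝒳₄ ≅ 𝔤₂^⊥` of `𝒳`, the
isomorphisms being induced by `r̄`. -/
def moduleX (φ : V [⋀^Fin 3]→ₗ[ℝ] ℝ) : G2Class → Submodule ℝ (V → (Fin 3 → V) → ℝ)
  | .X₁ => spaceX φ ⊓ (scalarForms.map bilinFun).comap (rBar φ)
  | .X₂ => spaceX φ ⊓ ((g₂ φ).map bilinFun).comap (rBar φ)
  | .X₃ => spaceX φ ⊓ (symForms₀.map bilinFun).comap (rBar φ)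
  | .X₄ => spaceX φ ⊓ ((g₂Perp φ).map bilinFun).comap (rBar φ)

end G2Linear

/-! ### Linear algebra of `SU(3)`-structures -/

section SU3Linear

variable {V : Type*} [NormedAddCommGroup V] [InnerProductSpace ℝ V]

/-- The space `W = V* ⊗ 𝔲(3)^⊥` of Gray and Hervella: trilinear forms `a` with
`a(x, y, z) = -a(x, z, y) = -a(x, Jy, Jz)`. -/
def spaceW (J : V → V) : Submodule ℝ (V → V → V → ℝ) where
  carrier := {a | (∃ A : V →ₗ[ℝ] V →ₗ[ℝ] V →ₗ[ℝ] ℝ, ∀ x y z, a x y z = A x y z) ∧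
    (∀ x y z, a x y z = -a x z y) ∧ ∀ x y z, a x y z = -a x (J y) (J z)}
  add_mem' := by
    rintro a b ⟨⟨A, hA⟩, ha, ha'⟩ ⟨⟨B, hB⟩, hb, hb'⟩
    refine ⟨⟨A + B, fun x y z => by simp [hA, hB]⟩, fun x y z => ?_, fun x y z => ?_⟩
    · simp only [Pi.add_apply]; linarith [ha x y z, hb x y z]
    · simp only [Pi.add_apply]; linarith [ha' x y z, hb' x y z]
  zero_mem' := ⟨⟨0, by simp⟩, by simp, by simp⟩
  smul_mem' := by
    rintro c b ⟨⟨B, hB⟩, hb, hb'⟩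
    refine ⟨⟨c • B, fun x y z => by simp [hB]⟩, fun x y z => ?_, fun x y z => ?_⟩
    · simp only [Pi.smul_apply, smul_eq_mul]; rw [hb x y z]; ring
    · simp only [Pi.smul_apply, smul_eq_mul]; rw [hb' x y z]; ring

variable [FiniteDimensional ℝ V]

/-- The contraction `z ↦ ∑ a(eᵢ, eᵢ, z)`. -/
def contr : (V → V → V → ℝ) →ₗ[ℝ] (V → ℝ) where
  toFun a := fun z => ∑ i, a (stdOrthonormalBasis ℝ V i) (stdOrthonormalBasis ℝ V i) z
  map_add' a b := by ext z; simp [Finset.sum_add_distrib]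
  map_smul' c a := by ext z; simp [Finset.mul_sum]

/-- The map `a ↦ r(a)`, `r(a)(x, y) = ½ ⟪x ⌟ a, y ⌟ ψ₊⟫`, for `a ∈ V* ⊗ Λ²V*`. -/
def rMap (ψp : (Fin 3 → V) → ℝ) : (V → V → V → ℝ) →ₗ[ℝ] (V → V → ℝ) where
  toFun a := fun x y =>
    (1 / 2) * formInner (fun v : Fin 2 → V => a x (v 0) (v 1)) (interior y ψp)
  map_add' a b := by
    ext x y
    simp [formInner, add_mul, Finset.sum_add_distrib, mul_add]
  map_smul' c a := by
    ext x y
    simp only [formInner, Pi.smul_apply, smul_eq_mul, RingHom.id_apply, mul_assoc,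
      ← Finset.mul_sum]
    ring

/-- The Gray-Hervella module `W₁`: the totally skew-symmetric elements of `W`. -/
def moduleW₁ (J : V → V) : Submodule ℝ (V → V → V → ℝ) where
  carrier := {a | a ∈ spaceW J ∧ ∀ x z, a x x z = 0}
  add_mem' := fun ha hb => ⟨add_mem ha.1 hb.1, fun x z => by simp [ha.2 x z, hb.2 x z]⟩
  zero_mem' := ⟨zero_mem _, by simp⟩
  smul_mem' := fun c a ha => ⟨Submodule.smul_mem _ c ha.1, fun x z => by simp [ha.2 x z]⟩

/-- The Gray-Hervella module `W₂`: the elements of `W` with vanishing cyclic sum. -/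
def moduleW₂ (J : V → V) : Submodule ℝ (V → V → V → ℝ) where
  carrier := {a | a ∈ spaceW J ∧ ∀ x y z, a x y z + a y z x + a z x y = 0}
  add_mem' := fun ha hb => ⟨add_mem ha.1 hb.1, fun x y z => by
    simp only [Pi.add_apply]; linarith [ha.2 x y z, hb.2 x y z]⟩
  zero_mem' := ⟨zero_mem _, by simp⟩
  smul_mem' := fun c a ha => ⟨Submodule.smul_mem _ c ha.1, fun x y z => by
    simp [← mul_add, ha.2 x y z]⟩

/-- The Gray-Hervella module `W₃`: the `a ∈ W` with `a(x, y, z) = a(Jx, Jy, z)` and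
`∑ a(eᵢ, eᵢ, z) = 0`. -/
def moduleW₃ (J : V → V) : Submodule ℝ (V → V → V → ℝ) where
  carrier := {a | a ∈ spaceW J ∧ (∀ x y z, a x y z = a (J x) (J y) z) ∧ contr a = 0}
  add_mem' := fun {a b} ha hb => ⟨add_mem ha.1 hb.1, fun x y z => by
    simp only [Pi.add_apply]; rw [ha.2.1 x y z, hb.2.1 x y z], by
    rw [map_add, ha.2.2, hb.2.2, add_zero]⟩
  zero_mem' := ⟨zero_mem _, by simp, map_zero _⟩
  smul_mem' := fun c a ha => ⟨Submodule.smul_mem _ c ha.1, fun x y z => by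
    simp only [Pi.smul_apply]; rw [ha.2.1 x y z], by rw [map_smul, ha.2.2, smul_zero]⟩

/-- The Gray-Hervella module `W₄` in real dimension 6: with `ā(z) = ∑ a(eᵢ, eᵢ, z)`, the `a ∈ W`
with `a(x, y, z) = ¼ (⟪x, y⟫ ā(z) - ⟪x, z⟫ ā(y) - ⟪x, Jy⟫ ā(Jz) + ⟪x, Jz⟫ ā(Jy))`. -/
def moduleW₄ (J : V → V) : Submodule ℝ (V → V → V → ℝ) where
  carrier := {a | a ∈ spaceW J ∧ ∀ x y z, a x y z = (1 / 4) *
    (inner ℝ x y * contr a z - inner ℝ x z * contr a y -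
      inner ℝ x (J y) * contr a (J z) + inner ℝ x (J z) * contr a (J y))}
  add_mem' := fun {a b} ha hb => ⟨add_mem ha.1 hb.1, fun x y z => by
    simp only [Pi.add_apply, map_add]; rw [ha.2 x y z, hb.2 x y z]; ring⟩
  zero_mem' := ⟨zero_mem _, by simp⟩
  smul_mem' := fun c a ha => ⟨Submodule.smul_mem _ c ha.1, fun x y z => by
    simp only [Pi.smul_apply, map_smul, smul_eq_mul]; rw [ha.2 x y z]; ring⟩

/-- The tensors `a` for which `r(a)` is symmetric. -/
def rSymm (ψp : (Fin 3 → V) → ℝ) : Submodule ℝ (V → V → V → ℝ) where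
  carrier := {a | ∀ x y, rMap ψp a x y = rMap ψp a y x}
  add_mem' := fun {a b} ha hb x y => by simp only [map_add, Pi.add_apply, ha x y, hb x y]
  zero_mem' := by simp
  smul_mem' := fun c a ha x y => by simp only [map_smul, Pi.smul_apply, ha x y]

/-- The tensors `a` for which `r(a)` is skew-symmetric. -/
def rSkew (ψp : (Fin 3 → V) → ℝ) : Submodule ℝ (V → V → V → ℝ) where
  carrier := {a | ∀ x y, rMap ψp a x y = -rMap ψp a y x}
  add_mem' := fun {a b} ha hb x y => by
    simp only [map_add, Pi.add_apply]; rw [ha x y, hb x y]; ring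
  zero_mem' := by simp
  smul_mem' := fun c a ha x y => by
    simp only [map_smul, Pi.smul_apply]; rw [ha x y, smul_neg]

/-- The basic classes of `SU(3)`-structures. -/
inductive SU3Class
  | W₁p | W₁m | W₂p | W₂m | W₃ | W₄ | W₅

/-- The `SU(3)`-modules `W₁^±, W₂^±, W₃, W₄, W₅` in the space of intrinsic `SU(3)`-torsions, which
is identified with `(V* ⊗ 𝔲(3)^⊥) ⊕ V*`. -/
def moduleSU3 (J : V → V) (ψp : (Fin 3 → V) → ℝ) :
    SU3Class → Submodule ℝ ((V → V → V → ℝ) × (V → ℝ))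
  | .W₁p => (moduleW₁ J ⊓ rSymm ψp).prod ⊥
  | .W₁m => (moduleW₁ J ⊓ rSkew ψp).prod ⊥
  | .W₂p => (moduleW₂ J ⊓ rSymm ψp).prod ⊥
  | .W₂m => (moduleW₂ J ⊓ rSkew ψp).prod ⊥
  | .W₃ => (moduleW₃ J).prod ⊥
  | .W₄ => (moduleW₄ J).prod ⊥
  | .W₅ => (⊥ : Submodule ℝ (V → V → V → ℝ)).prod
      (LinearMap.range (LinearMap.ltoFun ℝ V ℝ ℝ))

end SU3Linear

/-! ### `G₂`-structures on seven-manifolds -/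

/-- A `G₂`-structure on a Riemannian seven-manifold: a smooth three-form that has a Cayley basis at
every point. -/
structure G2Structure (N : Type*) [TopologicalSpace N]
    [ChartedSpace (EuclideanSpace ℝ (Fin 7)) N] [IsManifold (𝓡 7) ∞ N]
    [RiemannianBundle (fun p : N => TangentSpace (𝓡 7) p)] where
  /-- the fundamental three-form -/
  φ : ∀ p : N, TangentSpace (𝓡 7) p [⋀^Fin 3]→ₗ[ℝ] ℝ
  smooth : ∀ (p : N) (X : Fin 3 → ∀ q : N, TangentSpace (𝓡 7) q),
    (∀ i, ContMDiffAt (𝓡 7) (𝓡 7).tangent ∞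
      (fun q => (⟨q, X i q⟩ : TangentBundle (𝓡 7) N)) p) →
    ContMDiffAt (𝓡 7) 𝓘(ℝ, ℝ) ∞ (fun q => φ q fun i => X i q) p
  cayley : ∀ p : N, ∃ e : OrthonormalBasis (Fin 7) ℝ (TangentSpace (𝓡 7) p), IsCayley e (φ p)

namespace G2Structure

variable {N : Type*} [TopologicalSpace N]
  [ChartedSpace (EuclideanSpace ℝ (Fin 7)) N] [IsManifold (𝓡 7) ∞ N]
  [RiemannianBundle (fun p : N => TangentSpace (𝓡 7) p)]

/-- The vector field `p_φ`, dual to the one-form `∗(∗dφ ∧ φ)`. (The result does not depend on the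
Cayley basis `e` that defines the volume form `e₀ ∧ ... ∧ e₆`.) -/
def pVec (G : G2Structure N) (p : N) : TangentSpace (𝓡 7) p :=
  vecOf fun x =>
    hodge (G.cayley p).choose 6 1 rfl
      (wedge (hodge (G.cayley p).choose 4 3 rfl (extDer (fun q v => G.φ q v) p))
        (fun v : Fin 3 → _ => G.φ p v)) ![x]

variable [IsContMDiffRiemannianBundle (𝓡 7) ∞ (EuclideanSpace ℝ (Fin 7))
    (fun p : N => TangentSpace (𝓡 7) p)]

/-- The `G₂`-structure is of type `∑_{c ∈ S} 𝒳_c`: `∇φ` takes its values in this module. -/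
def HasType (G : G2Structure N) (S : Set G2Class) : Prop :=
  ∀ p : N, nabla (EuclideanSpace ℝ (Fin 7)) (fun q v => G.φ q v) p ∈
    ⨆ c ∈ S, moduleX (G.φ p) c

end G2Structure

/-! ### `SU(3)`-structures on six-manifolds

An `SU(3)`-structure is given by an almost complex structure `J` and the real and imaginary parts
`ψ₊`, `ψ₋` of a complex volume form. -/

section SU3

variable {M : Type*} [TopologicalSpace M]
  [ChartedSpace (EuclideanSpace ℝ (Fin 6)) M] [IsManifold (𝓡 6) ∞ M]
  [RiemannianBundle (fun p : M => TangentSpace (𝓡 6) p)]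

/-- The Kähler form `ω(x, y) = ⟪x, Jy⟫`. -/
def kahler (J : ∀ p : M, TangentSpace (𝓡 6) p → TangentSpace (𝓡 6) p) (p : M)
    (v : Fin 2 → TangentSpace (𝓡 6) p) : ℝ :=
  inner ℝ (v 0) (J p (v 1))

variable [IsContMDiffRiemannianBundle (𝓡 6) ∞ (EuclideanSpace ℝ (Fin 6))
    (fun p : M => TangentSpace (𝓡 6) p)]

/-- The intrinsic `SU(3)`-torsion at `p`, in the form of the pair `(∇ω, η)`. The one-form `η` is
determined by the `W₅`-part of `∇ψ₊`, which is `-3 Iη ⊗ ψ₋` with `Iη(x) = -η(Jx)`; since `ψ₋` has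
square norm 4 and is orthogonal to the remaining part of `∇_x ψ₊`, this gives
`η(x) = -(1/12) ⟪∇_{Jx} ψ₊, ψ₋⟫`. -/
def torsionSU3 (J : ∀ p : M, TangentSpace (𝓡 6) p → TangentSpace (𝓡 6) p)
    (ψp ψm : ∀ p : M, (Fin 3 → TangentSpace (𝓡 6) p) → ℝ) (p : M) :
    (TangentSpace (𝓡 6) p → TangentSpace (𝓡 6) p → TangentSpace (𝓡 6) p → ℝ) ×
      (TangentSpace (𝓡 6) p → ℝ) :=
  (fun x y z => nabla (EuclideanSpace ℝ (Fin 6)) (kahler J) p x ![y, z],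
    fun x => -(1 / 12) * formInner (nabla (EuclideanSpace ℝ (Fin 6)) ψp p (J p x)) (ψm p))

/-- The `SU(3)`-structure `(J, ψ₊ + i ψ₋)` is of type `∑_{c ∈ S} W_c`. -/
def HasTypeSU3 (J : ∀ p : M, TangentSpace (𝓡 6) p → TangentSpace (𝓡 6) p)
    (ψp ψm : ∀ p : M, (Fin 3 → TangentSpace (𝓡 6) p) → ℝ) (S : Set SU3Class) : Prop :=
  ∀ p : M, torsionSU3 J ψp ψm p ∈ ⨆ c ∈ S, moduleSU3 (J p) (ψp p) c

end SU3

/-! ### Hypersurfaces -/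

section Hypersurface

variable {N : Type*} [TopologicalSpace N]
  [ChartedSpace (EuclideanSpace ℝ (Fin 7)) N] [IsManifold (𝓡 7) ∞ N]
  [RiemannianBundle (fun p : N => TangentSpace (𝓡 7) p)]
  {M : Type*} [TopologicalSpace M]
  [ChartedSpace (EuclideanSpace ℝ (Fin 6)) M] [IsManifold (𝓡 6) ∞ M]
  [RiemannianBundle (fun p : M => TangentSpace (𝓡 6) p)]

/-- `ι : M → N` exhibits `M`, with its Riemannian metric, as an (immersed) hypersurface of the
Riemannian manifold `N`, and `n` is a smooth unit normal vector field. -/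
structure IsHypersurface (ι : M → N) (n : ∀ p : M, TangentSpace (𝓡 7) (ι p)) : Prop where
  smooth : ContMDiff (𝓡 6) (𝓡 7) ∞ ι
  isometric : ∀ (p : M) (x y : TangentSpace (𝓡 6) p),
    inner ℝ (mfderiv (𝓡 6) (𝓡 7) ι p x) (mfderiv (𝓡 6) (𝓡 7) ι p y) = inner ℝ x y
  smooth_normal : ContMDiff (𝓡 6) (𝓡 7).tangent ∞ (fun p => (⟨ι p, n p⟩ : TangentBundle (𝓡 7) N))
  unit : ∀ p, inner ℝ (n p) (n p) = (1 : ℝ)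
  normal : ∀ (p : M) (x : TangentSpace (𝓡 6) p), inner ℝ (n p) (mfderiv (𝓡 6) (𝓡 7) ι p x) = (0 : ℝ)

variable (G : G2Structure N) (ι : M → N) (n : ∀ p : M, TangentSpace (𝓡 7) (ι p)) (θ : M → ℝ)

/-- The induced almost complex structure `Jx = P(n, x)`; that is, `Jx` is the vector tangent to `M`
with `⟪Jx, y⟫ = φ(n, x, y)` for all `y` tangent to `M`. -/
def indJ (p : M) (x : TangentSpace (𝓡 6) p) : TangentSpace (𝓡 6) p :=
  vecOf fun y =>
    G.φ (ι p) ![n p, mfderiv (𝓡 6) (𝓡 7) ι p x, mfderiv (𝓡 6) (𝓡 7) ι p y]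

/-- `ψ₊ = cos θ ι^*φ - sin θ ι^*(n ⌟ ∗φ)`. -/
def indPsiPlus (p : M) (v : Fin 3 → TangentSpace (𝓡 6) p) : ℝ :=
  Real.cos (θ p) * G.φ (ι p) (fun i => mfderiv (𝓡 6) (𝓡 7) ι p (v i)) -
    Real.sin (θ p) *
      interior (n p) (starPhi (G.φ (ι p))) (fun i => mfderiv (𝓡 6) (𝓡 7) ι p (v i))

/-- `ψ₋ = sin θ ι^*φ + cos θ ι^*(n ⌟ ∗φ)`. -/
def indPsiMinus (p : M) (v : Fin 3 → TangentSpace (𝓡 6) p) : ℝ :=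
  Real.sin (θ p) * G.φ (ι p) (fun i => mfderiv (𝓡 6) (𝓡 7) ι p (v i)) +
    Real.cos (θ p) *
      interior (n p) (starPhi (G.φ (ι p))) (fun i => mfderiv (𝓡 6) (𝓡 7) ι p (v i))

/-- `p_φ` is tangent to the hypersurface at each of its points. -/
def PVecTangent : Prop :=
  ∀ p : M, ∃ x : TangentSpace (𝓡 6) p, G.pVec (ι p) = mfderiv (𝓡 6) (𝓡 7) ι p x

variable [IsContMDiffRiemannianBundle (𝓡 7) ∞ (EuclideanSpace ℝ (Fin 7))
    (fun p : N => TangentSpace (𝓡 7) p)]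

/-- The second fundamental form `B(x, y) = ⟪II(x, y), n⟫`, where `II(x, y)` is the normal part of
`∇̄_x Y` for a vector field `Y` on `M` extending `y`. -/
def secondFF (ι : M → N) (n : ∀ p : M, TangentSpace (𝓡 7) (ι p)) (p : M)
    (x y : TangentSpace (𝓡 6) p) : ℝ :=
  inner ℝ (nablaAlong ι (fun q => mfderiv (𝓡 6) (𝓡 7) ι q (constField p y q)) p x) (n p)

/-- The mean curvature `h = ⟪H, n⟫`, where `H = (1/6) Tr II`. -/
def meanCurv (ι : M → N) (n : ∀ p : M, TangentSpace (𝓡 7) (ι p)) (p : M) : ℝ :=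
  (1 / 6) * ∑ i, secondFF ι n p (stdOrthonormalBasis ℝ (TangentSpace (𝓡 6) p) i)
    (stdOrthonormalBasis ℝ (TangentSpace (𝓡 6) p) i)

/-- `M` is a minimal variety. -/
def IsMinimal (ι : M → N) (n : ∀ p : M, TangentSpace (𝓡 7) (ι p)) : Prop :=
  ∀ p : M, meanCurv ι n p = 0

end Hypersurface

end G2Hyp

end

noncomputable section

namespace G2Hyp

open scoped RealInnerProductSpace

/-! ### Sums over orthonormal bases -/

section Sums

variable {V : Type*} [NormedAddCommGroup V] [InnerProductSpace ℝ V]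
  {κ : Type*} [Fintype κ] (b : OrthonormalBasis κ ℝ V)

/-! The theorem reduces, point by point, to linear algebra of endomorphisms. In the ambient tangent
space the covariant derivative of the three-form is `S x ⌟ ∗φ` for an endomorphism `S`, and the
normalisation of `rBar` makes `rBar` return exactly the bilinear form `⟪S x, y⟫` (`rBar_eq`). So
type 𝒳₁ + 𝒳₃ makes `S` symmetric and type 𝒳₂ + 𝒳₄ makes it skew (`exists_symm`, `exists_skew`).

On the hypersurface, an endomorphism `K` of the tangent space gives the torsion `a(x, y, z) = ψ(K x,
y, z)`, and `rMap` recovers `K` from it. Decompose `K` under `J`: the multiples of the identity and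
of `J` give W₁⁺ and W₁⁻; the symmetric and skew pieces of the part that commutes with `J` and has
zero complex trace give W₂⁺ and W₂⁻; the symmetric and skew pieces of the part that anticommutes
with `J` give W₃ and W₄ (`exists_decomposition`). Conversely, the trace of `r(a)` vanishes off W₁
(`trace_eq_zero`), and the map `a ↦ a + a(J·, J·, ·)` followed by `r` gives a skew form off W₃
(`skew_of_mem`). The module W₅ never obstructs, since η is linear (`exists_linear_eta`).

The bridge is `nabla_kahler`: differentiating `ω(y, z) = φ(n, z, y)` along the hypersurface and
inserting the Gauss and Weingarten formulas yields `K = A - J ∘ Sᵀ`, where `A` is the shape operator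
and `Sᵀ` the tangential part of `S`. Twice the part of `K` that anticommutes with `J` is `B - IB`,
which is symmetric, plus a term in `S` that is symmetric or skew together with `S`. Hence there is
no W₄ in (i), and in (iii) the W₃ part vanishes exactly when `IB = B`.

For (ii), `tr K = tr B + ⟪n, ∑ P(eᵢ, S eᵢ)⟫` and, for `S` skew, `tr (J K) = 0`. The vector `∑ P(eᵢ,
S eᵢ)` is a nonzero multiple of `p_φ` (`G2Structure.inner_pVec`), so if `p_φ` is tangent the W₁ part
is governed by `tr B` alone. The phase θ multiplies `K` by a unit complex number, which respects all
the conditions involved (`IsSU3.torsionForm_rotate`). -/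

theorem sum_inner_mul (x : V) (f : V →ₗ[ℝ] ℝ) : ∑ i, ⟪x, b i⟫ * f (b i) = f x := by
  conv_rhs => rw [← b.sum_repr' x]
  simp [real_inner_comm]

theorem sum_inner_mul_inner' (x y : V) : ∑ i, ⟪x, b i⟫ * ⟪y, b i⟫ = ⟪x, y⟫ := by
  simpa [real_inner_comm] using b.sum_inner_mul_inner x y

theorem sum_bilin_eq {κ' : Type*} [Fintype κ'] (b' : OrthonormalBasis κ' ℝ V)
    (g : V →ₗ[ℝ] V →ₗ[ℝ] ℝ) : ∑ i, g (b i) (b i) = ∑ i, g (b' i) (b' i) := by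
  have h1 : ∀ i, g (b i) (b i) = ∑ j, ⟪b i, b' j⟫ * g (b i) (b' j) := fun i =>
    (sum_inner_mul b' (b i) (g (b i))).symm
  have h2 : ∀ j, g (b' j) (b' j) = ∑ i, ⟪b' j, b i⟫ * g (b i) (b' j) := fun j =>
    (sum_inner_mul b (b' j) (g.flip (b' j))).symm
  simp_rw [h1, h2]
  rw [Finset.sum_comm]
  simp_rw [real_inner_comm]

/-- Transposition of an endomorphism under a sum over an orthonormal basis. -/
theorem sum_bilin_adjoint {F F' : V →ₗ[ℝ] V} (hF : ∀ x y, ⟪F x, y⟫ = ⟪x, F' y⟫)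
    (g : V →ₗ[ℝ] V →ₗ[ℝ] ℝ) : ∑ i, g (F (b i)) (b i) = ∑ i, g (b i) (F' (b i)) := by
  have h1 : ∀ i, g (F (b i)) (b i) = ∑ j, ⟪F (b i), b j⟫ * g (b j) (b i) := fun i =>
    (sum_inner_mul b (F (b i)) (g.flip (b i))).symm
  have h2 : ∀ j, g (b j) (F' (b j)) = ∑ i, ⟪F' (b j), b i⟫ * g (b j) (b i) := fun j =>
    (sum_inner_mul b (F' (b j)) (g (b j))).symm
  simp_rw [h1, h2, hF]
  rw [Finset.sum_comm]
  simp_rw [real_inner_comm]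

omit [Fintype κ] in
theorem sum_cyc (s : Finset κ) (f : κ → κ → κ → ℝ) :
    ∑ i ∈ s, ∑ j ∈ s, ∑ k ∈ s, f i j k = ∑ i ∈ s, ∑ j ∈ s, ∑ k ∈ s, f j k i := by
  conv_rhs => rw [Finset.sum_comm]
  exact Finset.sum_congr rfl fun i _ => Finset.sum_comm

theorem sum_fin_two {m : ℕ} (f : (Fin 2 → Fin m) → ℝ) :
    ∑ i, f i = ∑ j, ∑ k, f ![j, k] := by
  rw [← Fintype.sum_prod_type' (f := fun j k => f ![j, k])]
  exact Fintype.sum_equiv (finTwoArrowEquiv (Fin m)) _ _ fun i => congrArg f (by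
    ext j; fin_cases j <;> rfl)

theorem sum_fin_three {m : ℕ} (f : (Fin 3 → Fin m) → ℝ) :
    ∑ i, f i = ∑ j, ∑ k, ∑ l, f ![j, k, l] := by
  rw [← Equiv.sum_comp (Fin.consEquiv fun _ : Fin 3 => Fin m), Fintype.sum_prod_type]
  exact Finset.sum_congr rfl fun j _ => sum_fin_two _

end Sums

/-! ### The linear algebra of `SU(3)`-structures -/

section SU3Algebra

variable {T : Type*} [NormedAddCommGroup T] [InnerProductSpace ℝ T]

/-- An `SU(3)`-structure on a Euclidean space: an orthogonal complex structure `J` and the real part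
`⟪Q x y, z⟫` of a complex volume form. -/
structure IsSU3 (J : T →ₗ[ℝ] T) (Q : T →ₗ[ℝ] T →ₗ[ℝ] T) : Prop where
  J_J : ∀ x, J (J x) = -x
  inner_J : ∀ x y, ⟪x, J y⟫ = -⟪J x, y⟫
  swap : ∀ x y, Q x y = -Q y x
  cyc : ∀ x y z, ⟪Q x y, z⟫ = ⟪Q y z, x⟫
  J_left : ∀ x y, Q (J x) y = -J (Q x y)
  norm : ∀ x y, ⟪Q x y, Q x y⟫ = ⟪x, x⟫ * ⟪y, y⟫ - ⟪x, y⟫ ^ 2 - ⟪J x, y⟫ ^ 2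

namespace IsSU3

variable {J : T →ₗ[ℝ] T} {Q : T →ₗ[ℝ] T →ₗ[ℝ] T} (h : IsSU3 J Q)
include h

theorem J_right (x y : T) : Q x (J y) = -J (Q x y) := by
  rw [h.swap, h.J_left, h.swap y x]; simp

theorem J_move (x y : T) : Q (J x) y = Q x (J y) := by rw [h.J_left, h.J_right]

theorem inner_J_J (x y : T) : ⟪J x, J y⟫ = ⟪x, y⟫ := by
  rw [h.inner_J, h.J_J]; simp

theorem inner_J_self (x : T) : ⟪J x, x⟫ = 0 := by
  have := h.inner_J x x
  rw [real_inner_comm] at this; linarith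

theorem self (x : T) : Q x x = 0 := by
  have : (2 : ℝ) • Q x x = 0 := by
    rw [two_smul]; nth_rewrite 1 [h.swap]; simp
  simpa using this

theorem J_self (x : T) : Q (J x) x = 0 := by rw [h.J_left, h.self]; simp

theorem self_J (x : T) : Q x (J x) = 0 := by rw [h.J_right, h.self]; simp

theorem cyc' (x y z : T) : ⟪Q x y, z⟫ = ⟪x, Q y z⟫ := by rw [h.cyc, real_inner_comm]

/-- Polarising the norm identity twice only gives a sum of two such products. Replacing `a, b` by `J
a, J b` reverses the sign of one of them and keeps the other, so subtracting the two relations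
isolates a single product. -/
theorem inner_Q_Q (a b c d : T) : ⟪Q a b, Q c d⟫ =
    ⟪a, c⟫ * ⟪b, d⟫ - ⟪a, d⟫ * ⟪b, c⟫ - ⟪J a, c⟫ * ⟪J b, d⟫ + ⟪J a, d⟫ * ⟪J b, c⟫ := by
  have pol1 : ∀ a c b, ⟪Q a b, Q c b⟫ = ⟪a, c⟫ * ⟪b, b⟫ - ⟪a, b⟫ * ⟪c, b⟫ - ⟪J a, b⟫ * ⟪J c, b⟫ := by
    intro a c b
    have h1 := h.norm (a + c) b
    have h2 := h.norm a b
    have h3 := h.norm c b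
    simp only [map_add, LinearMap.add_apply, inner_add_left, inner_add_right] at h1
    rw [real_inner_comm (Q a b) (Q c b), real_inner_comm a c] at h1
    linarith
  have pol2 : ∀ a b c d, ⟪Q a b, Q c d⟫ + ⟪Q a d, Q c b⟫ = 2 * ⟪a, c⟫ * ⟪b, d⟫ -
      ⟪a, b⟫ * ⟪c, d⟫ - ⟪a, d⟫ * ⟪c, b⟫ - ⟪J a, b⟫ * ⟪J c, d⟫ - ⟪J a, d⟫ * ⟪J c, b⟫ := by
    intro a b c d
    have h1 := pol1 a c (b + d)
    have h2 := pol1 a c b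
    have h3 := pol1 a c d
    simp only [map_add, inner_add_left, inner_add_right] at h1
    rw [real_inner_comm b d] at h1
    linarith
  have h1 := pol2 a b c d
  have h2 := pol2 (J a) (J b) c d
  simp only [h.J_left, h.J_right, h.inner_J_J, h.J_J, map_neg, inner_neg_left, inner_neg_right,
    neg_neg] at h2
  rw [h.inner_J c b, h.inner_J a b] at h2
  have h3 : ⟪J c, b⟫ = -⟪J b, c⟫ := by rw [real_inner_comm, h.inner_J]
  rw [h3, real_inner_comm b c] at h1 h2
  linarith

/-- A unitary frame in which the complex volume form is standard. -/
structure IsFrame (J : T →ₗ[ℝ] T) (Q : T →ₗ[ℝ] T →ₗ[ℝ] T) (e : Fin 3 → T) : Prop where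
  orth : ∀ a b, ⟪e a, e b⟫ = if a = b then 1 else 0
  orthJ : ∀ a b, ⟪J (e a), e b⟫ = 0
  q01 : Q (e 0) (e 1) = e 2
  q12 : Q (e 1) (e 2) = e 0
  q20 : Q (e 2) (e 0) = e 1

omit h in
theorem IsFrame.orthonormal {e : Fin 3 → T} (h : IsSU3 J Q) (he : IsFrame J Q e) :
    Orthonormal ℝ (Sum.elim e fun a => J (e a)) := by
  rw [orthonormal_iff_ite]
  rintro (a | a) (b | b)
  · simp [he.orth]
  · simp [h.inner_J, he.orthJ]
  · simp [he.orthJ]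
  · simp [h.inner_J_J, he.orth]

end IsSU3

variable [FiniteDimensional ℝ T]

namespace IsSU3

variable {J : T →ₗ[ℝ] T} {Q : T →ₗ[ℝ] T →ₗ[ℝ] T} (h : IsSU3 J Q) (h6 : Module.finrank ℝ T = 6)
include h h6

/-- Take a unit vector `u`, a unit vector `v` orthogonal to the complex line of `u`, and complete
the frame by `Q u v`. The norm identity makes the third vector a unit vector, and the remaining
products follow from `inner_Q_Q`. -/
theorem exists_frame : ∃ e : Fin 3 → T, IsFrame J Q e := by
  have : Nontrivial T := Module.nontrivial_of_finrank_pos (R := ℝ) (by omega)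
  obtain ⟨u, hu⟩ := exists_norm_eq T zero_le_one
  let K : Submodule ℝ T := Submodule.span ℝ {u, J u}
  have hK : Module.finrank ℝ K ≤ 2 := by
    classical
    have := finrank_span_finset_le_card (R := ℝ) ({u, J u} : Finset T)
    rw [Finset.coe_pair] at this
    exact this.trans Finset.card_le_two
  have hK' : Kᗮ ≠ ⊥ := by
    intro h0
    have := K.finrank_add_finrank_orthogonal
    rw [h0, finrank_bot] at this; omega
  obtain ⟨w, hw, hw0⟩ := Submodule.exists_mem_ne_zero_of_ne_bot hK'
  have hv1 : ⟪u, w⟫ = 0 := hw u (Submodule.subset_span (by simp))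
  have hv2 : ⟪J u, w⟫ = 0 := hw (J u) (Submodule.subset_span (by simp))
  obtain ⟨v, hvv, huv, hJuv⟩ : ∃ v : T, ⟪v, v⟫ = 1 ∧ ⟪u, v⟫ = 0 ∧ ⟪J u, v⟫ = 0 := by
    refine ⟨‖w‖⁻¹ • w, ?_, by simp [inner_smul_right, hv1], by simp [inner_smul_right, hv2]⟩
    have : ‖w‖ ≠ 0 := norm_ne_zero_iff.2 hw0
    simp only [inner_smul_left, inner_smul_right, real_inner_self_eq_norm_sq]
    simp; field_simp
  have huu : ⟪u, u⟫ = 1 := by rw [real_inner_self_eq_norm_sq, hu]; norm_num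
  have hv : ‖v‖ = 1 := by
    have := real_inner_self_eq_norm_sq v
    rw [hvv] at this
    nlinarith [norm_nonneg v]
  have hvu : ⟪v, u⟫ = 0 := by rw [real_inner_comm, huv]
  have hJvu : ⟪J v, u⟫ = 0 := by rw [real_inner_comm, h.inner_J, hJuv, neg_zero]
  have q12 : Q v (Q u v) = u := by
    refine ext_inner_right ℝ fun z => ?_
    rw [h.swap, inner_neg_left, h.cyc', h.inner_Q_Q]
    simp [huv, hJuv, hv, h.inner_J_self]
  have q20 : Q (Q u v) u = v := by
    refine ext_inner_right ℝ fun z => ?_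
    rw [h.cyc', h.inner_Q_Q]
    simp [hvu, hJvu, hu, h.inner_J_self]
  have o1 : ⟪u, Q u v⟫ = 0 := by rw [← h.cyc', h.self]; simp
  have o2 : ⟪v, Q u v⟫ = 0 := by rw [← h.cyc', ← h.cyc, h.self]; simp
  have o3 : ⟪J u, Q u v⟫ = 0 := by rw [← h.cyc', h.J_self]; simp
  have o4 : ⟪J v, Q u v⟫ = 0 := by rw [← h.cyc', ← h.cyc, h.self_J]; simp
  have o5 : ⟪Q u v, Q u v⟫ = 1 := by rw [h.norm, huu, hvv, huv, hJuv]; norm_num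
  have o6 : ‖Q u v‖ = 1 := by
    have := real_inner_self_eq_norm_sq (Q u v)
    rw [o5] at this
    nlinarith [norm_nonneg (Q u v)]
  have sk : ∀ x y : T, ⟪J x, y⟫ = -⟪J y, x⟫ := fun x y => by rw [real_inner_comm, h.inner_J]
  refine ⟨![u, v, Q u v], ⟨?_, ?_, rfl, q12, q20⟩⟩
  · intro a b
    fin_cases a <;> fin_cases b <;>
      simp [hu, hv, huv, hvu, o1, o2, o6, real_inner_comm u, real_inner_comm v (Q u v)]
  · intro a b
    fin_cases a <;> fin_cases b <;>
      simp [hJuv, hJvu, o3, o4, h.inner_J_self, sk (Q u v) u, sk (Q u v) v]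

/-- The orthonormal basis defined by a unitary frame. -/
theorem exists_basis {e : Fin 3 → T} (he : IsFrame J Q e) :
    ∃ b : OrthonormalBasis (Fin 3 ⊕ Fin 3) ℝ T, ∀ i, b i = Sum.elim e (fun a => J (e a)) i := by
  have ho := IsFrame.orthonormal h he
  have hspan : Submodule.span ℝ (Set.range (Sum.elim e fun a => J (e a))) = ⊤ :=
    ho.linearIndependent.span_eq_top_of_card_eq_finrank' (by simp [h6])
  exact ⟨OrthonormalBasis.mk ho hspan.ge, fun i => by simp⟩

theorem frame_ext {e : Fin 3 → T} (he : IsFrame J Q e) {W : Type*} [AddCommGroup W] [Module ℝ W]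
    {f : T →ₗ[ℝ] W} (h1 : ∀ a, f (e a) = 0) (h2 : ∀ a, f (J (e a)) = 0) : f = 0 := by
  obtain ⟨b, hb⟩ := h.exists_basis h6 he
  refine b.toBasis.ext fun i => ?_
  rw [OrthonormalBasis.coe_toBasis, hb]
  rcases i with a | a
  · simpa using h1 a
  · simpa using h2 a

theorem trace_eq {e : Fin 3 → T} (he : IsFrame J Q e) (C : T →ₗ[ℝ] T)
    (hC : ∀ x, C (J x) = J (C x)) : LinearMap.trace ℝ T C = 2 * ∑ a, ⟪C (e a), e a⟫ := by
  obtain ⟨b, hb⟩ := h.exists_basis h6 he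
  rw [LinearMap.trace_eq_sum_inner C b]
  simp only [hb, Fintype.sum_sum_type, Sum.elim_inl, Sum.elim_inr, hC, h.inner_J_J]
  rw [two_mul]
  simp_rw [real_inner_comm]

/-- A complex-valued three-form of type `(3, 0)` vanishes if it vanishes on a unitary frame. -/
theorem threeForm_eq_zero {e : Fin 3 → T} (he : IsFrame J Q e) (D : T →ₗ[ℝ] T →ₗ[ℝ] T →ₗ[ℝ] ℝ)
    (s1 : ∀ x y z, D x y z = -D y x z) (s2 : ∀ x y z, D x y z = -D x z y)
    (j1 : ∀ x y z, D (J x) y z = D x (J y) z) (h0 : D (e 0) (e 1) (e 2) = 0)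
    (hJ : D (J (e 0)) (e 1) (e 2) = 0) : D = 0 := by
  have j2 : ∀ x y z, D x y (J z) = D (J x) y z := fun x y z => by
    rw [s2, ← j1, s2, neg_neg]
  -- Skew forms on three vectors are determined by one value; this is applied both to `D` and to
  -- `D(J ·, ·, ·)`, which play the roles of real and imaginary parts.
  have key : ∀ D' : T →ₗ[ℝ] T →ₗ[ℝ] T →ₗ[ℝ] ℝ, (∀ x y z, D' x y z = -D' y x z) →
      (∀ x y z, D' x y z = -D' x z y) → D' (e 0) (e 1) (e 2) = 0 →
      ∀ a b c, D' (e a) (e b) (e c) = 0 := by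
    intro D' s1 s2 h0 a b c
    have r1 : ∀ x y, D' x x y = 0 := fun x y => by linarith [s1 x x y]
    have r2 : ∀ x y, D' x y y = 0 := fun x y => by linarith [s2 x y y]
    have r3 : ∀ x y, D' x y x = 0 := fun x y => by rw [s2, r1, neg_zero]
    have p1 : D' (e 1) (e 0) (e 2) = 0 := by rw [s1, h0, neg_zero]
    have p2 : D' (e 0) (e 2) (e 1) = 0 := by rw [s2, h0, neg_zero]
    have p3 : D' (e 1) (e 2) (e 0) = 0 := by rw [s2, p1, neg_zero]
    have p4 : D' (e 2) (e 0) (e 1) = 0 := by rw [s1, p2, neg_zero]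
    have p5 : D' (e 2) (e 1) (e 0) = 0 := by rw [s2, p4, neg_zero]
    fin_cases a <;> fin_cases b <;> fin_cases c <;> first | apply r1 | apply r2 | apply r3 | assumption
  have k1 := key D s1 s2 h0
  have k2 := key (D ∘ₗ J) (fun x y z => by
    simp only [LinearMap.comp_apply]; rw [j1, s1]) (fun x y z => by
    simp only [LinearMap.comp_apply]; rw [s2]) hJ
  simp only [LinearMap.comp_apply] at k2
  have k3 : ∀ a b, D (e a) (e b) = 0 := fun a b => h.frame_ext h6 he (k1 a b) fun c => by
    rw [j2, k2]
  have k4 : ∀ a b, D (J (e a)) (e b) = 0 := fun a b => h.frame_ext h6 he (k2 a b) fun c => by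
    rw [j2, h.J_J]; simp [k1]
  have k5 : ∀ a b, D (e a) (J (e b)) = 0 := fun a b => by
    ext z; rw [← j1, k4]
  have k6 : ∀ a b, D (J (e a)) (J (e b)) = 0 := fun a b => by
    ext z; rw [← j1, h.J_J]; simp [k3]
  exact h.frame_ext h6 he (fun a => h.frame_ext h6 he (k3 a) (k5 a))
    fun a => h.frame_ext h6 he (k4 a) (k6 a)

/-- An endomorphism that commutes with `J` and has zero complex trace annihilates the complex volume
form. -/
theorem cyclic_sum_eq_zero (C : T →ₗ[ℝ] T) (hC : ∀ x, C (J x) = J (C x))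
    (ht : LinearMap.trace ℝ T C = 0) (htJ : LinearMap.trace ℝ T (J ∘ₗ C) = 0) (x y z : T) :
    ⟪Q (C x) y, z⟫ + ⟪Q (C y) z, x⟫ + ⟪Q (C z) x, y⟫ = 0 := by
  obtain ⟨e, he⟩ := h.exists_frame h6
  have hJC : ∀ x, (J ∘ₗ C) (J x) = J ((J ∘ₗ C) x) := fun x => by simp [hC]
  rw [h.trace_eq h6 he C hC] at ht
  rw [h.trace_eq h6 he _ hJC] at htJ
  simp only [Fin.sum_univ_three, LinearMap.comp_apply] at ht htJ
  -- The derivation action of `C` on the volume form. It is again of type (3, 0) because `C`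
  -- commutes with `J`, so it is the complex trace of `C` times the volume form; the two values on
  -- the frame are half the traces of `C` and of `J ∘ C`.
  let D : T →ₗ[ℝ] T →ₗ[ℝ] T →ₗ[ℝ] ℝ :=
    (Q.compr₂ (innerₗ T)) ∘ₗ C + (Q.compr₂ (innerₗ T)).compl₂ C +
      (Q.compr₂ ((innerₗ T).compl₂ C))
  have hD : ∀ x y z, D x y z = ⟪Q (C x) y, z⟫ + ⟪Q x (C y), z⟫ + ⟪Q x y, C z⟫ := fun x y z => by
    simp [D]
  have : D = 0 := by
    refine h.threeForm_eq_zero h6 he D ?_ ?_ ?_ ?_ ?_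
    · intro x y z
      rw [hD, hD, h.swap (C x) y, h.swap x (C y), h.swap x y]
      simp only [inner_neg_left]; ring
    · intro x y z
      rw [hD, hD, h.cyc (C x) y z, h.cyc x (C y) z, h.cyc x y (C z), h.cyc (C x) z y,
        h.cyc x (C z) y, h.cyc x z (C y), h.swap y z, h.swap (C y) z, h.swap y (C z)]
      simp only [inner_neg_left]; ring
    · intro x y z
      rw [hD, hD, hC, hC, h.J_move, h.J_move x, h.J_move x]
    · have e1 : ⟪Q (C (e 0)) (e 1), e 2⟫ = ⟪C (e 0), e 0⟫ := by rw [h.cyc', he.q12]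
      have e2 : ⟪Q (e 0) (C (e 1)), e 2⟫ = ⟪C (e 1), e 1⟫ := by
        rw [h.cyc, h.cyc', he.q20]
      rw [hD, e1, e2, he.q01, real_inner_comm (C (e 2))]
      linarith
    · have e1 : ⟪Q (C (J (e 0))) (e 1), e 2⟫ = ⟪J (C (e 0)), e 0⟫ := by rw [hC, h.cyc', he.q12]
      have e2 : ⟪Q (J (e 0)) (C (e 1)), e 2⟫ = ⟪J (C (e 1)), e 1⟫ := by
        rw [h.J_move, h.cyc, h.cyc', he.q20]
      have e3 : ⟪Q (J (e 0)) (e 1), C (e 2)⟫ = ⟪J (C (e 2)), e 2⟫ := by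
        rw [h.J_left, he.q01, inner_neg_left, ← h.inner_J, real_inner_comm]
      rw [hD, e1, e2, e3]
      linarith
  have h3 := hD x y z
  rw [this] at h3
  rw [← h.cyc x (C y) z, h.cyc (C z) x y]
  simp only [LinearMap.zero_apply] at h3
  exact h3.symm

end IsSU3
end SU3Algebra

/-! ### Torsion tensors of an SU(3)-structure as endomorphisms -/

section SU3Modules

variable {T : Type*} [NormedAddCommGroup T] [InnerProductSpace ℝ T]

/-- The trilinear form `a(x, y, z) = ψ(K x, y, z)`, where `ψ(x, y, z) = ⟪Q x y, z⟫`. -/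
def torsionForm (Q : T →ₗ[ℝ] T →ₗ[ℝ] T) : (T →ₗ[ℝ] T) →ₗ[ℝ] (T → T → T → ℝ) where
  toFun K := fun x y z => ⟪Q (K x) y, z⟫
  map_add' K L := by ext x y z; simp [inner_add_left]
  map_smul' c K := by ext x y z; simp [inner_smul_left]

theorem torsionForm_apply (Q : T →ₗ[ℝ] T →ₗ[ℝ] T) (K : T →ₗ[ℝ] T) (x y z : T) :
    torsionForm Q K x y z = ⟪Q (K x) y, z⟫ := rfl

/-- The three-form `ψ(x, y, z) = ⟪Q x y, z⟫`. -/
def volForm (Q : T →ₗ[ℝ] T →ₗ[ℝ] T) (v : Fin 3 → T) : ℝ := ⟪Q (v 0) (v 1), v 2⟫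

variable [FiniteDimensional ℝ T]

theorem trace_adjoint (A : T →ₗ[ℝ] T) :
    LinearMap.trace ℝ T (LinearMap.adjoint A) = LinearMap.trace ℝ T A := by
  rw [LinearMap.trace_eq_sum_inner _ (stdOrthonormalBasis ℝ T),
    LinearMap.trace_eq_sum_inner _ (stdOrthonormalBasis ℝ T)]
  simp only [LinearMap.adjoint_inner_right, real_inner_comm]

theorem smul_add_adjoint_symm (c : ℝ) (A : T →ₗ[ℝ] T) (x y : T) :
    ⟪(c • (A + LinearMap.adjoint A)) x, y⟫ = ⟪x, (c • (A + LinearMap.adjoint A)) y⟫ := by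
  simp only [LinearMap.smul_apply, LinearMap.add_apply, real_inner_smul_left,
    real_inner_smul_right, inner_add_left, inner_add_right, LinearMap.adjoint_inner_left,
    LinearMap.adjoint_inner_right]
  ring

theorem smul_sub_adjoint_skew (c : ℝ) (A : T →ₗ[ℝ] T) (x y : T) :
    ⟪(c • (A - LinearMap.adjoint A)) x, y⟫ = -⟪x, (c • (A - LinearMap.adjoint A)) y⟫ := by
  simp only [LinearMap.smul_apply, LinearMap.sub_apply, real_inner_smul_left,
    real_inner_smul_right, inner_sub_left, inner_sub_right, LinearMap.adjoint_inner_left,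
    LinearMap.adjoint_inner_right]
  ring

theorem mem_type_of_mem {J : T → T} {ψ : (Fin 3 → T) → ℝ} {S : Set SU3Class}
    {c : SU3Class} (hc : c ∈ S) {τ : (T → T → T → ℝ) × (T → ℝ)} (hτ : τ ∈ moduleSU3 J ψ c) :
    τ ∈ ⨆ c ∈ S, moduleSU3 J ψ c :=
  Submodule.mem_iSup_of_mem c (Submodule.mem_iSup_of_mem hc hτ)

theorem sum_prod_eq {A B : Type*} [AddCommGroup A] [AddCommGroup B]
    (a₁ a₂ a₃ a₄ a₅ : A) (η : B) : (a₁ + a₂ + a₃ + a₄ + a₅, η) =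
      (a₁, 0) + (a₂, 0) + (a₃, 0) + (a₄, 0) + (a₅, 0) + (0, η) := by
  simp

/-- One of the two sums in the scalar product of two-forms reassembles the vector `Q y u`. The
factor is `1/2` from the definition of `r` times `1/2!` from the scalar product. -/
theorem rMap_eq {κ : Type*} [Fintype κ] (b : OrthonormalBasis κ ℝ T)
    (Q : T →ₗ[ℝ] T →ₗ[ℝ] T) (a : T → T → T → ℝ)
    (A : T →ₗ[ℝ] T →ₗ[ℝ] T →ₗ[ℝ] ℝ) (hA : ∀ x y z, a x y z = A x y z) (x y : T) :
    rMap (volForm Q) a x y = (1 / 4) * ∑ j, a x (b j) (Q y (b j)) := by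
  have h1 : ∀ u, ∑ k, a x u (stdOrthonormalBasis ℝ T k) * ⟪Q y u, stdOrthonormalBasis ℝ T k⟫ =
      a x u (Q y u) := fun u => by
    simp only [hA, mul_comm (A x u _)]
    exact sum_inner_mul _ _ (A x u)
  have h2 : ∑ j, a x (b j) (Q y (b j)) =
      ∑ j, a x (stdOrthonormalBasis ℝ T j) (Q y (stdOrthonormalBasis ℝ T j)) := by
    simp_rw [hA]
    exact sum_bilin_eq b _ ((A x).compl₂ (Q y))
  rw [h2]
  simp only [rMap, LinearMap.coe_mk, AddHom.coe_mk, formInner, interior, volForm]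
  rw [sum_fin_two]
  have h3 : ∀ j k, a x (stdOrthonormalBasis ℝ T j) (stdOrthonormalBasis ℝ T k) *
      ⟪Q y (stdOrthonormalBasis ℝ T j), stdOrthonormalBasis ℝ T k⟫ =
    a x (stdOrthonormalBasis ℝ T (![j, k] 0)) (stdOrthonormalBasis ℝ T (![j, k] 1)) *
      ⟪Q (Matrix.vecCons y (fun i => stdOrthonormalBasis ℝ T (![j, k] i)) 0)
        (Matrix.vecCons y (fun i => stdOrthonormalBasis ℝ T (![j, k] i)) 1),
        Matrix.vecCons y (fun i => stdOrthonormalBasis ℝ T (![j, k] i)) 2⟫ := fun _ _ => rfl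
  simp only [← h3, h1]
  norm_num [Nat.factorial]
  ring

theorem contr_eq {κ : Type*} [Fintype κ] (b : OrthonormalBasis κ ℝ T) (a : T → T → T → ℝ)
    (A : T →ₗ[ℝ] T →ₗ[ℝ] T →ₗ[ℝ] ℝ) (hA : ∀ x y z, a x y z = A x y z) (z : T) :
    contr a z = ∑ i, a (b i) (b i) z := by
  simp only [contr, LinearMap.coe_mk, AddHom.coe_mk, hA]
  exact sum_bilin_eq _ b (A.compr₂ (LinearMap.applyₗ z))

namespace IsSU3

variable {J : T →ₗ[ℝ] T} {Q : T →ₗ[ℝ] T →ₗ[ℝ] T} (h : IsSU3 J Q) (h6 : Module.finrank ℝ T = 6)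
include h

omit h [FiniteDimensional ℝ T] in
/-- The trilinear map underlying `torsionForm`. -/
theorem torsionForm_trilin (K : T →ₗ[ℝ] T) : ∃ A : T →ₗ[ℝ] T →ₗ[ℝ] T →ₗ[ℝ] ℝ,
    ∀ x y z, torsionForm Q K x y z = A x y z :=
  ⟨(Q.compr₂ (innerₗ T)) ∘ₗ K, fun x y z => by simp [torsionForm]⟩

omit [FiniteDimensional ℝ T] in
theorem torsionForm_mem (K : T →ₗ[ℝ] T) : torsionForm Q K ∈ spaceW J := by
  refine ⟨torsionForm_trilin K, fun x y z => ?_, fun x y z => ?_⟩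
  · simp only [torsionForm_apply]
    rw [h.cyc, h.cyc _ z y, h.swap]; simp
  · simp only [torsionForm_apply]
    rw [h.J_right, inner_neg_left, h.inner_J_J, neg_neg]

omit [FiniteDimensional ℝ T] in
theorem sum_J_inner {κ : Type*} [Fintype κ] (b : OrthonormalBasis κ ℝ T) (x y : T) :
    ∑ j, ⟪J x, b j⟫ * ⟪J (b j), y⟫ = - ⟪x, y⟫ := by
  have : ∀ j, ⟪J (b j), y⟫ = -⟪J y, b j⟫ := fun j => by rw [real_inner_comm, h.inner_J]
  simp_rw [this, mul_neg, Finset.sum_neg_distrib, sum_inner_mul_inner', h.inner_J_J]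

omit [FiniteDimensional ℝ T] in
include h6 in
-- In `inner_Q_Q` the three surviving terms contribute 6, -1 and -1. This 4 is what the factor `1/4`
-- of `rMap_eq` cancels.
theorem sum_inner_Q {κ : Type*} [Fintype κ] (b : OrthonormalBasis κ ℝ T) (x y : T) :
    ∑ j, ⟪Q x (b j), Q y (b j)⟫ = 4 * ⟪x, y⟫ := by
  have h1 : ∀ j, ⟪Q x (b j), Q y (b j)⟫ =
      ⟪x, y⟫ - ⟪x, b j⟫ * ⟪y, b j⟫ + ⟪J x, b j⟫ * ⟪J (b j), y⟫ := fun j => by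
    have h0 : ⟪b j, b j⟫ = (1 : ℝ) := by rw [real_inner_self_eq_norm_sq, b.norm_eq_one]; norm_num
    rw [h.inner_Q_Q, h.inner_J_self, h0, real_inner_comm y (b j)]
    ring
  have hc : (Fintype.card κ : ℝ) = 6 := by
    rw [← Module.finrank_eq_card_basis b.toBasis, h6]; norm_num
  simp_rw [h1, Finset.sum_add_distrib, Finset.sum_sub_distrib, sum_inner_mul_inner', h.sum_J_inner]
  simp [hc]; ring

include h6 in
-- This makes `r` a left inverse of `torsionForm`: symmetry of `r(a)` becomes symmetry of the
-- endomorphism, which is how the signs in W₁^± and W₂^± are decided.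
theorem rMap_torsionForm (K : T →ₗ[ℝ] T) (x y : T) :
    rMap (volForm Q) (torsionForm Q K) x y = ⟪K x, y⟫ := by
  obtain ⟨A, hA⟩ := torsionForm_trilin K
  rw [rMap_eq (stdOrthonormalBasis ℝ T) Q _ A hA]
  simp only [torsionForm_apply, h.sum_inner_Q h6]
  ring

include h6 in
theorem torsionForm_mem_rSymm {K : T →ₗ[ℝ] T} (hK : ∀ x y, ⟪K x, y⟫ = ⟪x, K y⟫) :
    torsionForm Q K ∈ rSymm (volForm Q) := fun x y => by
  rw [h.rMap_torsionForm h6, h.rMap_torsionForm h6, hK, real_inner_comm]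

include h6 in
theorem torsionForm_mem_rSkew {K : T →ₗ[ℝ] T} (hK : ∀ x y, ⟪K x, y⟫ = -⟪x, K y⟫) :
    torsionForm Q K ∈ rSkew (volForm Q) := fun x y => by
  rw [h.rMap_torsionForm h6, h.rMap_torsionForm h6, hK, real_inner_comm]

omit [FiniteDimensional ℝ T] in
theorem torsionForm_id_mem : torsionForm Q LinearMap.id ∈ moduleW₁ J :=
  ⟨h.torsionForm_mem _, fun x z => by simp [torsionForm_apply, h.self]⟩

omit [FiniteDimensional ℝ T] in
theorem torsionForm_J_mem : torsionForm Q J ∈ moduleW₁ J :=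
  ⟨h.torsionForm_mem _, fun x z => by simp [torsionForm_apply, h.J_self]⟩

include h6 in
theorem torsionForm_mem_W₂ {C : T →ₗ[ℝ] T} (hC : ∀ x, C (J x) = J (C x))
    (ht : LinearMap.trace ℝ T C = 0) (htJ : LinearMap.trace ℝ T (J ∘ₗ C) = 0) :
    torsionForm Q C ∈ moduleW₂ J :=
  ⟨h.torsionForm_mem _, h.cyclic_sum_eq_zero h6 C hC ht htJ⟩

omit [FiniteDimensional ℝ T] in
theorem torsionForm_J_J {F : T →ₗ[ℝ] T} (hF : ∀ x, F (J x) = -J (F x)) (x y z : T) :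
    torsionForm Q F (J x) (J y) z = torsionForm Q F x y z := by
  simp [torsionForm_apply, hF, h.J_left, h.J_right, h.J_J]

/-- Invariance under `J` comes from anticommutation. The contraction vanishes because the symmetric
`F` can be moved to the other argument of `Q` under the sum, while `Q` is skew. -/
theorem torsionForm_mem_W₃ {F : T →ₗ[ℝ] T} (hF : ∀ x, F (J x) = -J (F x))
    (hs : ∀ x y, ⟪F x, y⟫ = ⟪x, F y⟫) : torsionForm Q F ∈ moduleW₃ J := by
  refine ⟨h.torsionForm_mem _, fun x y z => (h.torsionForm_J_J hF x y z).symm, ?_⟩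
  ext z
  let b := stdOrthonormalBasis ℝ T
  change ∑ i, ⟪Q (F (b i)) (b i), z⟫ = 0
  have h1 : ∑ i, ⟪Q (F (b i)) (b i), z⟫ = ∑ i, ⟪Q (b i) (F (b i)), z⟫ :=
    sum_bilin_adjoint b hs (Q.compr₂ ((innerₗ T).flip z))
  have h2 : ∑ i, ⟪Q (b i) (F (b i)), z⟫ = -∑ i, ⟪Q (F (b i)) (b i), z⟫ := by
    rw [← Finset.sum_neg_distrib]
    exact Finset.sum_congr rfl fun i _ => by rw [h.swap, inner_neg_left]
  linarith

include h6 in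
/-- A skew endomorphism that anticommutes with `J` is of the form `Q b`. -/
theorem exists_eq_Q {F : T →ₗ[ℝ] T} (hF : ∀ x, F (J x) = -J (F x))
    (hs : ∀ x y, ⟪F x, y⟫ = -⟪x, F y⟫) : ∃ b, F = Q b := by
  obtain ⟨e, he⟩ := h.exists_frame h6
  -- `c` and `d` are the coordinates of `b` in the frame, forced by `⟪Q b x, y⟫ = ⟪b, Q x y⟫` and
  -- the multiplication table of the frame; the signs in `d` come from `Q x (J y) = -J (Q x y)`.
  let c : Fin 3 → ℝ := ![⟪F (e 1), e 2⟫, ⟪F (e 2), e 0⟫, ⟪F (e 0), e 1⟫]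
  let d : Fin 3 → ℝ := ![-⟪F (e 1), J (e 2)⟫, -⟪F (e 2), J (e 0)⟫, -⟪F (e 0), J (e 1)⟫]
  let b : T := ∑ a, (c a • e a + d a • J (e a))
  have hc : ∀ a, ⟪b, e a⟫ = c a := fun a => by
    simp [b, sum_inner, inner_add_left, inner_smul_left, he.orth, he.orthJ]
  have hd : ∀ a, ⟪b, J (e a)⟫ = d a := fun a => by
    simp [b, sum_inner, inner_add_left, inner_smul_left, he.orth, he.orthJ, h.J_J, h.inner_J]
  let g : T →ₗ[ℝ] T := F - Q b
  have gx : ∀ x, g x = F x - Q b x := fun x => rfl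
  have gs : ∀ x y, ⟪g x, y⟫ = -⟪g y, x⟫ := fun x y => by
    rw [gx, gx, inner_sub_left, inner_sub_left, hs, h.cyc', h.cyc', h.swap x y, inner_neg_right,
      real_inner_comm]
    ring
  have gJ : ∀ x y, ⟪g x, J y⟫ = -⟪g y, J x⟫ := fun x y => by
    have : ∀ x, g (J x) = -J (g x) := fun x => by rw [gx, gx, hF, h.J_right, map_sub]; abel
    rw [gs, this, inner_neg_left, neg_neg, real_inner_comm, h.inner_J, real_inner_comm]
  refine ⟨b, sub_eq_zero.1 (?_ : g = 0)⟩
  have key : ∀ G : T → T → ℝ, (∀ x y, G x y = -G y x) → G (e 0) (e 1) = 0 → G (e 1) (e 2) = 0 →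
      G (e 2) (e 0) = 0 → ∀ i j, G (e i) (e j) = 0 := by
    intro G s p1 p2 p3 i j
    have r : ∀ x, G x x = 0 := fun x => by linarith [s x x]
    have q1 : G (e 1) (e 0) = 0 := by rw [s, p1, neg_zero]
    have q2 : G (e 2) (e 1) = 0 := by rw [s, p2, neg_zero]
    have q3 : G (e 0) (e 2) = 0 := by rw [s, p3, neg_zero]
    fin_cases i <;> fin_cases j <;> first | apply r | assumption
  have k1 := key (fun x y => ⟪g x, y⟫) gs
    (by simp only [gx, inner_sub_left, h.cyc', he.q01, hc]; simp [c])
    (by simp only [gx, inner_sub_left, h.cyc', he.q12, hc]; simp [c])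
    (by simp only [gx, inner_sub_left, h.cyc', he.q20, hc]; simp [c])
  have k2 := key (fun x y => ⟪g x, J y⟫) gJ
    (by simp only [gx, inner_sub_left, h.cyc', h.J_right, he.q01, inner_neg_right, hd]; simp [d])
    (by simp only [gx, inner_sub_left, h.cyc', h.J_right, he.q12, inner_neg_right, hd]; simp [d])
    (by simp only [gx, inner_sub_left, h.cyc', h.J_right, he.q20, inner_neg_right, hd]; simp [d])
  have k3 : ∀ i, innerₗ T (g (e i)) = 0 := fun i => h.frame_ext h6 he (k1 i) (k2 i)
  have k4 : ∀ i, g (e i) = 0 := fun i =>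
    by simpa using LinearMap.congr_fun (k3 i) (g (e i))
  refine h.frame_ext h6 he k4 fun i => ?_
  rw [gx, hF, h.J_right, ← neg_add', ← sub_eq_add_neg, ← map_sub, ← gx, k4]
  simp

include h6 in
-- Writing `F = Q b` turns the torsion into an explicit expression in `b`, `J` and the metric. Its
-- contraction is `-4 ⟪b, ·⟫`, from `1 - 6 + 1`, and this is the pattern that defines W₄.
theorem torsionForm_mem_W₄ {F : T →ₗ[ℝ] T} (hF : ∀ x, F (J x) = -J (F x))
    (hs : ∀ x y, ⟪F x, y⟫ = -⟪x, F y⟫) : torsionForm Q F ∈ moduleW₄ J := by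
  obtain ⟨b, rfl⟩ := h.exists_eq_Q h6 hF hs
  have key : ∀ x y z, torsionForm Q (Q b) x y z =
      ⟪b, y⟫ * ⟪x, z⟫ - ⟪b, z⟫ * ⟪x, y⟫ - ⟪J b, y⟫ * ⟪J x, z⟫ + ⟪J b, z⟫ * ⟪J x, y⟫ :=
    fun x y z => by rw [torsionForm_apply, h.cyc', h.inner_Q_Q]
  have hc : ∀ z, contr (torsionForm Q (Q b)) z = -4 * ⟪b, z⟫ := fun z => by
    have h0 : ∀ i, ⟪stdOrthonormalBasis ℝ T i, stdOrthonormalBasis ℝ T i⟫ = (1 : ℝ) := fun i => by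
      rw [real_inner_self_eq_norm_sq, OrthonormalBasis.norm_eq_one]; norm_num
    simp only [contr, LinearMap.coe_mk, AddHom.coe_mk, key, h.inner_J_self, h0]
    simp only [Finset.sum_add_distrib, Finset.sum_sub_distrib, h.sum_J_inner]
    simp only [real_inner_comm z, sum_inner_mul_inner']
    simp [h6]
    ring
  refine ⟨h.torsionForm_mem _, fun x y z => ?_⟩
  rw [key, hc, hc, hc, hc, h.inner_J, h.inner_J, h.inner_J, h.inner_J]
  ring

/-! #### Projections that detect the modules -/

/-- Each of the four terms in the definition of W₄ contributes the same amount. The result is skew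
in `x, y`, which serves both the vanishing of the trace of `r(a)` and the detection of W₃. -/
theorem rMap_of_mem_W₄ {a : T → T → T → ℝ} (ha : a ∈ moduleW₄ J) (x y : T) :
    rMap (volForm Q) a x y = (1 / 4) * contr a (Q y x) := by
  obtain ⟨A, hA⟩ := ha.1.1
  let b := stdOrthonormalBasis ℝ T
  obtain ⟨β, hβ⟩ : ∃ β : T →ₗ[ℝ] ℝ, ∀ z, contr a z = β z :=
    ⟨∑ i, A (b i) (b i), fun z => by simp [contr_eq b a A hA, hA]⟩
  rw [rMap_eq b Q a A hA]
  simp only [ha.2, hβ]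
  rw [← Finset.mul_sum]
  simp only [Finset.sum_add_distrib, Finset.sum_sub_distrib]
  have s1 : ∑ j, ⟪x, b j⟫ * β (Q y (b j)) = β (Q y x) := sum_inner_mul b x (β ∘ₗ Q y)
  have s2 : ∑ j, ⟪x, Q y (b j)⟫ * β (b j) = -β (Q y x) := by
    simp_rw [← h.cyc']
    rw [sum_inner_mul b (Q x y) β, h.swap, map_neg]
  have s3 : ∑ j, ⟪x, J (b j)⟫ * β (J (Q y (b j))) = -β (Q y x) := by
    simp_rw [h.inner_J, neg_mul, Finset.sum_neg_distrib]
    have := sum_inner_mul b (J x) (β ∘ₗ J ∘ₗ Q y)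
    simp only [LinearMap.comp_apply] at this
    rw [this, h.J_right, map_neg, h.J_J, neg_neg]
  have s4 : ∑ j, ⟪x, J (Q y (b j))⟫ * β (J (b j)) = β (Q y x) := by
    simp_rw [h.inner_J, neg_mul, Finset.sum_neg_distrib, ← h.cyc']
    have := sum_inner_mul b (Q (J x) y) (β ∘ₗ J)
    simp only [LinearMap.comp_apply] at this
    rw [this, h.J_left, map_neg, h.J_J, h.swap x]; simp
  rw [s1, s2, s3, s4]
  ring

theorem J_J_of_mem_W₄ {a : T → T → T → ℝ} (ha : a ∈ moduleW₄ J) (x y z : T) :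
    a (J x) (J y) z = a x y z := by
  obtain ⟨A, hA⟩ := ha.1.1
  have hn : ∀ z, contr a (-z) = -contr a z := fun z => by
    simp [contr_eq (stdOrthonormalBasis ℝ T) a A hA, hA]
  rw [ha.2, ha.2 x, h.J_J, hn, h.inner_J_J, h.inner_J_J, h.inner_J x y, h.inner_J x z,
    inner_neg_right]
  ring

omit [FiniteDimensional ℝ T] in
theorem J_left_right {a : T → T → T → ℝ} (ha : a ∈ spaceW J) (x y z : T) :
    a x (J y) z = a x y (J z) := by
  obtain ⟨A, hA⟩ := ha.1
  rw [ha.2.2 x y (J z), h.J_J]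
  simp [hA]

omit h [FiniteDimensional ℝ T] in
-- Total skewness carries the two arguments into the last two slots, where the defining condition of
-- `spaceW` applies.
theorem J_J_of_mem_W₁ {a : T → T → T → ℝ} (ha : a ∈ moduleW₁ J) (x y z : T) :
    a (J x) (J y) z = -a x y z := by
  obtain ⟨A, hA⟩ := ha.1.1
  have s1 : ∀ x y z, a x y z = -a y x z := fun x y z => by
    have := ha.2 (x + y) z
    have h1 := ha.2 x z
    have h2 := ha.2 y z
    simp only [hA, map_add, LinearMap.add_apply] at *
    linarith
  have s2 := ha.1.2.1
  have c : ∀ x y z, a x y z = a z x y := fun x y z => by rw [s2, s1, neg_neg]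
  rw [c, c x y z, ha.1.2.2 z x y, neg_neg]

omit [FiniteDimensional ℝ T] in
-- The sum `s(x, y, z) = a(x, y, z) + a(Jx, Jy, z)` changes sign under cyclic permutation, by the
-- cyclic identity for `a`. Three permutations return to the start, so `s = -s`.
theorem J_J_of_mem_W₂ {a : T → T → T → ℝ} (ha : a ∈ moduleW₂ J) (x y z : T) :
    a (J x) (J y) z = -a x y z := by
  have key : ∀ x y z, a x y z + a (J x) (J y) z = -(a y z x + a (J y) (J z) x) := fun x y z => by
    have h1 := ha.2 x y z
    have h2 := ha.2 (J x) (J y) z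
    have h3 := ha.1.2.2 z x y
    have h4 := h.J_left_right ha.1 (J y) z x
    linarith
  linarith [key x y z, key y z x, key z x y]

/-- The trace of `r(a)` is, up to a factor, the full contraction of `a` with the volume form. Since
the latter is cyclically invariant, only the cyclic sum of `a` contributes. -/
theorem sum_rMap_of_mem_W₂ {a : T → T → T → ℝ} (ha : a ∈ moduleW₂ J) :
    ∑ i, rMap (volForm Q) a (stdOrthonormalBasis ℝ T i) (stdOrthonormalBasis ℝ T i) = 0 := by
  obtain ⟨A, hA⟩ := ha.1.1
  let b := stdOrthonormalBasis ℝ T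
  change ∑ i, rMap (volForm Q) a (b i) (b i) = 0
  have h1 : ∀ u v, a u v (Q u v) = ∑ k, a u v (b k) * ⟪Q u v, b k⟫ := fun u v => by
    simp only [hA, mul_comm (A u v _)]
    exact (sum_inner_mul _ _ (A u v)).symm
  simp only [rMap_eq b Q a A hA, ← Finset.mul_sum, h1]
  have c1 : ∑ i, ∑ j, ∑ k, a (b i) (b j) (b k) * ⟪Q (b i) (b j), b k⟫ =
      ∑ i, ∑ j, ∑ k, a (b j) (b k) (b i) * ⟪Q (b i) (b j), b k⟫ := by
    rw [sum_cyc]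
    simp only [← h.cyc]
  have c2 : ∑ i, ∑ j, ∑ k, a (b i) (b j) (b k) * ⟪Q (b i) (b j), b k⟫ =
      ∑ i, ∑ j, ∑ k, a (b k) (b i) (b j) * ⟪Q (b i) (b j), b k⟫ := by
    conv_rhs => rw [sum_cyc]
    exact Finset.sum_congr rfl fun i _ => Finset.sum_congr rfl fun j _ =>
      Finset.sum_congr rfl fun k _ => by rw [h.cyc]
  have c3 : ∑ i, ∑ j, ∑ k, (a (b i) (b j) (b k) * ⟪Q (b i) (b j), b k⟫ +
      a (b j) (b k) (b i) * ⟪Q (b i) (b j), b k⟫ + a (b k) (b i) (b j) * ⟪Q (b i) (b j), b k⟫) =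
      0 := by
    simp only [← add_mul, ha.2, zero_mul, Finset.sum_const_zero]
  simp only [Finset.sum_add_distrib] at c3
  linarith

/-- Replacing the basis by its image under `J` in both summations changes nothing. Termwise,
however, `a` is invariant and `Q` changes sign, so the sum equals its negative. -/
theorem sum_rMap_of_mem_W₃ {a : T → T → T → ℝ} (ha : a ∈ moduleW₃ J) :
    ∑ i, rMap (volForm Q) a (stdOrthonormalBasis ℝ T i) (stdOrthonormalBasis ℝ T i) = 0 := by
  obtain ⟨A, hA⟩ := ha.1.1
  let b := stdOrthonormalBasis ℝ T
  change ∑ i, rMap (volForm Q) a (b i) (b i) = 0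
  have hJ : ∀ g : T →ₗ[ℝ] T →ₗ[ℝ] ℝ, ∑ i, g (J (b i)) (J (b i)) = ∑ i, g (b i) (b i) := by
    intro g
    have := sum_bilin_adjoint b (F := J) (F' := -J) (fun x y => by simp [h.inner_J]) (g.compl₂ J)
    simpa [h.J_J] using this
  simp only [rMap_eq b Q a A hA, ← Finset.mul_sum]
  have h1 : ∀ u, ∑ j, a u (J (b j)) (Q u (J (b j))) = ∑ j, a u (b j) (Q u (b j)) := fun u => by
    simpa [hA] using hJ ((A u).compl₂ (Q u))
  have h2 : ∑ i, ∑ j, a (J (b i)) (b j) (Q (J (b i)) (b j)) =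
      ∑ i, ∑ j, a (b i) (b j) (Q (b i) (b j)) := by
    rw [Finset.sum_comm, Finset.sum_comm (f := fun i j => a (b i) (b j) (Q (b i) (b j)))]
    refine Finset.sum_congr rfl fun j _ => ?_
    simpa [hA] using hJ ((A.flip (b j)).compl₂ (Q.flip (b j)))
  have h3 : ∑ i, ∑ j, a (J (b i)) (J (b j)) (Q (J (b i)) (J (b j))) =
      ∑ i, ∑ j, a (b i) (b j) (Q (b i) (b j)) := by
    simp only [h1, h2]
  have h4 : ∀ u v, a (J u) (J v) (Q (J u) (J v)) = -a u v (Q u v) := fun u v => by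
    rw [← ha.2.1, h.J_left, h.J_right, map_neg, h.J_J, neg_neg]
    simp [hA]
  simp only [h4, Finset.sum_neg_distrib] at h3
  linarith

theorem sum_rMap_of_mem_W₄ {a : T → T → T → ℝ} (ha : a ∈ moduleW₄ J) :
    ∑ i, rMap (volForm Q) a (stdOrthonormalBasis ℝ T i) (stdOrthonormalBasis ℝ T i) = 0 := by
  simp only [h.rMap_of_mem_W₄ ha, h.self]
  obtain ⟨A, hA⟩ := ha.1.1
  simp [contr, hA]

include h6 in
/-- The torsion has no component in `W₁` only if `K` is trace-free. -/
theorem trace_eq_zero {K : T →ₗ[ℝ] T} {η : T → ℝ} {ψ : (Fin 3 → T) → ℝ}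
    (hK : (torsionForm Q K, η) ∈ ⨆ c ∈ ({.W₂p, .W₂m, .W₃, .W₄, .W₅} : Set SU3Class),
      moduleSU3 J ψ c) : LinearMap.trace ℝ T K = 0 := by
  -- `L` is the trace of `r(a)`. It kills every listed module, and `ψ` may be arbitrary because the
  -- split of W₂ into its two halves plays no part.
  let L : (T → T → T → ℝ) →ₗ[ℝ] ℝ :=
    ∑ i, LinearMap.proj (stdOrthonormalBasis ℝ T i) ∘ₗ LinearMap.proj (stdOrthonormalBasis ℝ T i) ∘ₗ
      rMap (volForm Q)
  have hL : ∀ a, L a = ∑ i, rMap (volForm Q) a (stdOrthonormalBasis ℝ T i)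
      (stdOrthonormalBasis ℝ T i) := fun a => by simp [L]
  have hle : (⨆ c ∈ ({.W₂p, .W₂m, .W₃, .W₄, .W₅} : Set SU3Class), moduleSU3 J ψ c) ≤
      (LinearMap.ker L).prod ⊤ := by
    refine iSup₂_le fun c hc => ?_
    rintro ⟨a, η⟩ ha
    refine ⟨LinearMap.mem_ker.2 ?_, trivial⟩
    rw [hL]
    simp only [Set.mem_insert_iff, Set.mem_singleton_iff] at hc
    rcases hc with rfl | rfl | rfl | rfl | rfl
    · exact h.sum_rMap_of_mem_W₂ ha.1.1
    · exact h.sum_rMap_of_mem_W₂ ha.1.1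
    · exact h.sum_rMap_of_mem_W₃ ha.1
    · exact h.sum_rMap_of_mem_W₄ ha.1
    · have : a = 0 := ha.1
      simp [this]
  have := LinearMap.mem_ker.1 (hle hK).1
  rw [hL] at this
  rw [LinearMap.trace_eq_sum_inner K (stdOrthonormalBasis ℝ T), ← this]
  simp only [h.rMap_torsionForm h6, real_inner_comm]

include h6 in
/-- The torsion has no component in `W₃` only if the part of `K` that anticommutes with `J` is
skew-symmetric. -/
theorem skew_of_mem {K : T →ₗ[ℝ] T} {η : T → ℝ} {ψ : (Fin 3 → T) → ℝ}
    (hK : (torsionForm Q K, η) ∈ ⨆ c ∈ ({.W₁p, .W₁m, .W₂p, .W₂m, .W₄, .W₅} : Set SU3Class),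
      moduleSU3 J ψ c) (x y : T) :
    ⟪K x + J (K (J x)), y⟫ = -⟪x, K y + J (K (J y))⟫ := by
  -- `L` kills W₁ and W₂ and doubles W₄, where `r` is skew; on `torsionForm Q K` it replaces `K` by
  -- `K + J K J`, twice the part that anticommutes with `J`.
  let L : (T → T → T → ℝ) →ₗ[ℝ] (T → T → T → ℝ) :=
    { toFun := fun a x y z => a x y z + a (J x) (J y) z
      map_add' := fun a b => by ext; simp; ring
      map_smul' := fun c a => by ext; simp; ring }
  have hle : (⨆ c ∈ ({.W₁p, .W₁m, .W₂p, .W₂m, .W₄, .W₅} : Set SU3Class), moduleSU3 J ψ c) ≤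
      ((rSkew (volForm Q)).comap L).prod ⊤ := by
    refine iSup₂_le fun c hc => ?_
    rintro ⟨a, η⟩ ha
    refine ⟨?_, trivial⟩
    have h0 : L a = 0 → L a ∈ rSkew (volForm Q) := fun h => h ▸ zero_mem _
    have h1 : a ∈ moduleW₁ J → L a ∈ rSkew (volForm Q) := fun ha => h0 (by
      ext x y z; simp [L, J_J_of_mem_W₁ ha])
    have h2 : a ∈ moduleW₂ J → L a ∈ rSkew (volForm Q) := fun ha => h0 (by
      ext x y z; simp [L, h.J_J_of_mem_W₂ ha])
    simp only [Set.mem_insert_iff, Set.mem_singleton_iff] at hc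
    rcases hc with rfl | rfl | rfl | rfl | rfl | rfl
    · exact h1 ha.1.1
    · exact h1 ha.1.1
    · exact h2 ha.1.1
    · exact h2 ha.1.1
    · have ha' : a ∈ moduleW₄ J := ha.1
      have : L a = (2 : ℝ) • a := by
        ext x y z; simp [L, h.J_J_of_mem_W₄ ha']; ring
      show L a ∈ rSkew (volForm Q)
      rw [this]
      refine Submodule.smul_mem _ _ fun x y => ?_
      rw [h.rMap_of_mem_W₄ ha', h.rMap_of_mem_W₄ ha', h.swap]
      obtain ⟨A, hA⟩ := ha'.1.1
      simp [contr, hA]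
    · have : a = 0 := ha.1
      exact h0 (by rw [this, map_zero])
  have h1 := (hle hK).1 x y
  have h2 : L (torsionForm Q K) = torsionForm Q (K + J ∘ₗ K ∘ₗ J) := by
    ext x y z
    simp [L, torsionForm_apply, h.J_left, h.J_right, inner_add_left]
  rw [h2, h.rMap_torsionForm h6, h.rMap_torsionForm h6] at h1
  rw [real_inner_comm (K y + _)]
  exact h1

theorem adjoint_J : LinearMap.adjoint J = -J := by
  rw [eq_comm, LinearMap.eq_adjoint_iff]
  intro x y; simp [h.inner_J]

theorem adjoint_commute {C : T →ₗ[ℝ] T} (hC : ∀ x, C (J x) = J (C x)) (x : T) :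
    LinearMap.adjoint C (J x) = J (LinearMap.adjoint C x) := by
  have h1 : C ∘ₗ J = J ∘ₗ C := LinearMap.ext hC
  have h2 := congrArg (fun A => LinearMap.adjoint A x) h1
  simp only [LinearMap.adjoint_comp, h.adjoint_J, LinearMap.comp_apply, LinearMap.neg_apply,
    map_neg, neg_inj] at h2
  exact h2.symm

theorem adjoint_anticommute {F : T →ₗ[ℝ] T} (hF : ∀ x, F (J x) = -J (F x)) (x : T) :
    LinearMap.adjoint F (J x) = -J (LinearMap.adjoint F x) := by
  have h1 : F ∘ₗ J = -J ∘ₗ F := LinearMap.ext hF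
  have h2 := congrArg (fun A => LinearMap.adjoint A x) h1
  simp only [LinearMap.adjoint_comp, h.adjoint_J, LinearMap.comp_apply, LinearMap.neg_apply,
    map_neg, neg_neg] at h2
  exact h2.symm

theorem trace_J : LinearMap.trace ℝ T J = 0 := by
  have := trace_adjoint J
  rw [h.adjoint_J, map_neg] at this; linarith

include h6 in
/-- The components of an endomorphism that commute and anticommute with `J`. -/
theorem exists_splitting (K : T →ₗ[ℝ] T) : ∃ (t s : ℝ) (C : T →ₗ[ℝ] T),
    (LinearMap.trace ℝ T K = 0 → t = 0) ∧ (LinearMap.trace ℝ T (J ∘ₗ K) = 0 → s = 0) ∧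
    (∀ x, C (J x) = J (C x)) ∧ LinearMap.trace ℝ T C = 0 ∧ LinearMap.trace ℝ T (J ∘ₗ C) = 0 ∧
    K = t • LinearMap.id + s • J + C + (1 / 2 : ℝ) • (K + J ∘ₗ K ∘ₗ J) := by
  -- The identity has trace 6 and `J ∘ J` has trace -6, which fixes `t` and the sign of `s`. What is
  -- left in `C` is the component commuting with `J`, with both traces removed.
  let t : ℝ := LinearMap.trace ℝ T K / 6
  let s : ℝ := -LinearMap.trace ℝ T (J ∘ₗ K) / 6
  let C : T →ₗ[ℝ] T := (1 / 2 : ℝ) • (K - J ∘ₗ K ∘ₗ J) - t • LinearMap.id - s • J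
  have hJJ : J ∘ₗ J = -LinearMap.id := LinearMap.ext fun x => by simp [h.J_J]
  have tr1 : LinearMap.trace ℝ T (J ∘ₗ K ∘ₗ J) = -LinearMap.trace ℝ T K := by
    rw [LinearMap.trace_comp_comm', LinearMap.comp_assoc, hJJ]; simp
  have tr2 : LinearMap.trace ℝ T (J ∘ₗ J ∘ₗ K ∘ₗ J) = -LinearMap.trace ℝ T (J ∘ₗ K) := by
    rw [LinearMap.trace_comp_comm', LinearMap.comp_assoc, LinearMap.comp_assoc, hJJ]; simp
  refine ⟨t, s, C, fun h0 => by simp [t, h0], fun h0 => by simp [s, h0], fun x => ?_, ?_, ?_, ?_⟩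
  · simp only [C, LinearMap.sub_apply, LinearMap.smul_apply, LinearMap.comp_apply, h.J_J,
      LinearMap.id_apply, map_sub, map_smul, map_neg]
    module
  · simp only [C, map_sub, map_smul, tr1, h.trace_J, LinearMap.trace_id, h6, t, smul_eq_mul]
    push_cast; ring
  · simp only [C, LinearMap.comp_sub, LinearMap.comp_smul, map_sub, map_smul, tr2, h.trace_J, hJJ,
      map_neg, LinearMap.comp_id, LinearMap.trace_id, h6, s, smul_eq_mul]
    push_cast; ring
  · simp only [C]
    module

include h6 in
/-- The components of a torsion tensor in the modules `W₁^±`, `W₂^±`, `W₃`, `W₄`. -/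
theorem exists_decomposition (K : T →ₗ[ℝ] T) :
    ∃ a₁p a₁m a₂p a₂m a₃ a₄ : T → T → T → ℝ, (a₁p ∈ moduleW₁ J ⊓ rSymm (volForm Q)) ∧
      (a₁m ∈ moduleW₁ J ⊓ rSkew (volForm Q)) ∧ (a₂p ∈ moduleW₂ J ⊓ rSymm (volForm Q)) ∧
      (a₂m ∈ moduleW₂ J ⊓ rSkew (volForm Q)) ∧ a₃ ∈ moduleW₃ J ∧ a₄ ∈ moduleW₄ J ∧
      torsionForm Q K = a₁p + a₁m + a₂p + a₂m + a₃ + a₄ ∧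
      (LinearMap.trace ℝ T K = 0 → LinearMap.trace ℝ T (J ∘ₗ K) = 0 → a₁p = 0 ∧ a₁m = 0) ∧
      ((∀ x y, ⟪K x + J (K (J x)), y⟫ = -⟪x, K y + J (K (J y))⟫) → a₃ = 0) ∧
      ((∀ x y, ⟪K x + J (K (J x)), y⟫ = ⟪x, K y + J (K (J y))⟫) → a₄ = 0) := by
  obtain ⟨t, s, C, ht, hs, hCJ, trC, trJC, hK⟩ := h.exists_splitting h6 K
  obtain ⟨F, hFx⟩ : ∃ F : T →ₗ[ℝ] T, F = K + J ∘ₗ K ∘ₗ J := ⟨_, rfl⟩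
  rw [← hFx] at hK
  have hF : ∀ x, F x = K x + J (K (J x)) := fun x => by rw [hFx]; rfl
  have hFJ : ∀ x, F (J x) = -J (F x) := fun x => by
    rw [hF, hF, h.J_J, map_neg, map_neg, map_add, h.J_J]; abel
  have trC' : LinearMap.trace ℝ T (LinearMap.adjoint C) = 0 := by rw [trace_adjoint, trC]
  have trJC' : LinearMap.trace ℝ T (J ∘ₗ LinearMap.adjoint C) = 0 := by
    have : J ∘ₗ LinearMap.adjoint C = -LinearMap.adjoint (C ∘ₗ J) := by
      rw [LinearMap.adjoint_comp, h.adjoint_J, LinearMap.neg_comp, neg_neg]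
    rw [this, map_neg, trace_adjoint, LinearMap.trace_comp_comm', trJC, neg_zero]
  -- The factors `1/4` combine two halves: one because `F` is twice the anticommuting component of
  -- `K`, one from taking symmetric and skew parts.
  refine ⟨torsionForm Q (t • LinearMap.id), torsionForm Q (s • J),
    torsionForm Q ((1 / 2 : ℝ) • (C + LinearMap.adjoint C)),
    torsionForm Q ((1 / 2 : ℝ) • (C - LinearMap.adjoint C)),
    torsionForm Q ((1 / 4 : ℝ) • (F + LinearMap.adjoint F)),
    torsionForm Q ((1 / 4 : ℝ) • (F - LinearMap.adjoint F)),
    ⟨?_, ?_⟩, ⟨?_, ?_⟩, ⟨?_, ?_⟩, ⟨?_, ?_⟩, ?_, ?_, ?_, ?_, ?_, ?_⟩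
  · rw [map_smul]; exact Submodule.smul_mem _ _ h.torsionForm_id_mem
  · exact h.torsionForm_mem_rSymm h6 fun x y => by simp [inner_smul_left, inner_smul_right]
  · rw [map_smul]; exact Submodule.smul_mem _ _ h.torsionForm_J_mem
  · exact h.torsionForm_mem_rSkew h6 fun x y => by
      simp [inner_smul_left, inner_smul_right, h.inner_J]
  · refine h.torsionForm_mem_W₂ h6 (fun x => ?_) ?_ ?_
    · simp only [LinearMap.smul_apply, LinearMap.add_apply, hCJ, h.adjoint_commute hCJ, map_smul,
        map_add]
    · rw [map_smul, map_add, trC, trC', add_zero, smul_zero]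
    · rw [LinearMap.comp_smul, LinearMap.comp_add, map_smul, map_add, trJC, trJC', add_zero,
        smul_zero]
  · exact h.torsionForm_mem_rSymm h6 (smul_add_adjoint_symm _ C)
  · refine h.torsionForm_mem_W₂ h6 (fun x => ?_) ?_ ?_
    · simp only [LinearMap.smul_apply, LinearMap.sub_apply, hCJ, h.adjoint_commute hCJ, map_smul,
        map_sub]
    · rw [map_smul, map_sub, trC, trC', sub_zero, smul_zero]
    · rw [LinearMap.comp_smul, LinearMap.comp_sub, map_smul, map_sub, trJC, trJC', sub_zero,
        smul_zero]
  · exact h.torsionForm_mem_rSkew h6 (smul_sub_adjoint_skew _ C)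
  · refine h.torsionForm_mem_W₃ (fun x => ?_) (smul_add_adjoint_symm _ F)
    simp only [LinearMap.smul_apply, LinearMap.add_apply, hFJ, h.adjoint_anticommute hFJ, map_smul,
      map_add, smul_neg, smul_add, neg_add]
  · refine h.torsionForm_mem_W₄ h6 (fun x => ?_) (smul_sub_adjoint_skew _ F)
    simp only [LinearMap.smul_apply, LinearMap.sub_apply, hFJ, h.adjoint_anticommute hFJ, map_smul,
      map_sub]
    module
  · rw [← map_add, ← map_add, ← map_add, ← map_add, ← map_add]
    congr 1
    nth_rewrite 1 [hK]
    module
  · intro h1 h2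
    rw [ht h1, hs h2, zero_smul, zero_smul, map_zero]
    exact ⟨rfl, rfl⟩
  · intro h1
    have : -F = LinearMap.adjoint F := by
      rw [LinearMap.eq_adjoint_iff]
      intro x y
      rw [LinearMap.neg_apply, inner_neg_left, hF, hF, h1, neg_neg]
    rw [← this, add_neg_cancel, smul_zero, map_zero]
  · intro h1
    have : F = LinearMap.adjoint F := by
      rw [LinearMap.eq_adjoint_iff]
      intro x y
      rw [hF, hF, h1]
    rw [← this, sub_self, smul_zero, map_zero]

include h6 in
-- The W₄ component comes from the skew half of `K + J K J`, so symmetry of that map removes it and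
-- leaves all other modules unrestricted.
theorem mem_type_of_symm {K : T →ₗ[ℝ] T} (η : T →ₗ[ℝ] ℝ)
    (hK : ∀ x y, ⟪K x + J (K (J x)), y⟫ = ⟪x, K y + J (K (J y))⟫) :
    (torsionForm Q K, (η : T → ℝ)) ∈ ⨆ c ∈ ({.W₁p, .W₁m, .W₂p, .W₂m, .W₃, .W₅} : Set SU3Class),
      moduleSU3 J (volForm Q) c := by
  obtain ⟨a₁p, a₁m, a₂p, a₂m, a₃, a₄, m1, m2, m3, m4, m5, -, he, -, -, h0⟩ :=
    h.exists_decomposition h6 K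
  rw [he, h0 hK, add_zero, sum_prod_eq]
  refine add_mem (add_mem (add_mem (add_mem (add_mem ?_ ?_) ?_) ?_) ?_) ?_
  · exact mem_type_of_mem (c := .W₁p) (by simp) ⟨m1, rfl⟩
  · exact mem_type_of_mem (c := .W₁m) (by simp) ⟨m2, rfl⟩
  · exact mem_type_of_mem (c := .W₂p) (by simp) ⟨m3, rfl⟩
  · exact mem_type_of_mem (c := .W₂m) (by simp) ⟨m4, rfl⟩
  · exact mem_type_of_mem (c := .W₃) (by simp) ⟨m5, rfl⟩
  · exact mem_type_of_mem (c := .W₅) (by simp) ⟨rfl, ⟨η, rfl⟩⟩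

include h6 in
theorem mem_type_of_skew {K : T →ₗ[ℝ] T} (η : T →ₗ[ℝ] ℝ)
    (hK : ∀ x y, ⟪K x + J (K (J x)), y⟫ = -⟪x, K y + J (K (J y))⟫) :
    (torsionForm Q K, (η : T → ℝ)) ∈ ⨆ c ∈ ({.W₁p, .W₁m, .W₂p, .W₂m, .W₄, .W₅} : Set SU3Class),
      moduleSU3 J (volForm Q) c := by
  obtain ⟨a₁p, a₁m, a₂p, a₂m, a₃, a₄, m1, m2, m3, m4, -, m6, he, -, h0, -⟩ :=
    h.exists_decomposition h6 K
  rw [he, h0 hK, add_zero, sum_prod_eq]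
  refine add_mem (add_mem (add_mem (add_mem (add_mem ?_ ?_) ?_) ?_) ?_) ?_
  · exact mem_type_of_mem (c := .W₁p) (by simp) ⟨m1, rfl⟩
  · exact mem_type_of_mem (c := .W₁m) (by simp) ⟨m2, rfl⟩
  · exact mem_type_of_mem (c := .W₂p) (by simp) ⟨m3, rfl⟩
  · exact mem_type_of_mem (c := .W₂m) (by simp) ⟨m4, rfl⟩
  · exact mem_type_of_mem (c := .W₄) (by simp) ⟨m6, rfl⟩
  · exact mem_type_of_mem (c := .W₅) (by simp) ⟨rfl, ⟨η, rfl⟩⟩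

include h6 in
theorem mem_type_of_trace {K : T →ₗ[ℝ] T} (η : T →ₗ[ℝ] ℝ)
    (hK : LinearMap.trace ℝ T K = 0) (hJK : LinearMap.trace ℝ T (J ∘ₗ K) = 0) :
    (torsionForm Q K, (η : T → ℝ)) ∈ ⨆ c ∈ ({.W₂p, .W₂m, .W₃, .W₄, .W₅} : Set SU3Class),
      moduleSU3 J (volForm Q) c := by
  obtain ⟨a₁p, a₁m, a₂p, a₂m, a₃, a₄, -, -, m3, m4, m5, m6, he, h0, -, -⟩ :=
    h.exists_decomposition h6 K
  rw [he, (h0 hK hJK).1, (h0 hK hJK).2, add_zero, sum_prod_eq]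
  refine add_mem (add_mem (add_mem (add_mem (add_mem ?_ ?_) ?_) ?_) ?_) ?_
  -- This summand is what remains of the two vanishing W₁ components.
  · exact zero_mem _
  · exact mem_type_of_mem (c := .W₂p) (by simp) ⟨m3, rfl⟩
  · exact mem_type_of_mem (c := .W₂m) (by simp) ⟨m4, rfl⟩
  · exact mem_type_of_mem (c := .W₃) (by simp) ⟨m5, rfl⟩
  · exact mem_type_of_mem (c := .W₄) (by simp) ⟨m6, rfl⟩
  · exact mem_type_of_mem (c := .W₅) (by simp) ⟨rfl, ⟨η, rfl⟩⟩

end IsSU3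
end SU3Modules

/-! ### The linear algebra of the cross product -/

section CrossAlgebra

variable {V : Type*} [NormedAddCommGroup V] [InnerProductSpace ℝ V]

/-- An alternating three-form as an iterated linear map. -/
def triL (φ : V [⋀^Fin 3]→ₗ[ℝ] ℝ) : V →ₗ[ℝ] V →ₗ[ℝ] V →ₗ[ℝ] ℝ :=
  have add : ∀ (i : Fin 3) (v : Fin 3 → V) (x y : V), φ (Function.update v i (x + y)) =
      φ (Function.update v i x) + φ (Function.update v i y) := fun i v x y => φ.map_update_add v i x y
  have smul : ∀ (i : Fin 3) (v : Fin 3 → V) (c : ℝ) (x : V), φ (Function.update v i (c • x)) =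
      c • φ (Function.update v i x) := fun i v c x => φ.map_update_smul v i c x
  have u0 : ∀ x y z w : V, Function.update ![x, y, z] 0 w = ![w, y, z] := fun x y z w => by
    ext i; fin_cases i <;> rfl
  have u1 : ∀ x y z w : V, Function.update ![x, y, z] 1 w = ![x, w, z] := fun x y z w => by
    ext i; fin_cases i <;> rfl
  have u2 : ∀ x y z w : V, Function.update ![x, y, z] 2 w = ![x, y, w] := fun x y z w => by
    ext i; fin_cases i <;> rfl
  LinearMap.mk₂ ℝ (fun x y =>
    { toFun := fun z => φ ![x, y, z]
      map_add' := fun z z' => by simpa only [u2] using add 2 ![x, y, 0] z z'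
      map_smul' := fun c z => by
        simpa only [u2, RingHom.id_apply] using smul 2 ![x, y, 0] c z })
    (fun x x' y => LinearMap.ext fun z => by
      have := add 0 ![0, y, z] x x'; simp only [u0] at this; exact this)
    (fun c x y => LinearMap.ext fun z => by
      have := smul 0 ![0, y, z] c x; simp only [u0] at this; exact this)
    (fun x y y' => LinearMap.ext fun z => by
      have := add 1 ![x, 0, z] y y'; simp only [u1] at this; exact this)
    (fun c x y => LinearMap.ext fun z => by
      have := smul 1 ![x, 0, z] c y; simp only [u1] at this; exact this)

theorem triL_apply (φ : V [⋀^Fin 3]→ₗ[ℝ] ℝ) (x y z : V) : triL φ x y z = φ ![x, y, z] := rfl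

theorem triL_swap (φ : V [⋀^Fin 3]→ₗ[ℝ] ℝ) (x y z : V) : triL φ x y z = -triL φ y x z := by
  rw [triL_apply, triL_apply, ← φ.map_swap ![y, x, z] (show (0 : Fin 3) ≠ 1 by decide)]
  congr 1; ext i; fin_cases i <;> rfl

theorem triL_swap' (φ : V [⋀^Fin 3]→ₗ[ℝ] ℝ) (x y z : V) : triL φ x y z = -triL φ x z y := by
  rw [triL_apply, triL_apply, ← φ.map_swap ![x, z, y] (show (1 : Fin 3) ≠ 2 by decide)]
  congr 1; ext i; fin_cases i <;> rfl

theorem triL_cyc (φ : V [⋀^Fin 3]→ₗ[ℝ] ℝ) (x y z : V) : triL φ x y z = triL φ y z x := by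
  rw [triL_swap, triL_swap', neg_neg]

theorem apply_eq_triL (φ : V [⋀^Fin 3]→ₗ[ℝ] ℝ) (v : Fin 3 → V) :
    φ v = triL φ (v 0) (v 1) (v 2) := by
  rw [triL_apply]; congr 1; ext i; fin_cases i <;> rfl

/-- A seven-dimensional vector cross product. -/
structure IsCross (P : V →ₗ[ℝ] V →ₗ[ℝ] V) : Prop where
  swap : ∀ x y, P x y = -P y x
  cyc : ∀ x y z, ⟪P x y, z⟫ = ⟪P y z, x⟫
  norm : ∀ x y, ⟪P x y, P x y⟫ = ⟪x, x⟫ * ⟪y, y⟫ - ⟪x, y⟫ ^ 2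

/-- The four-form `∗φ` in terms of the cross product. -/
def starForm (P : V →ₗ[ℝ] V →ₗ[ℝ] V) (w x y z : V) : ℝ :=
  -⟪P w x, P y z⟫ + ⟪w, y⟫ * ⟪x, z⟫ - ⟪w, z⟫ * ⟪x, y⟫

/-- The four-form `∗φ` as a bilinear form in its last two arguments. -/
def starBilin (P : V →ₗ[ℝ] V →ₗ[ℝ] V) (w x : V) : V →ₗ[ℝ] V →ₗ[ℝ] ℝ :=
  LinearMap.mk₂ ℝ (starForm P w x)
    (fun y y' z => by simp [starForm, inner_add_right]; ring)
    (fun c y z => by simp [starForm, inner_smul_right]; ring)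
    (fun y z z' => by simp [starForm, inner_add_right]; ring)
    (fun c y z => by simp [starForm, inner_smul_right]; ring)

namespace IsCross

variable {P : V →ₗ[ℝ] V →ₗ[ℝ] V} (h : IsCross P)
include h

theorem cyc' (x y z : V) : ⟪P x y, z⟫ = ⟪x, P y z⟫ := by rw [h.cyc, real_inner_comm]

theorem self (x : V) : P x x = 0 := by
  have : (2 : ℝ) • P x x = 0 := by
    rw [two_smul]; nth_rewrite 1 [h.swap]; simp
  simpa using this

theorem inner_P_same (a c b : V) : ⟪P a b, P c b⟫ = ⟪a, c⟫ * ⟪b, b⟫ - ⟪a, b⟫ * ⟪c, b⟫ := by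
  have h1 := h.norm (a + c) b
  have h2 := h.norm a b
  have h3 := h.norm c b
  simp only [map_add, LinearMap.add_apply, inner_add_left, inner_add_right] at h1
  rw [real_inner_comm (P a b) (P c b), real_inner_comm a c] at h1
  linarith

theorem inner_P_P (a b c d : V) : ⟪P a b, P c d⟫ + ⟪P a d, P c b⟫ = 2 * ⟪a, c⟫ * ⟪b, d⟫ -
    ⟪a, b⟫ * ⟪c, d⟫ - ⟪a, d⟫ * ⟪c, b⟫ := by
  have h1 := h.inner_P_same a c (b + d)
  have h2 := h.inner_P_same a c b
  have h3 := h.inner_P_same a c d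
  simp only [map_add, inner_add_left, inner_add_right] at h1
  rw [real_inner_comm b d] at h1
  linarith

theorem starForm_swap₁ (w x y z : V) : starForm P w x y z = -starForm P x w y z := by
  simp only [starForm]
  rw [h.swap w x, inner_neg_left]; ring

theorem starForm_swap₃ (w x y z : V) : starForm P w x y z = -starForm P w x z y := by
  simp only [starForm]
  rw [h.swap y z, inner_neg_right]; ring

/-- The metric terms of `starForm` are precisely the correction that turns the polarised norm
identity into skewness in the middle arguments. With the two evident swaps this makes the form
alternating. -/
theorem starForm_swap₂ (w x y z : V) : starForm P w x y z = -starForm P w y x z := by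
  simp only [starForm]
  have h1 := h.inner_P_P x w y z
  have h2 := h.inner_P_P x w z y
  have h3 := h.inner_P_P w x z y
  have h4 := h.inner_P_P w y z x
  rw [h.swap z y, h.swap z x] at h3
  simp only [inner_neg_right] at h3
  rw [real_inner_comm y x, real_inner_comm x z, real_inner_comm y z] at *
  nlinarith [real_inner_comm x z, real_inner_comm x y, real_inner_comm y z]

/-- Averaging three equal values under cyclic permutation of the last arguments cancels the metric
terms. This connects `starForm`, convenient for computing, with the cyclic expression in `starPhi`.
-/
theorem starForm_eq_cyclic (w x y z : V) : starForm P w x y z =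
    -(1 / 3) * (⟪P w x, P y z⟫ + ⟪P w y, P z x⟫ + ⟪P w z, P x y⟫) := by
  have h1 : starForm P w x y z = starForm P w y z x := by
    rw [h.starForm_swap₂, h.starForm_swap₃, neg_neg]
  have h2 : starForm P w x y z = starForm P w z x y := by
    rw [h.starForm_swap₃, h.starForm_swap₂, neg_neg]
  simp only [starForm] at h1 h2 ⊢
  rw [real_inner_comm x y] at *
  rw [real_inner_comm x z, real_inner_comm y z] at *
  linarith

section Contractions

variable {κ : Type*} [Fintype κ] (b : OrthonormalBasis κ ℝ V) (h7 : Fintype.card κ = 7)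
include h7

theorem sum_inner_P (x y : V) : ∑ j, ⟪P x (b j), P y (b j)⟫ = 6 * ⟪x, y⟫ := by
  have h0 : ∀ j, ⟪b j, b j⟫ = (1 : ℝ) := fun j => by
    rw [real_inner_self_eq_norm_sq, b.norm_eq_one]; norm_num
  simp_rw [h.inner_P_same, h0, Finset.sum_sub_distrib, sum_inner_mul_inner']
  simp [h7]; ring

/-- After moving the free arguments `w, z` into one cross product, the three terms of `starForm`
contribute `-6`, `+1` and `+1` times `⟪P u w, z⟫`. -/
theorem sum_starForm (u w z : V) :
    ∑ j, ∑ k, ⟪P u (b j), b k⟫ * starForm P w (b j) (b k) z = -4 * ⟪P u w, z⟫ := by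
  have h1 : ∀ j k, starForm P w (b j) (b k) z =
      -⟪P (P w z) (b j), b k⟫ + ⟪w, b j⟫ * ⟪z, b k⟫ - ⟪w, b k⟫ * ⟪z, b j⟫ := fun j k => by
    have : starForm P w (b j) (b k) z = starForm P w z (b j) (b k) := by
      rw [h.starForm_swap₃, h.starForm_swap₂, neg_neg]
    rw [this, starForm, ← h.cyc']
  have h2 : ∀ j, ∑ k, ⟪P u (b j), b k⟫ * starForm P w (b j) (b k) z =
      -⟪P u (b j), P (P w z) (b j)⟫ + ⟪w, b j⟫ * ⟪P u (b j), z⟫ - ⟪P u (b j), w⟫ * ⟪z, b j⟫ := by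
    intro j
    rw [← sum_inner_mul_inner' b (P u (b j)), ← sum_inner_mul_inner' b (P u (b j)) z,
      ← sum_inner_mul_inner' b (P u (b j)) w, Finset.mul_sum, Finset.sum_mul,
      ← Finset.sum_neg_distrib, ← Finset.sum_add_distrib, ← Finset.sum_sub_distrib]
    exact Finset.sum_congr rfl fun k _ => by rw [h1]; ring
  simp only [h2, Finset.sum_add_distrib, Finset.sum_sub_distrib, Finset.sum_neg_distrib,
    h.sum_inner_P b h7]
  have h3 : ∑ j, ⟪w, b j⟫ * ⟪P u (b j), z⟫ = ⟪P u w, z⟫ :=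
    sum_inner_mul b w (((innerₗ V).flip z) ∘ₗ (P u))
  have h4 : ∑ j, ⟪P u (b j), w⟫ * ⟪z, b j⟫ = -⟪P u w, z⟫ := by
    have : ∀ j, ⟪P u (b j), w⟫ * ⟪z, b j⟫ = -(⟪P u w, b j⟫ * ⟪z, b j⟫) := fun j => by
      rw [h.swap, inner_neg_left, h.cyc (b j), neg_mul]
    simp_rw [this, Finset.sum_neg_distrib, sum_inner_mul_inner']
  rw [h3, h4, ← h.cyc']
  ring

/-- The value 24 is what normalises `rBar`: it cancels the factor `1/4` and the `1/3!` of the scalar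
product of three-forms. It arises as `2·6 + 2·(7 - 1)`. -/
theorem sum_starForm_starForm (u v : V) :
    ∑ i, ∑ j, ∑ k, starForm P u (b i) (b j) (b k) * starForm P v (b i) (b j) (b k) =
      24 * ⟪u, v⟫ := by
  have h0 : ∀ j, ⟪b j, b j⟫ = (1 : ℝ) := fun j => by
    rw [real_inner_self_eq_norm_sq, b.norm_eq_one]; norm_num
  have h1 : ∀ i, ∑ j, ∑ k, starForm P u (b i) (b j) (b k) * starForm P v (b i) (b j) (b k) =
      2 * ⟪P u (b i), P v (b i)⟫ + 2 * (⟪u, v⟫ - ⟪u, b i⟫ * ⟪v, b i⟫) := by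
    intro i
    have cyc : ∀ y z, starForm P v (b i) y z = starForm P v y z (b i) := fun y z => by
      rw [h.starForm_swap₂, h.starForm_swap₃, neg_neg]
    have e1 : ∀ j k, starForm P u (b i) (b j) (b k) * starForm P v (b i) (b j) (b k) =
      -(⟪P (P u (b i)) (b j), b k⟫ * starForm P v (b j) (b k) (b i)) +
      ⟪u, b j⟫ * (⟪b i, b k⟫ * starForm P v (b i) (b j) (b k)) -
      ⟪b i, b j⟫ * (⟪u, b k⟫ * starForm P v (b i) (b j) (b k)) := fun j k => by
        rw [← cyc, starForm, ← h.cyc']; ring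
    have e2 : ∀ x y, ∑ j, ∑ k, ⟪x, b j⟫ * (⟪y, b k⟫ * starForm P v (b i) (b j) (b k)) =
        starForm P v (b i) x y := fun x y => by
      have h1 := fun j => sum_inner_mul b y (starBilin P v (b i) (b j))
      have h2 := sum_inner_mul b x ((starBilin P v (b i)).flip y)
      simp only [starBilin, LinearMap.mk₂_apply, LinearMap.flip_apply] at h1 h2
      simp only [← Finset.mul_sum, h1, h2]
    simp only [e1, Finset.sum_add_distrib, Finset.sum_sub_distrib, Finset.sum_neg_distrib, e2,
      h.sum_starForm b h7]
    rw [h.starForm_swap₃ v (b i) (b i) u, h.cyc']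
    simp only [starForm, h0, real_inner_comm u, ← h.cyc']
    have e3 : ⟪P (P v (b i)) u, b i⟫ = ⟪P (P u (b i)) v, b i⟫ := by
      rw [h.cyc', real_inner_comm, h.cyc' _ v]
    rw [e3]
    ring
  simp only [h1, Finset.sum_add_distrib, ← Finset.mul_sum, Finset.sum_sub_distrib,
    h.sum_inner_P b h7, sum_inner_mul_inner']
  simp [h7]; ring

end Contractions

end IsCross

variable [FiniteDimensional ℝ V]

/-- The cross product as a bilinear map. -/
def crossL (φ : V [⋀^Fin 3]→ₗ[ℝ] ℝ) : V →ₗ[ℝ] V →ₗ[ℝ] V :=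
  have key : ∀ x y z, ⟪cross φ x y, z⟫ = triL φ x y z := fun x y z => inner_vecOf (triL φ x y) z
  LinearMap.mk₂ ℝ (cross φ)
    (fun x x' y => ext_inner_right ℝ fun z => by simp [key, inner_add_left])
    (fun c x y => ext_inner_right ℝ fun z => by simp [key, real_inner_smul_left])
    (fun x y y' => ext_inner_right ℝ fun z => by simp [key, inner_add_left])
    (fun c x y => ext_inner_right ℝ fun z => by simp [key, real_inner_smul_left])

theorem inner_crossL (φ : V [⋀^Fin 3]→ₗ[ℝ] ℝ) (x y z : V) :
    ⟪crossL φ x y, z⟫ = φ ![x, y, z] := inner_vecOf (triL φ x y) z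

omit [FiniteDimensional ℝ V] in
-- Each index lies in exactly three of the seven Cayley triples, namely those starting at `k - 3`,
-- `k` and `k - 1` modulo 7.
theorem IsCayley.triL_eq {e : OrthonormalBasis (Fin 7) ℝ V} {φ : V [⋀^Fin 3]→ₗ[ℝ] ℝ}
    (he : IsCayley e φ) (x y : V) (k : Fin 7) : φ ![x, y, e k] =
      (⟪e (k + 4), x⟫ * ⟪e (k + 5), y⟫ - ⟪e (k + 5), x⟫ * ⟪e (k + 4), y⟫) +
      (⟪e (k + 1), x⟫ * ⟪e (k + 3), y⟫ - ⟪e (k + 3), x⟫ * ⟪e (k + 1), y⟫) +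
      (⟪e (k + 2), x⟫ * ⟪e (k + 6), y⟫ - ⟪e (k + 6), x⟫ * ⟪e (k + 2), y⟫) := by
  rw [he]
  simp only [Matrix.det_fin_three, Matrix.of_apply, Matrix.cons_val_zero, Matrix.cons_val_one,
    Matrix.cons_val_two, Matrix.head_cons, Matrix.tail_cons, Fin.sum_univ_seven]
  fin_cases k <;>
  simp only [e.inner_eq_ite, Fin.isValue, Fin.reduceFinMk, Fin.zero_eta, Fin.mk_one, Fin.reduceAdd,
    Fin.reduceEq, zero_add, if_true, if_false, zero_ne_one, one_ne_zero] <;> ring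

theorem IsCayley.isCross {e : OrthonormalBasis (Fin 7) ℝ V} {φ : V [⋀^Fin 3]→ₗ[ℝ] ℝ}
    (he : IsCayley e φ) : IsCross (crossL φ) where
  swap x y := ext_inner_right ℝ fun z => by
    rw [inner_neg_left, inner_crossL, inner_crossL, ← triL_apply, triL_swap, triL_apply]
  cyc x y z := by rw [inner_crossL, inner_crossL, ← triL_apply, triL_cyc, triL_apply]
  -- In coordinates this is a polynomial identity of degree four in the components of `x` and `y`.
  norm x y := by
    have h1 : ∀ u v : V, ⟪u, v⟫ = ∑ k, ⟪e k, u⟫ * ⟪e k, v⟫ := fun u v => by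
      rw [← sum_inner_mul_inner' e]; simp only [real_inner_comm]
    rw [h1 (crossL φ x y)]
    simp only [real_inner_comm (crossL φ x y), inner_crossL, he.triL_eq]
    rw [h1 x x, h1 y y, h1 x y]
    generalize hx : (fun k => ⟪e k, x⟫) = X
    generalize hy : (fun k => ⟪e k, y⟫) = Y
    have hx' : ∀ k, ⟪e k, x⟫ = X k := fun k => congrFun hx k
    have hy' : ∀ k, ⟪e k, y⟫ = Y k := fun k => congrFun hy k
    simp only [hx', hy', Fin.sum_univ_seven, Fin.isValue, Fin.reduceAdd, zero_add]
    ring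

theorem starPhi_eq {φ : V [⋀^Fin 3]→ₗ[ℝ] ℝ} (h : IsCross (crossL φ)) (v : Fin 4 → V) :
    starPhi φ v = starForm (crossL φ) (v 0) (v 1) (v 2) (v 3) := by
  rw [h.starForm_eq_cyclic]; rfl

/-- A generator `f ⊗ (y ⌟ ∗φ)` corresponds to the rank-one endomorphism `f ⊗ y`, and the
correspondence is linear. -/
theorem exists_of_mem_spaceX {φ : V [⋀^Fin 3]→ₗ[ℝ] ℝ} (h : IsCross (crossL φ))
    {α : V → (Fin 3 → V) → ℝ} (hα : α ∈ spaceX φ) : ∃ S : V →ₗ[ℝ] V,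
      ∀ x v, α x v = starForm (crossL φ) (S x) (v 0) (v 1) (v 2) := by
  induction hα using Submodule.span_induction with
  | mem α hα =>
    obtain ⟨f, y, rfl⟩ := hα
    refine ⟨f.smulRight y, fun x v => ?_⟩
    simp only [interior, starPhi_eq h]
    change f x * starForm (crossL φ) y (v 0) (v 1) (v 2) = _
    simp only [starForm, LinearMap.smulRight_apply, map_smul, LinearMap.smul_apply,
      real_inner_smul_left]
    ring
  | zero => exact ⟨0, fun x v => by simp [starForm]⟩
  | add α β _ _ hα hβ =>
    obtain ⟨S, hS⟩ := hα
    obtain ⟨S', hS'⟩ := hβ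
    refine ⟨S + S', fun x v => ?_⟩
    simp only [Pi.add_apply, hS, hS', starForm, LinearMap.add_apply, map_add, inner_add_left]
    ring
  | smul c α _ hα =>
    obtain ⟨S, hS⟩ := hα
    refine ⟨c • S, fun x v => ?_⟩
    simp only [Pi.smul_apply, hS, starForm, LinearMap.smul_apply, map_smul, inner_smul_left,
      smul_eq_mul]
    simp
    ring

theorem rBar_eq {φ : V [⋀^Fin 3]→ₗ[ℝ] ℝ} (h : IsCross (crossL φ)) (h7 : Module.finrank ℝ V = 7)
    {α : V → (Fin 3 → V) → ℝ} {S : V →ₗ[ℝ] V}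
    (hS : ∀ x v, α x v = starForm (crossL φ) (S x) (v 0) (v 1) (v 2)) (x y : V) :
    rBar φ α x y = ⟪S x, y⟫ := by
  have h1 := h.sum_starForm_starForm (stdOrthonormalBasis ℝ V) (by simpa using h7) (S x) y
  simp only [rBar, LinearMap.coe_mk, AddHom.coe_mk, formInner, interior, hS, starPhi_eq h]
  rw [sum_fin_three]
  change 1 / 4 * (1 / ((Nat.factorial 3 : ℕ) : ℝ) * ∑ i, ∑ j, ∑ k,
    starForm (crossL φ) (S x) (stdOrthonormalBasis ℝ V i) (stdOrthonormalBasis ℝ V j)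
      (stdOrthonormalBasis ℝ V k) * starForm (crossL φ) y (stdOrthonormalBasis ℝ V i)
      (stdOrthonormalBasis ℝ V j) (stdOrthonormalBasis ℝ V k)) = _
  rw [h1]
  norm_num [Nat.factorial]
  ring

/-- Tensors of type `𝒳₁ + 𝒳₃` correspond to symmetric endomorphisms. -/
theorem exists_symm {φ : V [⋀^Fin 3]→ₗ[ℝ] ℝ} (h : IsCross (crossL φ))
    (h7 : Module.finrank ℝ V = 7) {α : V → (Fin 3 → V) → ℝ}
    (hα : α ∈ ⨆ c ∈ ({.X₁, .X₃} : Set G2Class), moduleX φ c) : ∃ S : V →ₗ[ℝ] V,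
      (∀ x v, α x v = starForm (crossL φ) (S x) (v 0) (v 1) (v 2)) ∧
      ∀ x y, ⟪S x, y⟫ = ⟪x, S y⟫ := by
  rw [iSup_pair] at hα
  obtain ⟨a, ⟨ha, ha'⟩, b, ⟨hb, hb'⟩, rfl⟩ := Submodule.mem_sup.1 hα
  obtain ⟨S, hS⟩ := exists_of_mem_spaceX h (add_mem ha hb)
  refine ⟨S, hS, fun x y => ?_⟩
  obtain ⟨A, hA, hA'⟩ := ha'
  obtain ⟨B, hB, hB'⟩ := hb'
  obtain ⟨c, rfl⟩ := Submodule.mem_span_singleton.1 hA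
  rw [real_inner_comm (S y), ← rBar_eq h h7 hS, ← rBar_eq h h7 hS, map_add, ← hA', ← hB']
  simp only [Pi.add_apply]
  change c * ⟪x, y⟫ + B x y = c * ⟪y, x⟫ + B y x
  rw [hB.1, real_inner_comm]

/-- Tensors of type `𝒳₂ + 𝒳₄` correspond to skew-symmetric endomorphisms. -/
theorem exists_skew {φ : V [⋀^Fin 3]→ₗ[ℝ] ℝ} (h : IsCross (crossL φ))
    (h7 : Module.finrank ℝ V = 7) {α : V → (Fin 3 → V) → ℝ}
    (hα : α ∈ ⨆ c ∈ ({.X₂, .X₄} : Set G2Class), moduleX φ c) : ∃ S : V →ₗ[ℝ] V,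
      (∀ x v, α x v = starForm (crossL φ) (S x) (v 0) (v 1) (v 2)) ∧
      ∀ x y, ⟪S x, y⟫ = -⟪x, S y⟫ := by
  rw [iSup_pair] at hα
  obtain ⟨a, ⟨ha, ha'⟩, b, ⟨hb, hb'⟩, rfl⟩ := Submodule.mem_sup.1 hα
  obtain ⟨S, hS⟩ := exists_of_mem_spaceX h (add_mem ha hb)
  refine ⟨S, hS, fun x y => ?_⟩
  obtain ⟨A, hA, hA'⟩ := ha'
  obtain ⟨B, hB, hB'⟩ := hb'
  rw [real_inner_comm (S y), ← rBar_eq h h7 hS, ← rBar_eq h h7 hS, map_add, ← hA', ← hB']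
  simp only [Pi.add_apply]
  change A x y + B x y = -(A y x + B y x)
  rw [hA.1, hB.1, neg_add]

end CrossAlgebra

/-! ### The Hodge dual of the exterior product of a Hodge dual and a three-form -/

section HodgeAlgebra

theorem append_eq_elim {α : Type*} {m n : ℕ} (u : Fin m → α) (w : Fin n → α) :
    Fin.append u w = fun i => Sum.elim u w (finSumFinEquiv.symm i) := by
  ext i
  refine Fin.addCases (fun j => ?_) (fun j => ?_) i <;> simp

theorem map_append_perm {V : Type*} [AddCommGroup V] [Module ℝ V] {m n : ℕ}
    (D : V [⋀^Fin (m + n)]→ₗ[ℝ] ℝ) (u : Fin m → V) (w : Fin n → V) (μ : Equiv.Perm (Fin m))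
    (ρ : Equiv.Perm (Fin n)) : D (Fin.append (u ∘ μ) (w ∘ ρ)) =
      ((Equiv.Perm.sign μ : ℤ) : ℝ) * ((Equiv.Perm.sign ρ : ℤ) : ℝ) * D (Fin.append u w) := by
  have h1 : ∀ (u : Fin m → V) (w : Fin n → V), D (Fin.append u w) =
      D.domDomCongr finSumFinEquiv.symm (Sum.elim u w) := fun u w => by
    rw [append_eq_elim]; rfl
  have h2 : Sum.elim (u ∘ μ) (w ∘ ρ) = Sum.elim u w ∘ Equiv.sumCongr μ ρ := by
    ext i; rcases i with i | i <;> rfl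
  rw [h1, h1, h2, AlternatingMap.map_perm]
  change Equiv.Perm.sign (Equiv.Perm.sumCongr μ ρ) • _ = _
  rw [Equiv.Perm.sign_sumCongr, Units.smul_def]
  simp

/-- Any enumeration of the complement of the range of `l` completes it. -/
theorem exists_equiv_extending {p q m : ℕ} (hm : p + q = m) {l : Fin p → Fin m}
    (hl : Function.Injective l) : ∃ τ : Fin p ⊕ Fin q ≃ Fin m, ∀ i, τ (Sum.inl i) = l i := by
  classical
  have hc : Fintype.card (Set.range l)ᶜ.Elem = q := by
    rw [Fintype.card_compl_set, Set.card_range_of_injective hl]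
    simp; omega
  exact ⟨(Equiv.sumCongr (Equiv.ofInjective l hl) (Fintype.equivFinOfCardEq hc).symm).trans
    (Equiv.Set.sumCompl (Set.range l)), fun i => by simp⟩

/-- The sign of the permutation that exchanges a block of length 3 and a block of length 4. -/
def flipSign : ℝ := ((Equiv.Perm.sign (finAddFlip (m := 3) (n := 4) : Equiv.Perm (Fin 7)) : ℤ) : ℝ)

/-- The value of the sign is irrelevant: it only scales `p_φ`, whose tangency is the only property
used. -/
theorem flipSign_ne_zero : flipSign ≠ 0 := by
  simp [flipSign]

variable {V : Type*} [AddCommGroup V] [Module ℝ V]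

/-- A form is recovered by contracting it twice with a determinant. -/
theorem sum_det_det (e : Module.Basis (Fin 7) ℝ V) (B : V [⋀^Fin 4]→ₗ[ℝ] ℝ) (l : Fin 4 → Fin 7) :
    ∑ a : Fin 3 → Fin 7, ∑ j : Fin 4 → Fin 7, B (e ∘ j) * e.det (Fin.append (e ∘ j) (e ∘ a)) *
      e.det (Fin.append (e ∘ a) (e ∘ l)) =
    144 * flipSign *
      B (e ∘ l) := by
  -- If `l` repeats an index, both sides vanish.
  by_cases hl : Function.Injective l
  swap
  · obtain ⟨i, j, hij, hne⟩ := Function.not_injective_iff.1 hl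
    have hz : ∀ a : Fin 3 → Fin 7, e.det (Fin.append (e ∘ a) (e ∘ l)) = 0 := fun a =>
      e.det.map_eq_zero_of_eq (i := Fin.natAdd 3 i) (j := Fin.natAdd 3 j) _ (by
        rw [Fin.append_right, Fin.append_right]; simp [hij])
        fun h => hne ((Fin.natAdd_injective _ _) h)
    rw [B.map_eq_zero_of_eq (e ∘ l) (by simp [hij]) hne, mul_zero]
    simp only [hz, mul_zero, Finset.sum_const_zero]
  obtain ⟨τ, hτ⟩ := exists_equiv_extending (q := 3) rfl hl
  let g : (Fin 4 ⊕ Fin 3 → Fin 7) → ℝ := fun f => B (e ∘ f ∘ Sum.inl) *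
    e.det (Fin.append (e ∘ f ∘ Sum.inl) (e ∘ f ∘ Sum.inr)) *
      e.det (Fin.append (e ∘ f ∘ Sum.inr) (e ∘ l))
  have h1 : ∑ a : Fin 3 → Fin 7, ∑ j : Fin 4 → Fin 7, B (e ∘ j) *
      e.det (Fin.append (e ∘ j) (e ∘ a)) * e.det (Fin.append (e ∘ a) (e ∘ l)) = ∑ f, g f := by
    rw [Finset.sum_comm, ← Equiv.sum_comp (Equiv.sumArrowEquivProdArrow _ _ _).symm,
      Fintype.sum_prod_type]
    rfl
  -- A nonzero term needs all seven indices of `j` and `a` distinct, and `a` disjoint from `l`. So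
  -- `j` rearranges `l` and `a` rearranges its complement, which leaves `4! · 3! = 144` terms.
  have h2 : ∑ x : Equiv.Perm (Fin 4) × Equiv.Perm (Fin 3), g (τ ∘ Equiv.sumCongr x.1 x.2) =
      ∑ f, g f := by
    refine Finset.sum_of_injOn (fun x => τ ∘ Equiv.sumCongr x.1 x.2) ?_ (by simp) ?_ (by simp)
    · rintro ⟨μ, ρ⟩ - ⟨μ', ρ'⟩ - h
      have := τ.injective.comp_left h
      refine Prod.ext (Equiv.ext fun i => ?_) (Equiv.ext fun i => ?_)
      · simpa using congrFun this (Sum.inl i)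
      · simpa using congrFun this (Sum.inr i)
    · intro f _ hf
      by_contra hg
      apply hf
      have hg1 : e.det (Fin.append (e ∘ f ∘ Sum.inl) (e ∘ f ∘ Sum.inr)) ≠ 0 := fun h => hg (by
        simp only [g, h, mul_zero, zero_mul])
      have hg2 : e.det (Fin.append (e ∘ f ∘ Sum.inr) (e ∘ l)) ≠ 0 := fun h => hg (by
        simp only [g, h, mul_zero])
      have hinj : Function.Injective f := by
        intro x y hxy
        by_contra hne
        apply hg1
        rw [append_eq_elim]
        refine AlternatingMap.map_eq_zero_of_eq (i := finSumFinEquiv x) (j := finSumFinEquiv y)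
          e.det _ ?_ (by simpa using hne)
        have : ∀ x, Sum.elim (e ∘ f ∘ Sum.inl) (e ∘ f ∘ Sum.inr) x = e (f x) := by
          rintro (x | x) <;> rfl
        simp only [Equiv.symm_apply_apply, this, hxy]
      have hbij : Function.Bijective f :=
        (Fintype.bijective_iff_injective_and_card f).2 ⟨hinj, by simp⟩
      let σ : Equiv.Perm (Fin 4 ⊕ Fin 3) := (Equiv.ofBijective f hbij).trans τ.symm
      have hσ : Set.MapsTo σ (Set.range Sum.inr) (Set.range Sum.inr) := by
        rintro _ ⟨i, rfl⟩
        rcases hx : σ (Sum.inr i) with k | k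
        · exfalso
          apply hg2
          refine AlternatingMap.map_eq_zero_of_eq (i := Fin.castAdd 4 i) (j := Fin.natAdd 3 k)
            e.det _ ?_ (fun h => ?_)
          · have : f (Sum.inr i) = l k := by
              rw [← hτ, ← hx]; simp [σ]
            simp [this]
          · have := congrArg Fin.val h
            simp at this; omega
        · exact ⟨k, rfl⟩
      obtain ⟨⟨μ, ρ⟩, hμ⟩ := Equiv.Perm.mem_sumCongrHom_range_of_perm_mapsTo_inl
        ((Equiv.Perm.perm_mapsTo_inl_iff_mapsTo_inr σ).2 hσ)
      refine ⟨(μ, ρ), by simp, ?_⟩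
      ext x
      have : Equiv.sumCongr μ ρ x = σ x := by rw [← hμ]; rfl
      simp [this, σ]
  -- All surviving terms agree: the sign of `μ` occurs in `B` and in one determinant, that of `ρ` in
  -- both determinants, so they square away and only the exchange of the two blocks remains.
  have h3 : ∀ x : Equiv.Perm (Fin 4) × Equiv.Perm (Fin 3), g (τ ∘ Equiv.sumCongr x.1 x.2) =
      flipSign *
        B (e ∘ l) := by
    rintro ⟨μ, ρ⟩
    have sq : ∀ {n : ℕ} (μ : Equiv.Perm (Fin n)), ((Equiv.Perm.sign μ : ℤ) : ℝ) *
        ((Equiv.Perm.sign μ : ℤ) : ℝ) = 1 := fun μ => by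
      rw [← Int.cast_mul, ← Units.val_mul, Int.units_mul_self]; simp
    have e1 : e ∘ (τ ∘ Equiv.sumCongr μ ρ) ∘ Sum.inl = (e ∘ l) ∘ μ := by
      ext i; simp [hτ]
    have e2 : e ∘ (τ ∘ Equiv.sumCongr μ ρ) ∘ Sum.inr = (e ∘ τ ∘ Sum.inr) ∘ ρ := by
      ext i; simp
    have e3 : e.det (Fin.append (e ∘ τ ∘ Sum.inr) (e ∘ l)) =
        flipSign *
          e.det (Fin.append (e ∘ l) (e ∘ τ ∘ Sum.inr)) := by
      have : Fin.append (e ∘ τ ∘ Sum.inr) (e ∘ l) = Fin.append (e ∘ l) (e ∘ τ ∘ Sum.inr) ∘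
          (finAddFlip (m := 3) (n := 4)) := by
        ext i
        refine Fin.addCases (fun j => ?_) (fun j => ?_) i
        · rw [Fin.append_left]
          exact ((congrArg (Fin.append (e ∘ l) (e ∘ τ ∘ Sum.inr))
            (finAddFlip_apply_castAdd j 4)).trans (Fin.append_right _ _ j)).symm
        · rw [Fin.append_right]
          exact ((congrArg (Fin.append (e ∘ l) (e ∘ τ ∘ Sum.inr))
            (finAddFlip_apply_natAdd j 3)).trans (Fin.append_left _ _ j)).symm
      have h5 := e.det.map_perm (Fin.append (e ∘ l) (e ∘ τ ∘ Sum.inr))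
        (finAddFlip (m := 3) (n := 4) : Equiv.Perm (Fin 7))
      rw [Units.smul_def] at h5
      rw [this, flipSign]
      refine h5.trans ?_
      simp
    have e4 : e.det (Fin.append (e ∘ l) (e ∘ τ ∘ Sum.inr)) *
        e.det (Fin.append (e ∘ l) (e ∘ τ ∘ Sum.inr)) = 1 := by
      have : Fin.append (e ∘ l) (e ∘ τ ∘ Sum.inr) = e ∘ (finSumFinEquiv.symm.trans τ) := by
        rw [append_eq_elim]
        ext i
        rcases h : finSumFinEquiv.symm i with k | k <;> simp [h, hτ]
      rw [this]
      have h5 := e.det.map_perm e (finSumFinEquiv.symm.trans τ)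
      rw [Module.Basis.det_self] at h5
      rw [h5, Units.smul_def]
      simpa using sq _
    have e5 := map_append_perm (m := 4) (n := 3) e.det (e ∘ l) (e ∘ τ ∘ Sum.inr) μ ρ
    have e6 := map_append_perm (m := 3) (n := 4) e.det (e ∘ τ ∘ Sum.inr) (e ∘ l) ρ 1
    have e7 : B ((e ∘ l) ∘ μ) = ((Equiv.Perm.sign μ : ℤ) : ℝ) * B (e ∘ l) := by
      rw [B.map_perm, Units.smul_def]; simp
    simp only [Equiv.Perm.coe_one, Function.comp_id, Equiv.Perm.sign_one, Units.val_one,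
      Int.cast_one, mul_one] at e6
    simp only [g, e1, e2]
    rw [e7, e5, e6, e3]
    linear_combination flipSign * B (e ∘ l) * (((Equiv.Perm.sign μ : ℤ) : ℝ) * ((Equiv.Perm.sign μ : ℤ) : ℝ) *
        ((Equiv.Perm.sign ρ : ℤ) : ℝ) * ((Equiv.Perm.sign ρ : ℤ) : ℝ) * e4 +
        ((Equiv.Perm.sign μ : ℤ) : ℝ) * ((Equiv.Perm.sign μ : ℤ) : ℝ) * sq ρ + sq μ)
  rw [h1, ← h2]
  simp only [h3, Finset.sum_const, Finset.card_univ, Fintype.card_prod, Fintype.card_perm,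
    Fintype.card_fin]
  norm_num [Nat.factorial]
  ring

end HodgeAlgebra

/-! ### The one-form ∗(∗dφ ∧ φ) in terms of the endomorphism `S` -/

section HodgeWedge

variable {V : Type*} [NormedAddCommGroup V] [InnerProductSpace ℝ V]

/-- `∗(∗B ∧ φ)` is, up to a constant, the contraction of `B` with `φ`. -/
theorem hodge_wedge_hodge (e : OrthonormalBasis (Fin 7) ℝ V) (B : V [⋀^Fin 4]→ₗ[ℝ] ℝ)
    (φ : V [⋀^Fin 3]→ₗ[ℝ] ℝ) (k : Fin 7) :
    hodge e 6 1 rfl (wedge (hodge e 4 3 rfl B) φ) ![e k] = (1 / 6) * flipSign *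
      ∑ b : Fin 3 → Fin 7, φ (e ∘ b) * B (Fin.append (e ∘ b) ![e k]) := by
  let D := e.toBasis.det
  let γ := hodge e 4 3 rfl B
  have h1 : hodge e 6 1 rfl (wedge γ φ) ![e k] = (1 / 36) * ∑ i : Fin 6 → Fin 7,
      γ (fun s => e (i (Fin.castAdd 3 s))) * φ (fun s => e (i (Fin.natAdd 3 s))) *
        D (Fin.append (e ∘ i) ![e k]) := by
    -- Reindexing the sum by `σ` permutes the arguments of the determinant, whose sign cancels that
    -- of the wedge product. Hence all `6!` permutations contribute equally.
    have h2 : ∀ σ : Equiv.Perm (Fin 6), ∑ i : Fin 6 → Fin 7, ((Equiv.Perm.sign σ : ℤ) : ℝ) *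
        (γ (fun s => e (i (σ (Fin.castAdd 3 s)))) * φ (fun s => e (i (σ (Fin.natAdd 3 s))))) *
        D (Fin.append (e ∘ i) ![e k]) = ∑ i : Fin 6 → Fin 7,
      γ (fun s => e (i (Fin.castAdd 3 s))) * φ (fun s => e (i (Fin.natAdd 3 s))) *
        D (Fin.append (e ∘ i) ![e k]) := by
      intro σ
      rw [← Equiv.sum_comp (Equiv.arrowCongr σ (Equiv.refl (Fin 7)))]
      refine Finset.sum_congr rfl fun i _ => ?_
      have h3 := map_append_perm (m := 6) (n := 1) D (e ∘ i) ![e k] σ⁻¹ 1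
      have sq : ((Equiv.Perm.sign σ : ℤ) : ℝ) * ((Equiv.Perm.sign σ : ℤ) : ℝ) = 1 := by
        rw [← Int.cast_mul, ← Units.val_mul, Int.units_mul_self]; simp
      have h4 : e ∘ (Equiv.arrowCongr σ (Equiv.refl (Fin 7)) i) = (e ∘ i) ∘ (σ⁻¹ : Equiv.Perm (Fin 6)) := rfl
      have h5 : ∀ s, Equiv.arrowCongr σ (Equiv.refl (Fin 7)) i (σ s) = i s := fun s => by simp
      simp only [Equiv.Perm.coe_one, Function.comp_id, Equiv.Perm.sign_one, Units.val_one,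
        Int.cast_one, mul_one, Equiv.Perm.sign_inv] at h3
      rw [h4, h3]
      simp only [h5]
      linear_combination (γ (fun s => e (i (Fin.castAdd 3 s))) *
        φ (fun s => e (i (Fin.natAdd 3 s))) * D (Fin.append (e ∘ i) ![e k])) * sq
    have h6 : hodge e 6 1 rfl (wedge γ φ) ![e k] = (1 / 720) * ∑ i : Fin 6 → Fin 7, ((1 / 36) *
      ∑ σ : Equiv.Perm (Fin 6), ((Equiv.Perm.sign σ : ℤ) : ℝ) *
        (γ (fun s => e (i (σ (Fin.castAdd 3 s)))) * φ (fun s => e (i (σ (Fin.natAdd 3 s)))))) *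
        D (Fin.append (e ∘ i) ![e k]) := by
      simp only [hodge, wedge]
      norm_num [Nat.factorial]
      rfl
    rw [h6]
    simp only [mul_assoc, ← Finset.mul_sum, Finset.sum_mul]
    rw [Finset.sum_comm]
    simp only [mul_assoc, ← Finset.mul_sum] at h2
    simp only [← Finset.mul_sum, h2, Finset.sum_const, Finset.card_univ, Fintype.card_perm,
      Fintype.card_fin, nsmul_eq_mul]
    norm_num [Nat.factorial]
    ring
  have h7 : ∀ u : Fin 3 → V, γ u = (1 / 24) * ∑ j : Fin 4 → Fin 7, B (e ∘ j) *
      D (Fin.append (e ∘ j) u) := fun u => by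
    simp only [γ, hodge]
    norm_num [Nat.factorial]
    rfl
  have h8 : ∀ a b : Fin 3 → Fin 7, (Fin.append (e ∘ Fin.append a b) ![e k] : Fin (6 + 1) → V) =
      (Fin.append (e ∘ a) (e ∘ Fin.append b ![k]) : Fin (3 + 4) → V) := fun a b => by
    ext j; fin_cases j <;> rfl
  have h9 : ∀ b : Fin 3 → Fin 7, (Fin.append (e ∘ b) ![e k] : Fin (3 + 1) → V) =
      e ∘ (Fin.append b ![k] : Fin 4 → Fin 7) := fun b => by
    ext j; fin_cases j <;> rfl
  change hodge e 6 1 rfl (wedge γ φ) ![e k] = _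
  rw [h1, ← Equiv.sum_comp (Fin.appendEquiv 3 3), Fintype.sum_prod_type, Finset.sum_comm]
  -- The six summation indices split into a block `a` for the dual of `B` and a block `b` for `φ`.
  -- Summing over `a` is the double contraction `sum_det_det`, and the constant is `144 / 24`.
  have h10 : ∀ b : Fin 3 → Fin 7, ∑ a : Fin 3 → Fin 7,
      γ (fun s => e (Fin.append a b (Fin.castAdd 3 s))) *
        φ (fun s => e (Fin.append a b (Fin.natAdd 3 s))) *
        D (Fin.append (e ∘ Fin.append a b) ![e k]) =
      6 * flipSign * (φ (e ∘ b) * B (e ∘ (Fin.append b ![k] : Fin 4 → Fin 7))) := by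
    intro b
    have h11 := sum_det_det e.toBasis B (Fin.append b ![k])
    simp only [OrthonormalBasis.coe_toBasis] at h11
    have h12 : ∀ a : Fin 3 → Fin 7, γ (fun s => e (Fin.append a b (Fin.castAdd 3 s))) *
        φ (fun s => e (Fin.append a b (Fin.natAdd 3 s))) *
        D (Fin.append (e ∘ Fin.append a b) ![e k]) = (1 / 24) * φ (e ∘ b) *
        ∑ j : Fin 4 → Fin 7, B (e ∘ j) * D (Fin.append (e ∘ j) (e ∘ a)) *
          D (Fin.append (e ∘ a) (e ∘ Fin.append b ![k])) := by
      intro a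
      have r1 : (fun s => e (Fin.append a b (Fin.castAdd 3 s))) = e ∘ a := by ext s; simp
      have r2 : (fun s => e (Fin.append a b (Fin.natAdd 3 s))) = e ∘ b := by
        ext s; exact congrArg e (Fin.append_right a b s)
      rw [r1, r2, h8, h7, ← Finset.sum_mul]
      ring
    simp only [h12, ← Finset.mul_sum]
    rw [h11]
    ring
  simp only [h9]
  have h13 := Finset.sum_congr rfl fun (b : Fin 3 → Fin 7) (_ : b ∈ Finset.univ) => h10 b
  rw [← Finset.mul_sum] at h13
  have h14 := congrArg (fun r : ℝ => 1 / 36 * r) h13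
  refine h14.trans ?_
  ring

theorem hodge_linear {k m : ℕ} (e : OrthonormalBasis (Fin m) ℝ V) (h : k + 1 = m)
    (a : (Fin k → V) → ℝ) : ∃ f : V →ₗ[ℝ] ℝ, ∀ x, hodge e k 1 h a ![x] = f x := by
  subst h
  have h1 : ∀ (u : Fin k → V) (x : V), Fin.append u ![x] =
      Function.update (Fin.append u ![(0 : V)]) (Fin.last k) x := fun u x => by
    ext j
    refine Fin.lastCases ?_ (fun i => ?_) j
    · rw [Function.update_self]
      exact Fin.append_right u ![x] 0
    · rw [Function.update_of_ne (Fin.castSucc_lt_last i).ne]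
      exact (Fin.append_left u ![x] i).trans (Fin.append_left u ![0] i).symm
  refine ⟨(1 / (k.factorial : ℝ)) • ∑ i : Fin k → Fin (k + 1), a (fun j => e (i j)) •
    e.toBasis.det.toMultilinearMap.toLinearMap (Fin.append (fun s => e (i s)) ![(0 : V)])
      (Fin.last k), fun x => ?_⟩
  simp only [hodge, Fin.cast_refl, id_eq, h1 _ x, LinearMap.smul_apply, LinearMap.sum_apply,
    MultilinearMap.toLinearMap_apply, smul_eq_mul, AlternatingMap.coe_multilinearMap]

/-- The four-form `∗φ`, with its first argument fixed, as an alternating map. -/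
def IsCross.starAlt {P : V →ₗ[ℝ] V →ₗ[ℝ] V} (h : IsCross P) (u : V) : V [⋀^Fin 3]→ₗ[ℝ] ℝ :=
  have c3 : ∀ i : Fin 3, i = 0 ∨ i = 1 ∨ i = 2 := by decide
  have n01 : (0 : Fin 3) ≠ 1 := by decide
  have n02 : (0 : Fin 3) ≠ 2 := by decide
  have n12 : (1 : Fin 3) ≠ 2 := by decide
  have n10 := n01.symm
  have n20 := n02.symm
  have n21 := n12.symm
  { toFun := fun v => starForm P u (v 0) (v 1) (v 2)
    map_update_add' := fun v i x y => by
      obtain rfl | rfl | rfl := c3 i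
      all_goals
        simp only [starForm, Function.update_self, Function.update_of_ne, n01, n02, n10, n12, n20, n21,
          ne_eq, not_false_eq_true, map_add, LinearMap.add_apply, inner_add_left, inner_add_right]
        ring
    map_update_smul' := fun v i c x => by
      obtain rfl | rfl | rfl := c3 i
      all_goals
        simp only [starForm, Function.update_self, Function.update_of_ne, n01, n02, n10, n12, n20, n21,
          ne_eq, not_false_eq_true, map_smul, LinearMap.smul_apply, real_inner_smul_left,
          real_inner_smul_right, smul_eq_mul]
        ring
    map_eq_zero_of_eq' := fun v i j hv hij => by
      have r1 : ∀ x z, starForm P u x x z = 0 := fun x z => by linarith [h.starForm_swap₂ u x x z]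
      have r2 : ∀ x z, starForm P u z x x = 0 := fun x z => by linarith [h.starForm_swap₃ u z x x]
      have r3 : ∀ x z, starForm P u x z x = 0 := fun x z => by rw [h.starForm_swap₃, r1, neg_zero]
      obtain rfl | rfl | rfl := c3 i
      all_goals
        obtain rfl | rfl | rfl := c3 j
        all_goals first | exact absurd rfl hij | (rw [hv]; first | apply r1 | apply r2 | apply r3) }

/-- The form `β` is the alternation of `x ↦ S x ⌟ ∗φ`, so contracting it with `φ` gives four sums.
Three contribute `-4` each after signs, by `sum_starForm`; the fourth is the full contraction of `φ`
with `∗φ` over three indices, which vanishes. The factor is `-12 / 6`. -/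
theorem hodge_wedge_of_star {φ : V [⋀^Fin 3]→ₗ[ℝ] ℝ} [FiniteDimensional ℝ V]
    (h : IsCross (crossL φ)) (e : OrthonormalBasis (Fin 7) ℝ V) (S : V →ₗ[ℝ] V)
    (β : (Fin 4 → V) → ℝ) (hβ : ∀ v, β v = ∑ i : Fin 4, (-1 : ℝ) ^ (i : ℕ) *
      starForm (crossL φ) (S (v i)) (v (i.succAbove 0)) (v (i.succAbove 1)) (v (i.succAbove 2)))
    (x : V) : hodge e 6 1 rfl (wedge (hodge e 4 3 rfl β) φ) ![x] =
      -2 * flipSign * ∑ i, ⟪crossL φ (e i) (S (e i)), x⟫ := by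
  let P := crossL φ
  let A : V →ₗ[ℝ] V [⋀^Fin 3]→ₗ[ℝ] ℝ :=
    { toFun := fun u => h.starAlt (S u)
      map_add' := fun u u' => by ext v; simp [IsCross.starAlt, starForm, inner_add_left]; ring
      map_smul' := fun c u => by ext v; simp [IsCross.starAlt, starForm, inner_smul_left]; ring }
  let B := AlternatingMap.alternatizeUncurryFin A
  have hB : β = B := by
    ext v
    rw [hβ, AlternatingMap.alternatizeUncurryFin_apply]
    refine Finset.sum_congr rfl fun i _ => ?_
    rw [zsmul_eq_mul]
    push_cast
    rfl
  have key : ∀ k, hodge e 6 1 rfl (wedge (hodge e 4 3 rfl β) φ) ![e k] =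
      -2 * flipSign * ∑ i, ⟪crossL φ (e i) (S (e i)), e k⟫ := by
    intro k
    rw [hB, hodge_wedge_hodge, ← hB, sum_fin_three]
    have hφ : ∀ i j l, φ (e ∘ ![i, j, l]) = ⟪P (e i) (e j), e l⟫ := fun i j l => by
      rw [inner_crossL]; congr 1; ext s; fin_cases s <;> rfl
    have hv : ∀ i j l, β (Fin.append (e ∘ ![i, j, l]) ![e k]) =
        starForm P (S (e i)) (e j) (e l) (e k) - starForm P (S (e j)) (e i) (e l) (e k) +
        starForm P (S (e l)) (e i) (e j) (e k) - starForm P (S (e k)) (e i) (e j) (e l) := by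
      intro i j l
      rw [hβ, Fin.sum_univ_four]
      change (-1) ^ 0 * starForm P (S (e i)) (e j) (e l) (e k) +
        (-1) ^ 1 * starForm P (S (e j)) (e i) (e l) (e k) +
        (-1) ^ 2 * starForm P (S (e l)) (e i) (e j) (e k) +
        (-1) ^ 3 * starForm P (S (e k)) (e i) (e j) (e l) = _
      ring
    simp only [hφ, hv, mul_sub, mul_add, Finset.sum_add_distrib, Finset.sum_sub_distrib]
    have t1 : ∑ i, ∑ j, ∑ l, ⟪P (e i) (e j), e l⟫ * starForm P (S (e i)) (e j) (e l) (e k) =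
        -4 * ∑ i, ⟪P (e i) (S (e i)), e k⟫ := by
      rw [Finset.mul_sum]
      exact Finset.sum_congr rfl fun i _ => h.sum_starForm e (by simp) _ _ _
    have t2 : ∑ i, ∑ j, ∑ l, ⟪P (e i) (e j), e l⟫ * starForm P (S (e j)) (e i) (e l) (e k) =
        4 * ∑ i, ⟪P (e i) (S (e i)), e k⟫ := by
      rw [Finset.sum_comm, ← neg_eq_iff_eq_neg.2 (t1.trans (neg_mul _ _)), ← Finset.sum_neg_distrib]
      refine Finset.sum_congr rfl fun i _ => ?_
      rw [← Finset.sum_neg_distrib]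
      refine Finset.sum_congr rfl fun j _ => ?_
      rw [← Finset.sum_neg_distrib]
      refine Finset.sum_congr rfl fun l _ => ?_
      rw [h.swap, inner_neg_left, neg_mul]
    have t3 : ∑ i, ∑ j, ∑ l, ⟪P (e i) (e j), e l⟫ * starForm P (S (e l)) (e i) (e j) (e k) =
        -4 * ∑ i, ⟪P (e i) (S (e i)), e k⟫ := by
      rw [← t1]
      conv_rhs => rw [sum_cyc, sum_cyc]
      refine Finset.sum_congr rfl fun i _ => Finset.sum_congr rfl fun j _ =>
        Finset.sum_congr rfl fun l _ => ?_
      rw [h.cyc (e l), h.cyc]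
    have t4 : ∑ i, ∑ j, ∑ l, ⟪P (e i) (e j), e l⟫ * starForm P (S (e k)) (e i) (e j) (e l) = 0 := by
      refine Finset.sum_eq_zero fun i _ => ?_
      have := h.sum_starForm e (by simp) (e i) (S (e k)) (e i)
      rw [h.cyc', h.swap, inner_neg_right, ← h.cyc', h.self] at this
      simp only [inner_zero_left, neg_zero, mul_zero] at this
      rw [← this]
      refine Finset.sum_congr rfl fun j _ => Finset.sum_congr rfl fun l _ => ?_
      rw [h.starForm_swap₂ _ (e i), h.starForm_swap₃ _ _ (e i), neg_neg]
    rw [t1, t2, t3, t4]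
    ring
  obtain ⟨f, hf⟩ := hodge_linear e rfl (wedge (hodge e 4 3 rfl β) φ)
  simp only [hf] at key ⊢
  have : f = (-2 * flipSign) • ∑ i, innerₗ V (crossL φ (e i) (S (e i))) :=
    e.toBasis.ext fun k => by simp [key]
  rw [this]; simp

end HodgeWedge

/-! ### The `SU(3)`-structures on a hyperplane of a `G₂`-space -/

section Hyperplane

/-- The new product is `(c - s J) Q`, a unit complex multiple of the old one. The norm is kept
because `J` is orthogonal and `Q x y` is perpendicular to `J (Q x y)`. -/
theorem IsSU3.rotate {T : Type*} [NormedAddCommGroup T] [InnerProductSpace ℝ T]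
    {J : T →ₗ[ℝ] T} {Q : T →ₗ[ℝ] T →ₗ[ℝ] T} (h : IsSU3 J Q) {c s : ℝ} (hcs : c ^ 2 + s ^ 2 = 1) :
    IsSU3 J (c • Q + s • Q ∘ₗ J) where
  J_J := h.J_J
  inner_J := h.inner_J
  swap x y := by
    simp only [LinearMap.add_apply, LinearMap.smul_apply, LinearMap.comp_apply]
    rw [h.J_left, h.J_left, h.swap x y]; simp [add_comm]
  cyc x y z := by
    simp only [LinearMap.add_apply, LinearMap.smul_apply, LinearMap.comp_apply, inner_add_left,
      real_inner_smul_left]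
    rw [h.J_move x y, h.cyc x y z, h.cyc x (J y) z]
  J_left x y := by
    simp only [LinearMap.add_apply, LinearMap.smul_apply, LinearMap.comp_apply, h.J_left]
    simp only [map_add, map_smul, smul_neg, map_neg, neg_add, neg_neg]
  norm x y := by
    have h1 : ⟪Q x y, J (Q x y)⟫ = 0 := by rw [real_inner_comm, h.inner_J_self]
    have h2 := h.inner_J_J (Q x y) (Q x y)
    simp only [LinearMap.add_apply, LinearMap.smul_apply, LinearMap.comp_apply, h.J_left,
      inner_add_left, inner_add_right, real_inner_smul_left, real_inner_smul_right,
      inner_neg_left, inner_neg_right, h1, h.inner_J_self, h2]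
    rw [← h.norm x y]
    linear_combination ⟪Q x y, Q x y⟫ * hcs

/-- The rotation of the complex volume form multiplies the endomorphism by a unit complex number. -/
theorem IsSU3.torsionForm_rotate {T : Type*}
    [NormedAddCommGroup T] [InnerProductSpace ℝ T] {J : T →ₗ[ℝ] T} {Q : T →ₗ[ℝ] T →ₗ[ℝ] T}
    (h : IsSU3 J Q) {c s : ℝ} (hcs : c ^ 2 + s ^ 2 = 1) (K : T →ₗ[ℝ] T) :
    torsionForm (c • Q + s • Q ∘ₗ J) (c • K - s • J ∘ₗ K) = torsionForm Q K := by
  funext x y z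
  simp only [torsionForm_apply, LinearMap.add_apply, LinearMap.smul_apply, LinearMap.comp_apply,
    LinearMap.sub_apply, map_sub, map_smul, h.J_J, h.J_left, map_neg, LinearMap.neg_apply, inner_add_left,
    inner_sub_left, inner_neg_left, real_inner_smul_left]
  linear_combination ⟪Q (K x) y, z⟫ * hcs

variable {V T : Type*} [NormedAddCommGroup V] [InnerProductSpace ℝ V] [FiniteDimensional ℝ V]
  [NormedAddCommGroup T] [InnerProductSpace ℝ T] [FiniteDimensional ℝ T]

/-- `L` embeds `T` isometrically in `V` and `n` is a unit vector normal to the image. -/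
structure IsUnitNormal (L : T →ₗ[ℝ] V) (n : V) : Prop where
  isometric : ∀ x y, ⟪L x, L y⟫ = ⟪x, y⟫
  unit : ⟪n, n⟫ = 1
  normal : ∀ x, ⟪n, L x⟫ = 0

/-- The complex structure `Jx = P(n, x)` of a hyperplane. -/
def hypJ (P : V →ₗ[ℝ] V →ₗ[ℝ] V) (L : T →ₗ[ℝ] V) (n : V) : T →ₗ[ℝ] T :=
  LinearMap.adjoint L ∘ₗ P n ∘ₗ L

/-- The tangential part of the cross product of two vectors in a hyperplane. -/
def hypQ (P : V →ₗ[ℝ] V →ₗ[ℝ] V) (L : T →ₗ[ℝ] V) : T →ₗ[ℝ] T →ₗ[ℝ] T :=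
  (P.compl₁₂ L L).compr₂ (LinearMap.adjoint L)

/-- The endomorphism that determines the covariant derivative of the Kähler form. -/
def hypK (P : V →ₗ[ℝ] V →ₗ[ℝ] V) (L : T →ₗ[ℝ] V) (n : V) (A : T →ₗ[ℝ] T) (S : V →ₗ[ℝ] V) :
    T →ₗ[ℝ] T :=
  A - hypJ P L n ∘ₗ LinearMap.adjoint L ∘ₗ S ∘ₗ L

variable {P : V →ₗ[ℝ] V →ₗ[ℝ] V} {L : T →ₗ[ℝ] V} {n : V}

theorem inner_hypJ (x y : T) : ⟪hypJ P L n x, y⟫ = ⟪P n (L x), L y⟫ := by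
  simp [hypJ, LinearMap.adjoint_inner_left]

theorem inner_hypQ (x y z : T) : ⟪hypQ P L x y, z⟫ = ⟪P (L x) (L y), L z⟫ := by
  simp [hypQ, LinearMap.adjoint_inner_left]

namespace IsUnitNormal

variable (hL : IsUnitNormal L n)
include hL

omit [FiniteDimensional ℝ V] [FiniteDimensional ℝ T] in
theorem orthonormal (b : OrthonormalBasis (Fin 6) ℝ T) :
    Orthonormal ℝ fun o : Option (Fin 6) => o.elim n (fun i => L (b i)) := by
  rw [orthonormal_iff_ite]
  rintro (_ | i) (_ | j)
  · simpa using hL.unit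
  · simpa using hL.normal (b j)
  · simpa [real_inner_comm] using hL.normal (b i)
  · simpa [hL.isometric] using orthonormal_iff_ite.1 b.orthonormal i j

omit [FiniteDimensional ℝ T] in
theorem exists_basis (h7 : Module.finrank ℝ V = 7) (b : OrthonormalBasis (Fin 6) ℝ T) :
    ∃ e : OrthonormalBasis (Option (Fin 6)) ℝ V, e none = n ∧ ∀ i, e (some i) = L (b i) := by
  have h := hL.orthonormal b
  refine ⟨OrthonormalBasis.mk h ?_, congrFun (OrthonormalBasis.coe_mk h _) none,
    fun i => congrFun (OrthonormalBasis.coe_mk h _) (some i)⟩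
  exact (h.linearIndependent.span_eq_top_of_card_eq_finrank' (by simp [h7])).ge

theorem decomp (h7 : Module.finrank ℝ V = 7) (h6 : Module.finrank ℝ T = 6) (v : V) :
    v = ⟪n, v⟫ • n + L (LinearMap.adjoint L v) := by
  have b : OrthonormalBasis (Fin 6) ℝ T := (stdOrthonormalBasis ℝ T).reindex (finCongr h6)
  obtain ⟨e, he, he'⟩ := hL.exists_basis h7 b
  conv_lhs => rw [← e.sum_repr' v]
  rw [Fintype.sum_option, he, ← b.sum_repr' (LinearMap.adjoint L v)]
  simp [he', LinearMap.adjoint_inner_right]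

theorem adjoint_self (x : T) : LinearMap.adjoint L (L x) = x :=
  ext_inner_right ℝ fun y => by rw [LinearMap.adjoint_inner_left, hL.isometric]

theorem map_hypJ (h : IsCross P) (h7 : Module.finrank ℝ V = 7) (h6 : Module.finrank ℝ T = 6)
    (x : T) : L (hypJ P L n x) = P n (L x) := by
  have h1 : ⟪n, P n (L x)⟫ = 0 := by rw [← h.cyc', h.self, inner_zero_left]
  have h2 := hL.decomp h7 h6 (P n (L x))
  rw [h1, zero_smul, zero_add] at h2
  exact h2.symm

theorem map_hypQ (h : IsCross P) (h7 : Module.finrank ℝ V = 7) (h6 : Module.finrank ℝ T = 6)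
    (x y : T) : P (L x) (L y) = ⟪hypJ P L n x, y⟫ • n + L (hypQ P L x y) := by
  conv_lhs => rw [hL.decomp h7 h6 (P (L x) (L y))]
  rw [inner_hypJ, ← h.cyc']
  rfl

/-- All axioms come from the polarised cross product identities with one argument equal to `n`. The
additional term in the norm identity is the square of the normal component of `P (L x) (L y)`. -/
theorem isSU3 (h : IsCross P) (h7 : Module.finrank ℝ V = 7) (h6 : Module.finrank ℝ T = 6) :
    IsSU3 (hypJ P L n) (hypQ P L) where
  J_J x := ext_inner_right ℝ fun y => by
    rw [inner_hypJ, hL.map_hypJ h h7 h6, h.swap, inner_neg_left, h.cyc', h.swap n (L x),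
      h.swap n (L y), inner_neg_neg, h.inner_P_same, hL.unit, hL.isometric,
      real_inner_comm, real_inner_comm n, hL.normal, inner_neg_left]
    simp [real_inner_comm]
  inner_J x y := by
    rw [real_inner_comm, inner_hypJ, inner_hypJ, h.cyc, h.swap, inner_neg_left, ← h.cyc]
  swap x y := ext_inner_right ℝ fun z => by
    rw [inner_neg_left, inner_hypQ, inner_hypQ, h.swap, inner_neg_left]
  cyc x y z := by rw [inner_hypQ, inner_hypQ, h.cyc]
  J_left x y := ext_inner_right ℝ fun z => by
    have h1 : P n (L (hypQ P L x y)) = P n (P (L x) (L y)) := by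
      rw [hL.map_hypQ h h7 h6 x y, map_add, map_smul, h.self, smul_zero, zero_add]
    rw [inner_neg_left, inner_hypQ, hL.map_hypJ h h7 h6, inner_hypJ, h1]
    have h2 := h.inner_P_P n (L x) (L y) (L z)
    simp only [hL.normal, hL.isometric] at h2
    rw [h.cyc' (P n (L x)), h.swap n (P (L x) (L y)), inner_neg_left, h.cyc' (P (L x) (L y)),
      real_inner_comm (P n (L z))]
    rw [h.swap (L y) (L x), inner_neg_right] at h2
    linarith
  norm x y := by
    have h1 := h.norm (L x) (L y)
    rw [hL.map_hypQ h h7 h6 x y] at h1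
    simp only [inner_add_left, inner_add_right, real_inner_smul_left, real_inner_smul_right,
      hL.unit, hL.normal, hL.isometric, real_inner_comm n] at h1
    linarith

/-- The metric terms vanish since `n` is normal, and the normal component of `v` is lost because `P
n n = 0`. -/
theorem starForm_eq (h : IsCross P) (h7 : Module.finrank ℝ V = 7) (h6 : Module.finrank ℝ T = 6)
    (v : V) (y z : T) : starForm P v n (L y) (L z) =
      ⟪hypQ P L (hypJ P L n (LinearMap.adjoint L v)) y, z⟫ := by
  rw [inner_hypQ, hL.map_hypJ h h7 h6]
  have h1 : P n (L (LinearMap.adjoint L v)) = P n v := by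
    conv_rhs => rw [hL.decomp h7 h6 v]
    rw [map_add, map_smul, h.self, smul_zero, zero_add]
  rw [h1, starForm, hL.normal, hL.normal, h.swap v n, inner_neg_left, h.cyc' (P n v)]
  ring

theorem starForm_normal (h : IsCross P) (h7 : Module.finrank ℝ V = 7)
    (h6 : Module.finrank ℝ T = 6) (x y z : T) : starForm P n (L x) (L y) (L z) =
      -⟪hypQ P L (hypJ P L n x) y, z⟫ := by
  rw [h.starForm_swap₁, hL.starForm_eq h h7 h6, hL.adjoint_self]

/-- The right-hand side is the shape in which the derivative of the Kähler form appears: a term from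
`∇φ` and a term from the derivative of the normal. -/
theorem torsionForm_hypK (h : IsCross P) (h7 : Module.finrank ℝ V = 7)
    (h6 : Module.finrank ℝ T = 6) (A : T →ₗ[ℝ] T) (S : V →ₗ[ℝ] V) (x y z : T) :
    torsionForm (hypQ P L) (hypK P L n A S) x y z =
      -starForm P (S (L x)) n (L y) (L z) + ⟪P (L (A x)) (L y), L z⟫ := by
  rw [hL.starForm_eq h h7 h6, torsionForm_apply, ← inner_hypQ]
  simp only [hypK, LinearMap.sub_apply, LinearMap.comp_apply, map_sub, inner_sub_left]
  ring

/-- In this form the symmetries can be read off: the first two terms are `B - IB` when `A` is the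
shape operator, and the last two are exchanged, up to the sign of the symmetry of `S`, when `x` and
`y` are exchanged. -/
theorem hypK_symm_part (h : IsCross P) (h7 : Module.finrank ℝ V = 7)
    (h6 : Module.finrank ℝ T = 6) (A : T →ₗ[ℝ] T) (S : V →ₗ[ℝ] V) (x y : T) :
    ⟪hypK P L n A S x + hypJ P L n (hypK P L n A S (hypJ P L n x)), y⟫ =
      ⟪A x, y⟫ - ⟪A (hypJ P L n x), hypJ P L n y⟫ + ⟪S (L x), L (hypJ P L n y)⟫
        + ⟪S (L (hypJ P L n x)), L y⟫ := by
  have hsu := hL.isSU3 h h7 h6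
  have hJ : ∀ x y, ⟪hypJ P L n x, y⟫ = -⟪x, hypJ P L n y⟫ := fun x y => by rw [hsu.inner_J, neg_neg]
  simp only [hypK, LinearMap.sub_apply, LinearMap.comp_apply, inner_add_left, map_sub, hsu.J_J,
    inner_sub_left, inner_neg_left, LinearMap.adjoint_inner_left, hJ]
  ring

/-- The sum over `e` does not depend on the basis, so it may be taken over one containing `n`; the
term of `n` drops out because `P n (S n)` is perpendicular to `n`. -/
theorem trace_hypK (h : IsCross P) (h7 : Module.finrank ℝ V = 7)
    (h6 : Module.finrank ℝ T = 6) (A : T →ₗ[ℝ] T) (S : V →ₗ[ℝ] V)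
    (e : OrthonormalBasis (Fin 7) ℝ V) :
    LinearMap.trace ℝ T (hypK P L n A S) =
      LinearMap.trace ℝ T A + ⟪n, ∑ i, P (e i) (S (e i))⟫ := by
  have b : OrthonormalBasis (Fin 6) ℝ T := (stdOrthonormalBasis ℝ T).reindex (finCongr h6)
  obtain ⟨e', he, he'⟩ := hL.exists_basis h7 b
  have h1 := sum_bilin_eq e e' ((P.compl₂ S).compr₂ (innerₗ V n))
  simp only [LinearMap.compl₂_apply, LinearMap.compr₂_apply, innerₗ_apply_apply] at h1
  have hsu := hL.isSU3 h h7 h6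
  have h2 : LinearMap.trace ℝ T (hypJ P L n ∘ₗ LinearMap.adjoint L ∘ₗ S ∘ₗ L) =
      -∑ i, ⟪n, P (e' (some i)) (S (e' (some i)))⟫ := by
    rw [LinearMap.trace_eq_sum_inner _ b, ← Finset.sum_neg_distrib]
    refine Finset.sum_congr rfl fun i _ => ?_
    simp only [LinearMap.comp_apply]
    rw [hsu.inner_J, LinearMap.adjoint_inner_right, hL.map_hypJ h h7 h6, he', h.cyc' n]
  rw [hypK, map_sub, inner_sum, h1, Fintype.sum_option, he, ← h.cyc', h.self, inner_zero_left,
    zero_add, h2, sub_neg_eq_add]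

/-- Here `J K = J A + Sᵀ`: the first term is a skew map composed with a symmetric one, the second is
skew, so both are trace-free. -/
theorem trace_hypJ_hypK (h : IsCross P) (h7 : Module.finrank ℝ V = 7)
    (h6 : Module.finrank ℝ T = 6) {A : T →ₗ[ℝ] T} {S : V →ₗ[ℝ] V}
    (hA : ∀ x y, ⟪A x, y⟫ = ⟪x, A y⟫) (hS : ∀ x y, ⟪S x, y⟫ = -⟪x, S y⟫) :
    LinearMap.trace ℝ T (hypJ P L n ∘ₗ hypK P L n A S) = 0 := by
  have b : OrthonormalBasis (Fin 6) ℝ T := (stdOrthonormalBasis ℝ T).reindex (finCongr h6)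
  have hsu := hL.isSU3 h h7 h6
  have h1 : LinearMap.trace ℝ T (hypJ P L n ∘ₗ A) = 0 := by
    have h2 : ∑ i, ⟪b i, hypJ P L n (A (b i))⟫ = ∑ i, ⟪A (b i), hypJ P L n (b i)⟫ := by
      have := sum_bilin_adjoint b hA ((innerₗ T).compl₂ (hypJ P L n))
      simpa using this.symm
    rw [LinearMap.trace_eq_sum_inner _ b]
    simp only [LinearMap.comp_apply]
    have h3 : ∑ i, ⟪b i, hypJ P L n (A (b i))⟫ = -∑ i, ⟪A (b i), hypJ P L n (b i)⟫ := by
      rw [← Finset.sum_neg_distrib]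
      exact Finset.sum_congr rfl fun i _ => by rw [hsu.inner_J, real_inner_comm]
    linarith
  have h4 : LinearMap.trace ℝ T (LinearMap.adjoint L ∘ₗ S ∘ₗ L) = 0 := by
    rw [LinearMap.trace_eq_sum_inner _ b]
    refine Finset.sum_eq_zero fun i _ => ?_
    simp only [LinearMap.comp_apply, LinearMap.adjoint_inner_right]
    have := hS (L (b i)) (L (b i))
    rw [real_inner_comm] at this
    linarith
  have h5 : hypJ P L n ∘ₗ hypK P L n A S =
      hypJ P L n ∘ₗ A + LinearMap.adjoint L ∘ₗ S ∘ₗ L := by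
    ext x
    simp [hypK, hsu.J_J]
  rw [h5, map_add, h1, h4, add_zero]

/-- For `K + J K J = F`, rotating the phase replaces `F` by `c F - s J F`, and `J F` is symmetric
when `F` is symmetric and anticommutes with `J`. So the symmetry condition does not see the phase.
-/
theorem mem_type_of_symm (h : IsCross P) (h7 : Module.finrank ℝ V = 7)
    (h6 : Module.finrank ℝ T = 6) {A : T →ₗ[ℝ] T} {S : V →ₗ[ℝ] V}
    (hA : ∀ x y, ⟪A x, y⟫ = ⟪x, A y⟫) (hS : ∀ x y, ⟪S x, y⟫ = ⟪x, S y⟫)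
    {c s : ℝ} (hcs : c ^ 2 + s ^ 2 = 1) (η : T →ₗ[ℝ] ℝ) :
    (torsionForm (hypQ P L) (hypK P L n A S), (η : T → ℝ)) ∈
      ⨆ k ∈ ({.W₁p, .W₁m, .W₂p, .W₂m, .W₃, .W₅} : Set SU3Class),
        moduleSU3 (hypJ P L n) (volForm (c • hypQ P L + s • hypQ P L ∘ₗ hypJ P L n)) k := by
  have hsu := hL.isSU3 h h7 h6
  rw [← hsu.torsionForm_rotate hcs]
  refine (hsu.rotate hcs).mem_type_of_symm h6 η fun x y => ?_
  have key : ∀ x y, ⟪hypK P L n A S x + hypJ P L n (hypK P L n A S (hypJ P L n x)), y⟫ =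
      ⟪hypK P L n A S y + hypJ P L n (hypK P L n A S (hypJ P L n y)), x⟫ := fun x y => by
    rw [hL.hypK_symm_part h h7 h6, hL.hypK_symm_part h h7 h6, hA x, hA (hypJ P L n x), hS (L x),
      hS (L (hypJ P L n x)), real_inner_comm x, real_inner_comm (hypJ P L n x),
      real_inner_comm (L x), real_inner_comm (L (hypJ P L n x))]
    ring
  rw [real_inner_comm _ x]
  have h1 := key x y
  have h2 := key x (hypJ P L n y)
  rw [hsu.inner_J] at h2
  simp only [LinearMap.sub_apply, LinearMap.smul_apply, LinearMap.comp_apply, map_add, map_sub, map_smul,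
    inner_add_left, inner_sub_left, real_inner_smul_left, hsu.J_J, map_neg, inner_neg_left]
    at h1 h2 ⊢
  linear_combination c * h1 + s * h2

theorem mem_type_of_skew (h : IsCross P) (h7 : Module.finrank ℝ V = 7)
    (h6 : Module.finrank ℝ T = 6) {A : T →ₗ[ℝ] T} {S : V →ₗ[ℝ] V}
    (hA : ∀ x y, ⟪A (hypJ P L n x), hypJ P L n y⟫ = ⟪A x, y⟫) (hS : ∀ x y, ⟪S x, y⟫ = -⟪x, S y⟫)
    {c s : ℝ} (hcs : c ^ 2 + s ^ 2 = 1) (η : T →ₗ[ℝ] ℝ) :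
    (torsionForm (hypQ P L) (hypK P L n A S), (η : T → ℝ)) ∈
      ⨆ k ∈ ({.W₁p, .W₁m, .W₂p, .W₂m, .W₄, .W₅} : Set SU3Class),
        moduleSU3 (hypJ P L n) (volForm (c • hypQ P L + s • hypQ P L ∘ₗ hypJ P L n)) k := by
  have hsu := hL.isSU3 h h7 h6
  rw [← hsu.torsionForm_rotate hcs]
  refine (hsu.rotate hcs).mem_type_of_skew h6 η fun x y => ?_
  have key : ∀ x y, ⟪hypK P L n A S x + hypJ P L n (hypK P L n A S (hypJ P L n x)), y⟫ =
      -⟪hypK P L n A S y + hypJ P L n (hypK P L n A S (hypJ P L n y)), x⟫ := fun x y => by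
    rw [hL.hypK_symm_part h h7 h6, hL.hypK_symm_part h h7 h6, hA x, hA y, hS (L x),
      hS (L (hypJ P L n x)), real_inner_comm (S (L (hypJ P L n y))), real_inner_comm (S (L y))]
    ring
  rw [real_inner_comm _ x]
  have h1 := key x y
  have h2 := key x (hypJ P L n y)
  rw [hsu.inner_J] at h2
  simp only [LinearMap.sub_apply, LinearMap.smul_apply, LinearMap.comp_apply, map_add, map_sub, map_smul,
    inner_add_left, inner_sub_left, real_inner_smul_left, hsu.J_J, map_neg, inner_neg_left]
    at h1 h2 ⊢
  linear_combination c * h1 + s * h2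

/-- Rotation multiplies the complex trace of `K` by a unit complex number, so its vanishing is
independent of the phase. -/
theorem mem_type_of_trace (h : IsCross P) (h7 : Module.finrank ℝ V = 7)
    (h6 : Module.finrank ℝ T = 6) {A : T →ₗ[ℝ] T} {S : V →ₗ[ℝ] V}
    (hA : ∀ x y, ⟪A x, y⟫ = ⟪x, A y⟫) (hS : ∀ x y, ⟪S x, y⟫ = -⟪x, S y⟫)
    (htr : LinearMap.trace ℝ T (hypK P L n A S) = 0)
    {c s : ℝ} (hcs : c ^ 2 + s ^ 2 = 1) (η : T →ₗ[ℝ] ℝ) :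
    (torsionForm (hypQ P L) (hypK P L n A S), (η : T → ℝ)) ∈
      ⨆ k ∈ ({.W₂p, .W₂m, .W₃, .W₄, .W₅} : Set SU3Class),
        moduleSU3 (hypJ P L n) (volForm (c • hypQ P L + s • hypQ P L ∘ₗ hypJ P L n)) k := by
  have hsu := hL.isSU3 h h7 h6
  have htr' := hL.trace_hypJ_hypK h h7 h6 hA hS
  have h1 : hypJ P L n ∘ₗ (c • hypK P L n A S - s • hypJ P L n ∘ₗ hypK P L n A S) =
      c • hypJ P L n ∘ₗ hypK P L n A S + s • hypK P L n A S := by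
    ext x
    simp [hsu.J_J]
  rw [← hsu.torsionForm_rotate hcs]
  refine (hsu.rotate hcs).mem_type_of_trace h6 η ?_ ?_
  · rw [map_sub, map_smul, map_smul, htr, htr']; simp
  · rw [h1, map_add, map_smul, map_smul, htr, htr']; simp

/-- The skew `S` contributes only skew terms to `K + J K J`, whereas the contribution of `A` is
symmetric. If the whole is skew, the latter must vanish. No rotation is needed, since the criterion
holds for any `ψ`. -/
theorem invariant_of_mem (h : IsCross P) (h7 : Module.finrank ℝ V = 7)
    (h6 : Module.finrank ℝ T = 6) {A : T →ₗ[ℝ] T} {S : V →ₗ[ℝ] V}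
    (hA : ∀ x y, ⟪A x, y⟫ = ⟪x, A y⟫) (hS : ∀ x y, ⟪S x, y⟫ = -⟪x, S y⟫) {η : T → ℝ}
    {ψ : (Fin 3 → T) → ℝ}
    (hm : (torsionForm (hypQ P L) (hypK P L n A S), η) ∈
      ⨆ k ∈ ({.W₁p, .W₁m, .W₂p, .W₂m, .W₄, .W₅} : Set SU3Class), moduleSU3 (hypJ P L n) ψ k)
    (x y : T) : ⟪A (hypJ P L n x), hypJ P L n y⟫ = ⟪A x, y⟫ := by
  have hsu := hL.isSU3 h h7 h6
  have h1 := hsu.skew_of_mem h6 hm x y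
  rw [real_inner_comm _ x, hL.hypK_symm_part h h7 h6, hL.hypK_symm_part h h7 h6, hS (L y),
      hS (L (hypJ P L n y)), real_inner_comm (S (L (hypJ P L n x))), real_inner_comm (S (L x)),
      hA y, hA (hypJ P L n y), real_inner_comm (A x), real_inner_comm (A (hypJ P L n x))] at h1
  linarith

end IsUnitNormal

end Hyperplane

/-! ### Directional derivatives on manifolds -/

section Directional

variable {E E' F F' : Type*} [NormedAddCommGroup E] [NormedSpace ℝ E]
  [NormedAddCommGroup E'] [NormedSpace ℝ E'] [NormedAddCommGroup F] [NormedSpace ℝ F]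
  [NormedAddCommGroup F'] [NormedSpace ℝ F']
  {M : Type*} [TopologicalSpace M] [ChartedSpace E M]
  {N : Type*} [TopologicalSpace N] [ChartedSpace E' N]

/-- The function `f` is differentiable at `p`, with derivative `d` in the direction `x`. -/
def HasDirDeriv (f : N → F) (p : N) (x : TangentSpace 𝓘(ℝ, E') p) (d : F) : Prop :=
  MDiffAt f p ∧ mvfderiv 𝓘(ℝ, E') f p x = d

namespace HasDirDeriv

variable {f g : N → F} {p : N} {x : TangentSpace 𝓘(ℝ, E') p} {d d' : F}

theorem of_mdiffAt (hf : MDiffAt f p) (x : TangentSpace 𝓘(ℝ, E') p) :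
    HasDirDeriv f p x (mvfderiv 𝓘(ℝ, E') f p x) := ⟨hf, rfl⟩

theorem congr (hf : HasDirDeriv f p x d) (h : g =ᶠ[𝓝 p] f) : HasDirDeriv g p x d := by
  refine ⟨hf.1.congr_of_eventuallyEq h, ?_⟩
  rw [← hf.2, mvfderiv, mvfderiv, h.mfderiv_eq]
  rfl

theorem add (hf : HasDirDeriv f p x d) (hg : HasDirDeriv g p x d') :
    HasDirDeriv (fun q => f q + g q) p x (d + d') := by
  refine ⟨hf.1.add hg.1, ?_⟩
  have := congrArg (fun L => L x) (mvfderiv_add hf.1 hg.1)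
  rw [add_apply, hf.2, hg.2] at this
  exact this

theorem mul {f g : N → ℝ} {d d' : ℝ} (hf : HasDirDeriv f p x d) (hg : HasDirDeriv g p x d') :
    HasDirDeriv (fun q => f q * g q) p x (d * g p + f p * d') := by
  refine ⟨hf.1.mul hg.1, ?_⟩
  have := congrArg (fun L => L x) (mvfderiv_mul hf.1 hg.1)
  simp only [add_apply, smul_apply, hf.2, hg.2,
    smul_eq_mul] at this
  refine this.trans ?_
  ring

theorem const (c : F) : HasDirDeriv (fun _ : N => c) p x 0 :=
  ⟨mdifferentiableAt_const, by rw [mvfderiv_const]; rfl⟩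

theorem sum {κ : Type*} (s : Finset κ) {f : κ → N → F} {d : κ → F}
    (h : ∀ i ∈ s, HasDirDeriv (f i) p x (d i)) :
    HasDirDeriv (fun q => ∑ i ∈ s, f i q) p x (∑ i ∈ s, d i) := by
  classical
  induction s using Finset.induction_on with
  | empty => simpa using const (0 : F)
  | insert a s ha ih =>
    simp only [Finset.sum_insert ha]
    exact (h a (by simp)).add (ih fun i hi => h i (by simp [hi]))

theorem clm_comp (L : F →L[ℝ] F') (hf : HasDirDeriv f p x d) :
    HasDirDeriv (fun q => L (f q)) p x (L d) := by
  have hL : MDifferentiableAt 𝓘(ℝ, F) 𝓘(ℝ, F') L (f p) := L.differentiableAt.mdifferentiableAt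
  refine ⟨hL.comp p hf.1, ?_⟩
  have h1 := mfderiv_comp_apply p hL hf.1 x
  rw [mfderiv_eq_fderiv, L.fderiv] at h1
  rw [← hf.2]
  exact h1

theorem comp {ι : N → M} {f : M → F} (hf : MDiffAt f (ι p)) (hι : MDiffAt ι p)
    (x : TangentSpace 𝓘(ℝ, E') p) : HasDirDeriv (fun q => f (ι q)) p x
      (mvfderiv 𝓘(ℝ, E) f (ι p) (mfderiv 𝓘(ℝ, E') 𝓘(ℝ, E) ι p x)) :=
  ⟨hf.comp p hι, mfderiv_comp_apply p hf hι x⟩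

variable [FiniteDimensional ℝ E]

/-- The product rule for a family of linear forms and a vector-valued function. -/
theorem apply {ℓ : N → E →ₗ[ℝ] ℝ} {c : N → E} {dc : E} {d : ℝ} (hc : HasDirDeriv c p x dc)
    (hℓ : ∀ e, MDiffAt (fun q => ℓ q e) p) (hd : HasDirDeriv (fun q => ℓ q (c p)) p x d) :
    HasDirDeriv (fun q => ℓ q (c q)) p x (d + ℓ p dc) := by
  -- Expanding in a fixed basis turns the evaluation into a finite sum of products of real
  -- functions, where the scalar product rule applies.
  let b := Module.finBasis ℝ E
  have hb : ∀ (m : E →ₗ[ℝ] ℝ) (e : E), m e = ∑ j, b.coord j e * m (b j) := fun m e => by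
    conv_lhs => rw [← b.sum_repr e]
    simp only [map_sum, map_smul, smul_eq_mul, Module.Basis.coord_apply]
  have h0 : ∀ j, HasDirDeriv (fun q => ℓ q (b j)) p x
      (mvfderiv 𝓘(ℝ, E') (fun q => ℓ q (b j)) p x) := fun j => of_mdiffAt (hℓ _) x
  have h1 : HasDirDeriv (fun q => ∑ j, b.coord j (c q) * ℓ q (b j)) p x
      (∑ j, (b.coord j dc * ℓ p (b j) + b.coord j (c p) *
        mvfderiv 𝓘(ℝ, E') (fun q => ℓ q (b j)) p x)) := by
    refine sum _ fun j _ => ?_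
    exact (clm_comp (b.coord j).toContinuousLinearMap hc).mul (h0 j)
  have h2 : HasDirDeriv (fun q => ∑ j, b.coord j (c p) * ℓ q (b j)) p x
      (∑ j, (0 * ℓ p (b j) + b.coord j (c p) *
        mvfderiv 𝓘(ℝ, E') (fun q => ℓ q (b j)) p x)) :=
    sum _ fun j _ => (const _).mul (h0 j)
  simp_rw [← hb] at h1 h2
  have h3 : d = ∑ j, b.coord j (c p) * mvfderiv 𝓘(ℝ, E') (fun q => ℓ q (b j)) p x := by
    rw [← hd.2, h2.2]; simp
  rw [Finset.sum_add_distrib, ← hb, ← h3, add_comm] at h1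
  exact h1

theorem apply₂ {A : N → E →ₗ[ℝ] E →ₗ[ℝ] ℝ} {c₁ c₂ : N → E} {e₁ e₂ : E} {d : ℝ}
    (h₁ : HasDirDeriv c₁ p x e₁) (h₂ : HasDirDeriv c₂ p x e₂)
    (hA : ∀ u v, MDiffAt (fun q => A q u v) p)
    (hd : HasDirDeriv (fun q => A q (c₁ p) (c₂ p)) p x d) :
    HasDirDeriv (fun q => A q (c₁ q) (c₂ q)) p x (d + A p (c₁ p) e₂ + A p e₁ (c₂ p)) := by
  have key : ∀ u, ∀ d, HasDirDeriv (fun q => A q u (c₂ p)) p x d →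
      HasDirDeriv (fun q => A q u (c₂ q)) p x (d + A p u e₂) := fun u d hd =>
    apply (ℓ := fun q => A q u) h₂ (hA u) hd
  exact apply (ℓ := fun q => (A q).flip (c₂ q)) h₁
    (fun u => (key u _ (of_mdiffAt (hA u _) x)).1) (key _ _ hd)

theorem apply₃ {A : N → E →ₗ[ℝ] E →ₗ[ℝ] E →ₗ[ℝ] ℝ} {c₁ c₂ c₃ : N → E} {e₁ e₂ e₃ : E} {d : ℝ}
    (h₁ : HasDirDeriv c₁ p x e₁) (h₂ : HasDirDeriv c₂ p x e₂) (h₃ : HasDirDeriv c₃ p x e₃)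
    (hA : ∀ u v w, MDiffAt (fun q => A q u v w) p)
    (hd : HasDirDeriv (fun q => A q (c₁ p) (c₂ p) (c₃ p)) p x d) :
    HasDirDeriv (fun q => A q (c₁ q) (c₂ q) (c₃ q)) p x
      (d + A p (c₁ p) (c₂ p) e₃ + A p (c₁ p) e₂ (c₃ p) + A p e₁ (c₂ p) (c₃ p)) := by
  have key : ∀ u, ∀ d, HasDirDeriv (fun q => A q u (c₂ p) (c₃ p)) p x d →
      HasDirDeriv (fun q => A q u (c₂ q) (c₃ q)) p x
        (d + A p u (c₂ p) e₃ + A p u e₂ (c₃ p)) := fun u d hd =>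
    apply₂ (A := fun q => A q u) h₂ h₃ (hA u) hd
  exact apply (ℓ := fun q => ((A q).flip (c₂ q)).flip (c₃ q)) h₁
    (fun u => (key u _ (of_mdiffAt (hA u _ _) x)).1) (key _ _ hd)

end HasDirDeriv

end Directional

/-! ### Derivatives of tensors along maps -/

section Along

variable {E E' : Type*} [NormedAddCommGroup E] [NormedSpace ℝ E] [FiniteDimensional ℝ E]
  [NormedAddCommGroup E'] [NormedSpace ℝ E']
  {M : Type*} [TopologicalSpace M] [ChartedSpace E M] [IsManifold 𝓘(ℝ, E) ∞ M]
  {N : Type*} [TopologicalSpace N] [ChartedSpace E' N]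

omit [FiniteDimensional ℝ E] in
theorem ofComps_comps_eventually (p : M) :
    ∀ᶠ q in 𝓝 p, ∀ y : TangentSpace 𝓘(ℝ, E) q, ofComps p q (comps p q y) = y := by
  filter_upwards [base_nhds (E := E) p] with q hq y
  exact Trivialization.symmL_continuousLinearMapAt _ hq y

omit [FiniteDimensional ℝ E] in
theorem comps_ofComps (p : M) (e : E) : comps p p (ofComps p p e) = e :=
  Trivialization.continuousLinearMapAt_symmL _ (mem_base p) _

omit [FiniteDimensional ℝ E] in
theorem constField_ofComps (p : M) (e : E) (q : M) :
    constField p (ofComps p p e) q = ofComps p q e :=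
  congrArg (ofComps p q) (comps_ofComps p e)

omit [FiniteDimensional ℝ E] in
theorem contMDiffAt_constField (p : M) (y : TangentSpace 𝓘(ℝ, E) p) :
    ContMDiffAt 𝓘(ℝ, E) 𝓘(ℝ, E).tangent ∞
      (fun q => (⟨q, constField p y q⟩ : TangentBundle 𝓘(ℝ, E) M)) p := by
  refine (FiberBundle.contMDiffAt_extend 𝓘(ℝ, E) E y).congr_of_eventuallyEq ?_
  filter_upwards [constField_eq_extend p y] with q hq
  rw [hq]

omit [FiniteDimensional ℝ E] in
/-- A vector field along a map that is differentiable as a map to the tangent bundle has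
differentiable components. -/
theorem comps_mdiffAt_along {ι : N → M} {V : ∀ q : N, TangentSpace 𝓘(ℝ, E) (ι q)} {p : N}
    (hV : MDifferentiableAt 𝓘(ℝ, E') 𝓘(ℝ, E).tangent
      (fun q => (⟨ι q, V q⟩ : TangentBundle 𝓘(ℝ, E) M)) p) :
    MDiffAt (fun q => comps (ι p) (ι q) (V q)) p := by
  have h := (mdifferentiableAt_totalSpace 𝓘(ℝ, E)
    (fun q => (⟨ι q, V q⟩ : TangentBundle 𝓘(ℝ, E) M))).1 hV
  refine h.2.congr_of_eventuallyEq ?_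
  filter_upwards [h.1.continuousAt.preimage_mem_nhds (base_nhds (E := E) (ι p))] with q hq
  exact congrFun (Trivialization.coe_linearMapAt_of_mem _ hq) (V q)

variable [RiemannianBundle (fun p : M => TangentSpace 𝓘(ℝ, E) p)]
  [IsContMDiffRiemannianBundle 𝓘(ℝ, E) ∞ E (fun p : M => TangentSpace 𝓘(ℝ, E) p)]

theorem christoffel_symm (p : M) (x y : TangentSpace 𝓘(ℝ, E) p) :
    christoffel p x y = christoffel p y x := by
  refine ext_inner_right ℝ fun z => ?_
  have hs : metricDeriv p x y = metricDeriv p y x := by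
    simp only [metricDeriv, LinearMap.mk₂_apply]
    simp_rw [real_inner_comm]
  rw [inner_christoffel, inner_christoffel]
  simp [christoffelFst, hs]; ring

theorem metricDeriv_eq (p : M) (y z x : TangentSpace 𝓘(ℝ, E) p) :
    metricDeriv p y z x = ⟪christoffel p y x, z⟫ + ⟪y, christoffel p z x⟫ := by
  have hs : metricDeriv p z y = metricDeriv p y z := by
    simp only [metricDeriv, LinearMap.mk₂_apply]
    simp_rw [real_inner_comm]
  rw [inner_christoffel, real_inner_comm, inner_christoffel]
  simp [christoffelFst, hs]
  ring

theorem nablaAlong_eq {ι : N → M} {V : ∀ q : N, TangentSpace 𝓘(ℝ, E) (ι q)} {p : N}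
    (x : TangentSpace 𝓘(ℝ, E') p) : nablaAlong ι V p x =
      ofComps (ι p) (ι p) (mvfderiv 𝓘(ℝ, E') (fun q => comps (ι p) (ι q) (V q)) p x) +
        christoffel (ι p) (V p) (mfderiv 𝓘(ℝ, E') 𝓘(ℝ, E) ι p x) := by
  rw [nablaAlong, leviCivita_constField]

/-- The derivative of a tensor field of type `(0, 3)`, evaluated on vector fields along a map. -/
theorem hasDirDeriv_tensor₃ {ι : N → M}
    (β : ∀ u : M, TangentSpace 𝓘(ℝ, E) u →ₗ[ℝ] TangentSpace 𝓘(ℝ, E) u →ₗ[ℝ]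
      TangentSpace 𝓘(ℝ, E) u →ₗ[ℝ] ℝ)
    {p : N} (hι : MDiffAt ι p)
    (hβ : ∀ a b c : TangentSpace 𝓘(ℝ, E) (ι p), MDiffAt (fun u => β u (constField (ι p) a u)
      (constField (ι p) b u) (constField (ι p) c u)) (ι p))
    {V₁ V₂ V₃ : ∀ q : N, TangentSpace 𝓘(ℝ, E) (ι q)}
    (h₁ : MDiffAt (fun q => comps (ι p) (ι q) (V₁ q)) p)
    (h₂ : MDiffAt (fun q => comps (ι p) (ι q) (V₂ q)) p)
    (h₃ : MDiffAt (fun q => comps (ι p) (ι q) (V₃ q)) p) (x : TangentSpace 𝓘(ℝ, E') p) :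
    HasDirDeriv (fun q => β (ι q) (V₁ q) (V₂ q) (V₃ q)) p x
      (nabla E (fun u v => β u (v 0) (v 1) (v 2)) (ι p) (mfderiv 𝓘(ℝ, E') 𝓘(ℝ, E) ι p x)
          ![V₁ p, V₂ p, V₃ p] + β (ι p) (nablaAlong ι V₁ p x) (V₂ p) (V₃ p) +
        β (ι p) (V₁ p) (nablaAlong ι V₂ p x) (V₃ p) +
        β (ι p) (V₁ p) (V₂ p) (nablaAlong ι V₃ p x)) := by
  -- The chart at `ι p` transports the tensor to the fixed model space. The derivative of the
  -- transported tensor, and of the components of the fields, then combine with the Christoffel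
  -- terms into `nabla` and `nablaAlong`.
  let C : ∀ u : M, E →ₗ[ℝ] TangentSpace 𝓘(ℝ, E) u := fun u => (ofComps (ι p) u).toLinearMap
  let A : N → E →ₗ[ℝ] E →ₗ[ℝ] E →ₗ[ℝ] ℝ := fun q =>
    ((β (ι q)).compl₁₂ (C (ι q)) (C (ι q))).compr₂ (LinearMap.lcomp ℝ ℝ (C (ι q)))
  have hA : ∀ q a b c, A q a b c = β (ι q) (ofComps (ι p) (ι q) a) (ofComps (ι p) (ι q) b)
    (ofComps (ι p) (ι q) c) := fun q a b c => rfl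
  have hβ' : ∀ a b c : E, MDiffAt (fun u => β u (ofComps (ι p) u a) (ofComps (ι p) u b)
      (ofComps (ι p) u c)) (ι p) := fun a b c => by
    have := hβ (ofComps (ι p) (ι p) a) (ofComps (ι p) (ι p) b) (ofComps (ι p) (ι p) c)
    simpa only [constField_ofComps] using this
  have hd := HasDirDeriv.comp (hβ (V₁ p) (V₂ p) (V₃ p)) hι x
  have key := HasDirDeriv.apply₃ (A := A) (HasDirDeriv.of_mdiffAt h₁ x)
    (HasDirDeriv.of_mdiffAt h₂ x) (HasDirDeriv.of_mdiffAt h₃ x)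
    (fun a b c => (hβ' a b c).comp p hι) hd
  refine (key.congr ?_).1 |> fun h => ⟨h, ?_⟩
  · filter_upwards [hι.continuousAt.eventually (ofComps_comps_eventually (E := E) (ι p))] with q hq
    rw [hA, hq, hq, hq]
  · rw [(key.congr ?_).2]
    · rw [hA, hA, hA, ofComps_comps, ofComps_comps, ofComps_comps, nabla, Fin.sum_univ_three]
      simp only [nablaAlong, map_add, LinearMap.add_apply]
      simp
      ring
    · filter_upwards [hι.continuousAt.eventually (ofComps_comps_eventually (E := E) (ι p))]
        with q hq
      rw [hA, hq, hq, hq]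

/-- The metric is parallel along a map. -/
theorem hasDirDeriv_inner {ι : N → M} {p : N} (hι : MDiffAt ι p)
    {V W : ∀ q : N, TangentSpace 𝓘(ℝ, E) (ι q)}
    (hV : MDiffAt (fun q => comps (ι p) (ι q) (V q)) p)
    (hW : MDiffAt (fun q => comps (ι p) (ι q) (W q)) p) (x : TangentSpace 𝓘(ℝ, E') p) :
    HasDirDeriv (fun q => ⟪V q, W q⟫) p x
      (⟪nablaAlong ι V p x, W p⟫ + ⟪V p, nablaAlong ι W p x⟫) := by
  let C : ∀ u : M, E →ₗ[ℝ] TangentSpace 𝓘(ℝ, E) u := fun u => (ofComps (ι p) u).toLinearMap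
  let A : N → E →ₗ[ℝ] E →ₗ[ℝ] ℝ := fun q =>
    (innerₗ (TangentSpace 𝓘(ℝ, E) (ι q))).compl₁₂ (C (ι q)) (C (ι q))
  have hA : ∀ q a b, A q a b = ⟪ofComps (ι p) (ι q) a, ofComps (ι p) (ι q) b⟫ :=
    fun q a b => rfl
  have hβ' : ∀ a b : E, MDiffAt (fun u => ⟪ofComps (ι p) u a, ofComps (ι p) u b⟫) (ι p) :=
    fun a b => by
      have := mdiffAt_inner_constField (ι p) (ofComps (ι p) (ι p) a) (ofComps (ι p) (ι p) b)
      simpa only [constField_ofComps] using this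
  have hd := HasDirDeriv.comp (mdiffAt_inner_constField (ι p) (V p) (W p)) hι x
  have key := HasDirDeriv.apply₂ (A := A) (HasDirDeriv.of_mdiffAt hV x)
    (HasDirDeriv.of_mdiffAt hW x) (fun a b => (hβ' a b).comp p hι) hd
  have hev : (fun q => ⟪V q, W q⟫) =ᶠ[𝓝 p]
      fun q => A q (comps (ι p) (ι q) (V q)) (comps (ι p) (ι q) (W q)) := by
    filter_upwards [hι.continuousAt.eventually (ofComps_comps_eventually (E := E) (ι p))] with q hq
    rw [hA, hq, hq]
  have hm := metricDeriv_eq (ι p) (V p) (W p) (mfderiv 𝓘(ℝ, E') 𝓘(ℝ, E) ι p x)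
  refine ⟨(key.congr hev).1, (key.congr hev).2.trans ?_⟩
  rw [hA, hA, ofComps_comps, ofComps_comps, nablaAlong_eq, nablaAlong_eq, inner_add_left,
    inner_add_right]
  change metricDeriv _ _ _ _ + _ + _ = _
  rw [hm]
  ring

end Along

/-! ### The Gauss formula -/

section Gauss

variable {E E' : Type*} [NormedAddCommGroup E] [NormedSpace ℝ E]
  [NormedAddCommGroup E'] [NormedSpace ℝ E']
  {M : Type*} [TopologicalSpace M] [ChartedSpace E M] [IsManifold 𝓘(ℝ, E) ∞ M]
  {N : Type*} [TopologicalSpace N] [ChartedSpace E' N] [IsManifold 𝓘(ℝ, E') ∞ N]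

variable (E) in
/-- The image under the differential of a map of a field with constant components. -/
def pushConst (ι : N → M) (p : N) (y : TangentSpace 𝓘(ℝ, E') p) (q : N) :
    TangentSpace 𝓘(ℝ, E) (ι q) :=
  mfderiv 𝓘(ℝ, E') 𝓘(ℝ, E) ι q (constField p y q)

variable {ι : N → M} (hι : ContMDiff 𝓘(ℝ, E') 𝓘(ℝ, E) ∞ ι)

omit [IsManifold 𝓘(ℝ, E) ∞ M] in
theorem pushConst_self (p : N) (y : TangentSpace 𝓘(ℝ, E') p) :
    pushConst E ι p y p = mfderiv 𝓘(ℝ, E') 𝓘(ℝ, E) ι p y := by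
  rw [pushConst, constField_self]

include hι

theorem comps_pushConst_mdiffAt (p : N) (y : TangentSpace 𝓘(ℝ, E') p) :
    MDifferentiableAt 𝓘(ℝ, E') 𝓘(ℝ, E) (fun q => comps (ι p) (ι q) (pushConst E ι p y q)) p := by
  refine comps_mdiffAt_along ?_
  have h1 : ContMDiff 𝓘(ℝ, E').tangent 𝓘(ℝ, E).tangent ∞ (tangentMap 𝓘(ℝ, E') 𝓘(ℝ, E) ι) :=
    hι.contMDiff_tangentMap (by simp)
  have h2 := (h1.contMDiffAt (x := ⟨p, constField p y p⟩)).comp p (contMDiffAt_constField p y)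
  exact h2.mdifferentiableAt (by simp)

omit [IsManifold 𝓘(ℝ, E) ∞ M] [IsManifold 𝓘(ℝ, E') ∞ N] in
/-- A map written in charts. -/
theorem contDiffAt_chart (p : N) :
    ContDiffAt ℝ ∞ (extChartAt 𝓘(ℝ, E) (ι p) ∘ ι ∘ (extChartAt 𝓘(ℝ, E') p).symm)
      (extChartAt 𝓘(ℝ, E') p p) := by
  have h := (contMDiffAt_iff.1 (hι.contMDiffAt (x := p))).2
  simpa [contDiffWithinAt_univ] using h

/-- In charts a pushed-forward constant field is the first derivative of the coordinate expression
of the map, so its own derivative is a second derivative, to which Schwarz's theorem applies. -/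
theorem comps_pushConst_eventually (p : N) (y : TangentSpace 𝓘(ℝ, E') p) :
    ∀ᶠ q in 𝓝 p, comps (ι p) (ι q) (pushConst E ι p y q) =
      fderiv ℝ (extChartAt 𝓘(ℝ, E) (ι p) ∘ ι ∘ (extChartAt 𝓘(ℝ, E') p).symm)
        (extChartAt 𝓘(ℝ, E') p q) (comps p p y) := by
  have h1 : ∀ᶠ q in 𝓝 p, q ∈ (chartAt E' p).source := chart_source_mem_nhds E' p
  have h2 : ∀ᶠ q in 𝓝 p, ι q ∈ (chartAt E (ι p)).source :=
    hι.continuous.continuousAt.eventually (chart_source_mem_nhds E (ι p))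
  filter_upwards [h1, h2] with q hq hq'
  have hq1 : q ∈ (extChartAt 𝓘(ℝ, E') p).source := by simpa using hq
  obtain ⟨u, hu, rfl⟩ : ∃ u ∈ (extChartAt 𝓘(ℝ, E') p).target, (extChartAt 𝓘(ℝ, E') p).symm u = q :=
    ⟨_, (extChartAt 𝓘(ℝ, E') p).map_source hq1, (extChartAt 𝓘(ℝ, E') p).left_inv hq1⟩
  have hs := TangentBundle.symmL_trivializationAt (I := 𝓘(ℝ, E')) hq
  have hr : extChartAt 𝓘(ℝ, E') p ((extChartAt 𝓘(ℝ, E') p).symm u) = u :=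
    (extChartAt 𝓘(ℝ, E') p).right_inv hu
  rw [hr] at hs
  have d1 : MDifferentiableAt 𝓘(ℝ, E') 𝓘(ℝ, E') (extChartAt 𝓘(ℝ, E') p).symm u := by
    have := mdifferentiableWithinAt_extChartAt_symm (I := 𝓘(ℝ, E')) hu
    rwa [modelWithCornersSelf_coe, Set.range_id, mdifferentiableWithinAt_univ] at this
  have d2 : MDiffAt ι ((extChartAt 𝓘(ℝ, E') p).symm u) := hι.mdifferentiableAt (by simp)
  have d3 : MDifferentiableAt 𝓘(ℝ, E) 𝓘(ℝ, E) (extChartAt 𝓘(ℝ, E) (ι p))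
      (ι ((extChartAt 𝓘(ℝ, E') p).symm u)) := mdifferentiableAt_extChartAt hq'
  have h3 := (d3.hasMFDerivAt.comp u (d2.hasMFDerivAt.comp u d1.hasMFDerivAt)).mfderiv
  rw [mfderiv_eq_fderiv] at h3
  rw [hr, h3, pushConst, constField, ofComps, hs, comps,
    TangentBundle.continuousLinearMapAt_trivializationAt hq', modelWithCornersSelf_coe,
    Set.range_id, mfderivWithin_univ]
  rfl

theorem comps_pushConst_deriv (p : N) (x y : TangentSpace 𝓘(ℝ, E') p) :
    mvfderiv 𝓘(ℝ, E') (fun q => comps (ι p) (ι q) (pushConst E ι p y q)) p x =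
      fderiv ℝ (fderiv ℝ (extChartAt 𝓘(ℝ, E) (ι p) ∘ ι ∘ (extChartAt 𝓘(ℝ, E') p).symm))
        (extChartAt 𝓘(ℝ, E') p p) (comps p p x) (comps p p y) := by
  have hF := contDiffAt_chart hι p
  set F := extChartAt 𝓘(ℝ, E) (ι p) ∘ ι ∘ (extChartAt 𝓘(ℝ, E') p).symm
  have hF' : DifferentiableAt ℝ (fderiv ℝ F) (extChartAt 𝓘(ℝ, E') p p) :=
    (hF.fderiv_right (m := ∞) (by simp)).differentiableAt (by simp)
  have hG : HasFDerivAt (fun u => fderiv ℝ F u (comps p p y))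
      ((fderiv ℝ (fderiv ℝ F) (extChartAt 𝓘(ℝ, E') p p)).flip (comps p p y))
      (extChartAt 𝓘(ℝ, E') p p) := by
    simpa using hF'.hasFDerivAt.clm_apply (hasFDerivAt_const (comps p p y) _)
  have hm : MDiffAt (extChartAt 𝓘(ℝ, E') p) p :=
    mdifferentiableAt_extChartAt (mem_chart_source E' p)
  have h1 := (HasDirDeriv.comp hG.differentiableAt.mdifferentiableAt hm x).congr
    (comps_pushConst_eventually hι p y)
  rw [h1.2, mvfderiv, mfderiv_eq_fderiv, hG.fderiv]
  have h2 := TangentBundle.continuousLinearMapAt_trivializationAt (I := 𝓘(ℝ, E'))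
    (mem_chart_source E' p)
  rw [← h2]
  rfl

theorem comps_pushConst_deriv_symm (p : N) (x y : TangentSpace 𝓘(ℝ, E') p) :
    mvfderiv 𝓘(ℝ, E') (fun q => comps (ι p) (ι q) (pushConst E ι p y q)) p x =
      mvfderiv 𝓘(ℝ, E') (fun q => comps (ι p) (ι q) (pushConst E ι p x q)) p y := by
  rw [comps_pushConst_deriv hι, comps_pushConst_deriv hι]
  exact (contDiffAt_chart hι p).isSymmSndFDerivAt
    (by rw [minSmoothness_of_isRCLikeNormedField]; exact WithTop.coe_le_coe.2 le_top) _ _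

variable [FiniteDimensional ℝ E]
  [RiemannianBundle (fun p : M => TangentSpace 𝓘(ℝ, E) p)]
  [IsContMDiffRiemannianBundle 𝓘(ℝ, E) ∞ E (fun p : M => TangentSpace 𝓘(ℝ, E) p)]

/-- The second covariant derivative of a map is symmetric. -/
theorem nablaAlong_pushConst_symm (p : N) (x y : TangentSpace 𝓘(ℝ, E') p) :
    nablaAlong ι (pushConst E ι p y) p x = nablaAlong ι (pushConst E ι p x) p y := by
  rw [nablaAlong_eq, nablaAlong_eq, comps_pushConst_deriv_symm hι, pushConst_self, pushConst_self,
    christoffel_symm]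

variable [FiniteDimensional ℝ E']
  [RiemannianBundle (fun p : N => TangentSpace 𝓘(ℝ, E') p)]
  [IsContMDiffRiemannianBundle 𝓘(ℝ, E') ∞ E' (fun p : N => TangentSpace 𝓘(ℝ, E') p)]

/-- The Gauss formula: the tangential part of the covariant derivative along an isometric
immersion. -/
theorem inner_nablaAlong_pushConst (hiso : ∀ (p : N) (x y : TangentSpace 𝓘(ℝ, E') p),
      ⟪mfderiv 𝓘(ℝ, E') 𝓘(ℝ, E) ι p x, mfderiv 𝓘(ℝ, E') 𝓘(ℝ, E) ι p y⟫ = ⟪x, y⟫)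
    (p : N) (x y z : TangentSpace 𝓘(ℝ, E') p) :
    ⟪nablaAlong ι (pushConst E ι p y) p x, mfderiv 𝓘(ℝ, E') 𝓘(ℝ, E) ι p z⟫ =
      ⟪leviCivita E' N (constField p y) p x, z⟫ := by
  -- Differentiating the isometry condition expresses the derivatives of the induced metric through
  -- the ambient connection. The Koszul combination of these, with the symmetry of the second
  -- derivative, leaves one term.
  have key : ∀ x y z, metricDeriv p y z x =
      ⟪nablaAlong ι (pushConst E ι p y) p x, mfderiv 𝓘(ℝ, E') 𝓘(ℝ, E) ι p z⟫ +
        ⟪nablaAlong ι (pushConst E ι p z) p x, mfderiv 𝓘(ℝ, E') 𝓘(ℝ, E) ι p y⟫ := fun x y z => by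
    have h := hasDirDeriv_inner (hι.mdifferentiableAt (x := p) (by simp))
      (comps_pushConst_mdiffAt hι p y) (comps_pushConst_mdiffAt hι p z) x
    have h2 := h.2
    rw [pushConst_self, pushConst_self, real_inner_comm (nablaAlong ι (pushConst E ι p z) p x)] at h2
    rw [← h2]
    simp only [pushConst, hiso]
    rfl
  rw [leviCivita_constField, inner_christoffel]
  simp only [christoffelFst, LinearMap.mk₂_apply, LinearMap.smul_apply, LinearMap.sub_apply,
    LinearMap.add_apply, LinearMap.flip_apply, key, smul_eq_mul]
  rw [nablaAlong_pushConst_symm hι p y x, nablaAlong_pushConst_symm hι p z x,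
    nablaAlong_pushConst_symm hι p z y]
  ring

end Gauss

/-! ### The exterior derivative of the fundamental form -/

/-- The correction terms cancel in the alternating sum that defines the exterior derivative, for a
torsion-free connection. -/
theorem alternating_sum_eq_zero {V : Type*} [NormedAddCommGroup V] [InnerProductSpace ℝ V]
    (φ : V [⋀^Fin 3]→ₗ[ℝ] ℝ) (Γ : V → V → V) (hΓ : ∀ x y, Γ x y = Γ y x) (v : Fin 4 → V) :
    ∑ i : Fin 4, (-1 : ℝ) ^ (i : ℕ) * ∑ j, φ (Function.update (fun j => v (i.succAbove j)) j
      (Γ (v (i.succAbove j)) (v i))) = 0 := by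
  have hupd : ∀ (i : Fin 4) (Γ : Fin 3 → V),
      ∑ j, φ (Function.update (fun j => v (i.succAbove j)) j (Γ j)) =
        triL φ (Γ 0) (v (i.succAbove 1)) (v (i.succAbove 2)) +
        triL φ (v (i.succAbove 0)) (Γ 1) (v (i.succAbove 2)) +
        triL φ (v (i.succAbove 0)) (v (i.succAbove 1)) (Γ 2) := fun i Γ => by
    rw [Fin.sum_univ_three, apply_eq_triL, apply_eq_triL, apply_eq_triL]
    simp
  have h1 := triL_swap φ
  have h2 := triL_swap' φ
  have h3 := triL_cyc φ
  have e0 : (0 : Fin 4).succAbove 0 = 1 ∧ (0 : Fin 4).succAbove 1 = 2 ∧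
    (0 : Fin 4).succAbove 2 = 3 := by decide
  have e1 : (1 : Fin 4).succAbove 0 = 0 ∧ (1 : Fin 4).succAbove 1 = 2 ∧
    (1 : Fin 4).succAbove 2 = 3 := by decide
  have e2 : (2 : Fin 4).succAbove 0 = 0 ∧ (2 : Fin 4).succAbove 1 = 1 ∧
    (2 : Fin 4).succAbove 2 = 3 := by decide
  have e3 : (3 : Fin 4).succAbove 0 = 0 ∧ (3 : Fin 4).succAbove 1 = 1 ∧
    (3 : Fin 4).succAbove 2 = 2 := by decide
  rw [Fin.sum_univ_four, hupd, hupd, hupd, hupd]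
  simp only [e0.1, e0.2.1, e0.2.2, e1.1, e1.2.1, e1.2.2, e2.1, e2.2.1, e2.2.2, e3.1, e3.2.1,
    e3.2.2]
  rw [hΓ (v 1) (v 0), hΓ (v 2) (v 0), hΓ (v 3) (v 0), hΓ (v 2) (v 1), hΓ (v 3) (v 1),
    hΓ (v 3) (v 2), h1 (v 1) (Γ (v 0) (v 2)) (v 3), ← h3 (Γ (v 0) (v 3)) (v 1) (v 2),
    h2 (v 0) (v 2) (Γ (v 1) (v 3))]
  norm_num
  ring

/-! ### The exterior derivative of φ and the vector field `p_φ` on the ambient manifold -/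

section Ambient

variable {N : Type*} [TopologicalSpace N]
  [ChartedSpace (EuclideanSpace ℝ (Fin 7)) N] [IsManifold (𝓡 7) ∞ N]
  [RiemannianBundle (fun p : N => TangentSpace (𝓡 7) p)]

theorem finrank_tangentSpace {m : ℕ} {M : Type*} [TopologicalSpace M]
    [ChartedSpace (EuclideanSpace ℝ (Fin m)) M] (p : M) :
    Module.finrank ℝ (TangentSpace (𝓡 m) p) = m := by
  change Module.finrank ℝ (EuclideanSpace ℝ (Fin m)) = m
  simp

theorem G2Structure.isCross (G : G2Structure N) (p : N) : IsCross (crossL (G.φ p)) :=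
  (G.cayley p).choose_spec.isCross

theorem G2Structure.mdiffAt_constField (G : G2Structure N) (p : N)
    (v : Fin 3 → TangentSpace (𝓡 7) p) :
    MDifferentiableAt (𝓡 7) 𝓘(ℝ, ℝ) (fun q => G.φ q fun i => constField p (v i) q) p :=
  (G.smooth p (fun i => constField p (v i)) fun i => contMDiffAt_constField p (v i)).mdifferentiableAt
    (by simp)

variable [IsContMDiffRiemannianBundle (𝓡 7) ∞ (EuclideanSpace ℝ (Fin 7))
    (fun p : N => TangentSpace (𝓡 7) p)]

/-- The connection is torsion-free, so the Christoffel corrections in the covariant derivatives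
cancel in the alternating sum. -/
theorem extDer_eq_nabla (α : ∀ p : N, TangentSpace (𝓡 7) p [⋀^Fin 3]→ₗ[ℝ] ℝ) (p : N)
    (v : Fin 4 → TangentSpace (𝓡 7) p) :
    extDer (fun q v => α q v) p v = ∑ i : Fin 4, (-1 : ℝ) ^ (i : ℕ) *
      nabla (EuclideanSpace ℝ (Fin 7)) (fun q v => α q v) p (v i)
        (fun j => v (i.succAbove j)) := by
  have h := alternating_sum_eq_zero (α p) (fun x y => christoffel p x y) (christoffel_symm p) v
  simp only [nabla, extDer, leviCivita_constField, mul_sub, Finset.sum_sub_distrib]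
  rw [eq_comm, sub_eq_self]
  exact h

/-- The vector field `p_φ` in terms of the tensor that determines `∇φ`. -/
theorem G2Structure.inner_pVec (G : G2Structure N) (p : N)
    {S : TangentSpace (𝓡 7) p →ₗ[ℝ] TangentSpace (𝓡 7) p}
    (hS : ∀ x v, nabla (EuclideanSpace ℝ (Fin 7)) (fun q v => G.φ q v) p x v =
      starForm (crossL (G.φ p)) (S x) (v 0) (v 1) (v 2)) (x : TangentSpace (𝓡 7) p) :
    ⟪G.pVec p, x⟫ = -2 * flipSign * ∑ i, ⟪crossL (G.φ p) ((G.cayley p).choose i)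
      (S ((G.cayley p).choose i)), x⟫ := by
  have hβ : ∀ v, extDer (fun q v => G.φ q v) p v = _ := fun v =>
    (extDer_eq_nabla G.φ p v).trans (by simp only [hS]; rfl)
  obtain ⟨f, hf⟩ := hodge_linear (G.cayley p).choose (k := 6) rfl
    (wedge (hodge (G.cayley p).choose 4 3 rfl (extDer (fun q v => G.φ q v) p))
        (fun v : Fin 3 → _ => G.φ p v))
  have h1 : G.pVec p = vecOf f := by
    rw [G2Structure.pVec]; simp only [hf]
  rw [h1, inner_vecOf, ← hf]
  exact hodge_wedge_of_star (G.isCross p) _ S _ hβ x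

end Ambient

/-! ### Hypersurfaces of manifolds with a `G₂`-structure -/

section HypersurfaceGeometry

variable {N : Type*} [TopologicalSpace N]
  [ChartedSpace (EuclideanSpace ℝ (Fin 7)) N] [IsManifold (𝓡 7) ∞ N]
  [RiemannianBundle (fun p : N => TangentSpace (𝓡 7) p)]
  {M : Type*} [TopologicalSpace M]
  [ChartedSpace (EuclideanSpace ℝ (Fin 6)) M] [IsManifold (𝓡 6) ∞ M]
  [RiemannianBundle (fun p : M => TangentSpace (𝓡 6) p)]

/-- The differential of a map, as a linear map. -/
def diffL (ι : M → N) (p : M) : TangentSpace (𝓡 6) p →ₗ[ℝ] TangentSpace (𝓡 7) (ι p) :=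
  (mfderiv (𝓡 6) (𝓡 7) ι p).toLinearMap

variable {G : G2Structure N} {ι : M → N} {n : ∀ p : M, TangentSpace (𝓡 7) (ι p)}

omit [IsManifold (𝓡 6) ∞ M] in
theorem indJ_eq (p : M) (x : TangentSpace (𝓡 6) p) :
    indJ G ι n p x = hypJ (crossL (G.φ (ι p))) (diffL ι p) (n p) x := by
  refine ext_inner_right ℝ fun y => ?_
  rw [inner_hypJ, inner_crossL]
  exact inner_vecOf (triL (G.φ (ι p)) (n p) (diffL ι p x) ∘ₗ diffL ι p) y

omit [IsManifold (𝓡 6) ∞ M] in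
theorem inner_indJ (p : M) (x y : TangentSpace (𝓡 6) p) :
    ⟪indJ G ι n p x, y⟫ = triL (G.φ (ι p)) (n p) (mfderiv (𝓡 6) (𝓡 7) ι p x)
      (mfderiv (𝓡 6) (𝓡 7) ι p y) :=
  inner_vecOf (triL (G.φ (ι p)) (n p) (diffL ι p x) ∘ₗ diffL ι p) y

namespace IsHypersurface

variable (hM : IsHypersurface ι n)
include hM

omit [IsManifold (𝓡 6) ∞ M] in
theorem isUnitNormal (p : M) : IsUnitNormal (diffL ι p) (n p) where
  isometric := hM.isometric p
  unit := hM.unit p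
  normal := hM.normal p

omit [IsManifold (𝓡 6) ∞ M] in
-- By `starForm_normal`, `n ⌟ ∗φ` restricts to minus the form of `Q ∘ J`. The phase θ therefore
-- becomes the rotation of `Q` handled by `IsSU3.rotate`.
theorem indPsiPlus_eq (θ : M → ℝ) (p : M) : indPsiPlus G ι n θ p =
    volForm (Real.cos (θ p) • hypQ (crossL (G.φ (ι p))) (diffL ι p) + Real.sin (θ p) •
      hypQ (crossL (G.φ (ι p))) (diffL ι p) ∘ₗ hypJ (crossL (G.φ (ι p))) (diffL ι p) (n p)) := by
  funext v
  have h := G.isCross (ι p)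
  have h1 : interior (n p) (starPhi (G.φ (ι p))) (fun i => mfderiv (𝓡 6) (𝓡 7) ι p (v i)) =
      starForm (crossL (G.φ (ι p))) (n p) (diffL ι p (v 0)) (diffL ι p (v 1))
        (diffL ι p (v 2)) := by
    rw [interior, starPhi_eq h]; rfl
  have h2 : G.φ (ι p) (fun i => mfderiv (𝓡 6) (𝓡 7) ι p (v i)) =
      ⟪hypQ (crossL (G.φ (ι p))) (diffL ι p) (v 0) (v 1), v 2⟫ := by
    rw [inner_hypQ, inner_crossL, ← triL_apply, apply_eq_triL]; rfl
  rw [indPsiPlus, h1, h2, (hM.isUnitNormal p).starForm_normal h (finrank_tangentSpace _)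
    (finrank_tangentSpace _), volForm]
  simp only [LinearMap.add_apply, LinearMap.smul_apply, LinearMap.comp_apply, inner_add_left,
    real_inner_smul_left]
  ring

omit [IsManifold (𝓡 6) ∞ M] in
theorem mdiffAt (p : M) : MDifferentiableAt (𝓡 6) (𝓡 7) ι p :=
  hM.smooth.mdifferentiableAt (by simp)

omit [IsManifold (𝓡 6) ∞ M] in
theorem comps_normal_mdiffAt (p : M) : MDifferentiableAt (𝓡 6) 𝓘(ℝ, EuclideanSpace ℝ (Fin 7))
    (fun q => comps (ι p) (ι q) (n q)) p :=
  comps_mdiffAt_along (hM.smooth_normal.mdifferentiableAt (by simp))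

variable [IsContMDiffRiemannianBundle (𝓡 7) ∞ (EuclideanSpace ℝ (Fin 7))
    (fun p : N => TangentSpace (𝓡 7) p)]

theorem secondFF_symm (p : M) (x y : TangentSpace (𝓡 6) p) :
    secondFF ι n p x y = secondFF ι n p y x :=
  congrArg (fun v => ⟪v, n p⟫) (nablaAlong_pushConst_symm hM.smooth p x y)

omit hM [IsManifold (𝓡 6) ∞ M] [RiemannianBundle fun p : M => TangentSpace (𝓡 6) p] in
theorem nablaAlong_add (V : ∀ q : M, TangentSpace (𝓡 7) (ι q)) (p : M)
    (x y : TangentSpace (𝓡 6) p) :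
    nablaAlong ι V p (x + y) = nablaAlong ι V p x + nablaAlong ι V p y := by
  simp only [nablaAlong, map_add]
  exact add_add_add_comm _ _ _ _

omit hM [IsManifold (𝓡 6) ∞ M] [RiemannianBundle fun p : M => TangentSpace (𝓡 6) p] in
theorem nablaAlong_smul (V : ∀ q : M, TangentSpace (𝓡 7) (ι q)) (p : M) (c : ℝ)
    (x : TangentSpace (𝓡 6) p) : nablaAlong ι V p (c • x) = c • nablaAlong ι V p x := by
  simp only [nablaAlong, map_smul, smul_add]

/-- There is a symmetric shape operator. -/
theorem exists_shape (p : M) : ∃ A : TangentSpace (𝓡 6) p →ₗ[ℝ] TangentSpace (𝓡 6) p,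
    ∀ x y, ⟪A x, y⟫ = secondFF ι n p x y := by
  have hadd : ∀ x x' y, secondFF ι n p (x + x') y = secondFF ι n p x y + secondFF ι n p x' y :=
    fun x x' y => by rw [secondFF, nablaAlong_add, inner_add_left]; rfl
  have hsmul : ∀ (c : ℝ) x y, secondFF ι n p (c • x) y = c • secondFF ι n p x y :=
    fun c x y => by rw [secondFF, nablaAlong_smul, real_inner_smul_left]; rfl
  let BL : TangentSpace (𝓡 6) p →ₗ[ℝ] TangentSpace (𝓡 6) p →ₗ[ℝ] ℝ :=
    LinearMap.mk₂ ℝ (secondFF ι n p) hadd hsmul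
      -- Linearity in the extended vector is not visible from the definition; it is borrowed from
      -- the first argument through symmetry.
      (fun x y y' => by rw [hM.secondFF_symm, hadd, hM.secondFF_symm p y, hM.secondFF_symm p y'])
      (fun c x y => by rw [hM.secondFF_symm, hsmul, hM.secondFF_symm p y])
  have key : ∀ x y, ⟪vecOf (BL x), y⟫ = BL x y := fun x y => inner_vecOf (BL x) y
  refine ⟨{ toFun := fun x => vecOf (BL x)
            map_add' := fun x y => ext_inner_right ℝ fun z => by
              rw [key, inner_add_left, key, key, map_add, LinearMap.add_apply]
            map_smul' := fun c x => ext_inner_right ℝ fun z => by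
              rw [key, RingHom.id_apply, real_inner_smul_left, key, map_smul, LinearMap.smul_apply,
                smul_eq_mul] }, key⟩

/-- The Weingarten formula. -/
theorem nablaAlong_normal {p : M} {A : TangentSpace (𝓡 6) p →ₗ[ℝ] TangentSpace (𝓡 6) p}
    (hA : ∀ x y, ⟪A x, y⟫ = secondFF ι n p x y) (x : TangentSpace (𝓡 6) p) :
    nablaAlong ι n p x = -diffL ι p (A x) := by
  have hL := hM.isUnitNormal p
  -- Differentiate `⟪n, n⟫ = 1` for the normal component, and below `⟪n, dι Y⟫ = 0` for the
  -- tangential one.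
  have h1 : ⟪n p, nablaAlong ι n p x⟫ = 0 := by
    have h := hasDirDeriv_inner (hM.mdiffAt p) (hM.comps_normal_mdiffAt p)
      (hM.comps_normal_mdiffAt p) x
    have h0 := h.2
    simp only [hM.unit] at h0
    rw [mvfderiv_const, real_inner_comm] at h0
    have : (0 : ℝ) = ⟪n p, nablaAlong ι n p x⟫ + ⟪n p, nablaAlong ι n p x⟫ := h0
    linarith
  have h2 : LinearMap.adjoint (diffL ι p) (nablaAlong ι n p x) = -A x := by
    refine ext_inner_right ℝ fun y => ?_
    have h := hasDirDeriv_inner (hM.mdiffAt p) (hM.comps_normal_mdiffAt p)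
      (comps_pushConst_mdiffAt hM.smooth p y) x
    have h0 := h.2
    simp only [pushConst, hM.normal] at h0
    rw [mvfderiv_const, constField_self] at h0
    have h3 : (0 : ℝ) = ⟪nablaAlong ι n p x, diffL ι p y⟫ +
      ⟪n p, nablaAlong ι (pushConst (EuclideanSpace ℝ (Fin 7)) ι p y) p x⟫ := h0
    rw [LinearMap.adjoint_inner_left, inner_neg_left, hA, secondFF, real_inner_comm (n p)]
    exact eq_neg_of_add_eq_zero_left h3.symm
  rw [hL.decomp (finrank_tangentSpace _) (finrank_tangentSpace _) (nablaAlong ι n p x), h1, h2]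
  simp

variable [IsContMDiffRiemannianBundle (𝓡 6) ∞ (EuclideanSpace ℝ (Fin 6))
    (fun p : M => TangentSpace (𝓡 6) p)]

/-- The Gauss formula. -/
theorem nablaAlong_pushConst (p : M) (x y : TangentSpace (𝓡 6) p) :
    nablaAlong ι (pushConst (EuclideanSpace ℝ (Fin 7)) ι p y) p x = secondFF ι n p x y • n p +
      diffL ι p (leviCivita (EuclideanSpace ℝ (Fin 6)) M (constField p y) p x) := by
  have hL := hM.isUnitNormal p
  have h2 : LinearMap.adjoint (diffL ι p)
      (nablaAlong ι (pushConst (EuclideanSpace ℝ (Fin 7)) ι p y) p x) =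
      leviCivita (EuclideanSpace ℝ (Fin 6)) M (constField p y) p x :=
    ext_inner_right ℝ fun z => by
      rw [LinearMap.adjoint_inner_left]
      exact inner_nablaAlong_pushConst hM.smooth hM.isometric p x y z
  rw [hL.decomp (finrank_tangentSpace _) (finrank_tangentSpace _)
    (nablaAlong ι (pushConst (EuclideanSpace ℝ (Fin 7)) ι p y) p x), h2, real_inner_comm]
  rfl

/-- The covariant derivative of the Kähler form. -/
theorem nabla_kahler {p : M} {A : TangentSpace (𝓡 6) p →ₗ[ℝ] TangentSpace (𝓡 6) p}
    (hA : ∀ x y, ⟪A x, y⟫ = secondFF ι n p x y)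
    {S : TangentSpace (𝓡 7) (ι p) →ₗ[ℝ] TangentSpace (𝓡 7) (ι p)}
    (hS : ∀ x v, nabla (EuclideanSpace ℝ (Fin 7)) (fun q v => G.φ q v) (ι p) x v =
      starForm (crossL (G.φ (ι p))) (S x) (v 0) (v 1) (v 2)) :
    (fun x y z => nabla (EuclideanSpace ℝ (Fin 6)) (kahler (indJ G ι n)) p x ![y, z]) =
      torsionForm (hypQ (crossL (G.φ (ι p))) (diffL ι p))
        (hypK (crossL (G.φ (ι p))) (diffL ι p) (n p) A S) := by
  funext x y z
  have h := G.isCross (ι p)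
  have hK : ∀ q (v : Fin 2 → TangentSpace (𝓡 6) q), kahler (indJ G ι n) q v =
      triL (G.φ (ι q)) (n q) (mfderiv (𝓡 6) (𝓡 7) ι q (v 1))
        (mfderiv (𝓡 6) (𝓡 7) ι q (v 0)) := fun q v => by
    rw [kahler, real_inner_comm, inner_indJ]
  have hd := (hasDirDeriv_tensor₃ (fun u => triL (G.φ u)) (hM.mdiffAt p)
    (fun a b c => by
      have := G.mdiffAt_constField (ι p) ![a, b, c]
      simp only [apply_eq_triL] at this
      exact this)
    (hM.comps_normal_mdiffAt p) (comps_pushConst_mdiffAt hM.smooth p z)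
    (comps_pushConst_mdiffAt hM.smooth p y) x).2
  have hφ : (fun (u : N) (v : Fin 3 → TangentSpace (𝓡 7) u) =>
      triL (G.φ u) (v 0) (v 1) (v 2)) = fun u v => G.φ u v := by
    funext u v; rw [apply_eq_triL]
  rw [hφ, hS, hM.nablaAlong_pushConst, hM.nablaAlong_pushConst, hM.nablaAlong_normal hA,
    pushConst_self, pushConst_self] at hd
  have hfun : (fun q => kahler (indJ G ι n) q fun i => constField p (![y, z] i) q) =
      fun q => triL (G.φ (ι q)) (n q) (pushConst (EuclideanSpace ℝ (Fin 7)) ι p z q)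
        (pushConst (EuclideanSpace ℝ (Fin 7)) ι p y q) := by
    funext q; rw [hK]; rfl
  rw [nabla, hfun, hd, Fin.sum_univ_two, hK, hK, (hM.isUnitNormal p).torsionForm_hypK h
    (finrank_tangentSpace _) (finrank_tangentSpace _)]
  -- In the product rule the normal parts of the Gauss formula repeat `n` in `φ` and vanish, and its
  -- tangential parts cancel the Levi-Civita corrections in `∇ω`. Only the `∇φ` term and the
  -- Weingarten term survive.
  have h0 : ∀ w, triL (G.φ (ι p)) (n p) (n p) w = 0 := fun w => by
    have := triL_swap (G.φ (ι p)) (n p) (n p) w; linarith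
  have h0' : ∀ w, triL (G.φ (ι p)) (n p) w (n p) = 0 := fun w => by
    rw [triL_swap', h0, neg_zero]
  have h1 : ∀ w, diffL ι p w = mfderiv (𝓡 6) (𝓡 7) ι p w := fun w => rfl
  rw [inner_crossL, ← triL_apply, triL_swap' _ _ (diffL ι p y), h.starForm_swap₃]
  simp only [map_add, map_smul, LinearMap.add_apply, LinearMap.smul_apply, h0, h0', h1]
  simp
  ring

omit [IsContMDiffRiemannianBundle (𝓡 7) ∞ (EuclideanSpace ℝ (Fin 7))
  fun p : N => TangentSpace (𝓡 7) p] in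
/-- The one-form `η` is linear. -/
theorem exists_linear_eta (θ : M → ℝ) (ψm : ∀ p : M, (Fin 3 → TangentSpace (𝓡 6) p) → ℝ) (p : M) :
    ∃ η : TangentSpace (𝓡 6) p →ₗ[ℝ] ℝ,
      (torsionSU3 (indJ G ι n) (indPsiPlus G ι n θ) ψm p).2 = η := by
  have hψ := hM.indPsiPlus_eq (G := G) θ p
  -- Linearity of the form in each slot makes the Levi-Civita corrections linear in the direction of
  -- differentiation.
  have hupd : ∀ (Q : TangentSpace (𝓡 6) p →ₗ[ℝ] TangentSpace (𝓡 6) p →ₗ[ℝ] TangentSpace (𝓡 6) p)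
      (v : Fin 3 → TangentSpace (𝓡 6) p) (i : Fin 3),
      ∃ f : TangentSpace (𝓡 6) p →ₗ[ℝ] ℝ, ∀ w, volForm Q (Function.update v i w) = f w := by
    intro Q v i
    fin_cases i
    · exact ⟨(innerₗ _).flip (v 2) ∘ₗ Q.flip (v 1), fun w => by
        simp [volForm, real_inner_comm (v 2)]⟩
    · exact ⟨(innerₗ _).flip (v 2) ∘ₗ Q (v 0), fun w => by
        simp [volForm, real_inner_comm (v 2)]⟩
    · exact ⟨innerₗ _ (Q (v 0) (v 1)), fun w => by simp [volForm]⟩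
  choose f hf using hupd
  have hlin : ∀ v, ∃ g : TangentSpace (𝓡 6) p →ₗ[ℝ] ℝ, ∀ x,
      nabla (EuclideanSpace ℝ (Fin 6)) (indPsiPlus G ι n θ) p x v = g x := fun v => by
    refine ⟨(mvfderiv (𝓡 6)
      (fun q => indPsiPlus G ι n θ q fun i => constField p (v i) q) p).toLinearMap -
      ∑ i, f (Real.cos (θ p) • hypQ (crossL (G.φ (ι p))) (diffL ι p) + Real.sin (θ p) •
        hypQ (crossL (G.φ (ι p))) (diffL ι p) ∘ₗ hypJ (crossL (G.φ (ι p))) (diffL ι p) (n p)) v i ∘ₗ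
      (leviCivita (EuclideanSpace ℝ (Fin 6)) M (constField p (v i)) p).toLinearMap, fun x => ?_⟩
    simp [nabla, hψ, hf]
  choose g hg using hlin
  let b := stdOrthonormalBasis ℝ (TangentSpace (𝓡 6) p)
  refine ⟨(-(1 / 12) : ℝ) • ((1 / ((3 : ℕ).factorial : ℝ)) •
    ∑ i : Fin 3 → Fin (Module.finrank ℝ (TangentSpace (𝓡 6) p)), ψm p (fun j => b (i j)) •
      g (fun j => b (i j))) ∘ₗ hypJ (crossL (G.φ (ι p))) (diffL ι p) (n p), ?_⟩
  funext x
  simp only [torsionSU3, formInner, hg, indJ_eq]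
  simp [b, mul_comm]

omit [IsManifold (𝓡 6) ∞ M] [IsContMDiffRiemannianBundle (𝓡 6) ∞ (EuclideanSpace ℝ (Fin 6))
  fun p : M => TangentSpace (𝓡 6) p] in
-- Pairing a tangent `p_φ` with `n` gives zero, and the scalar relating `p_φ` to this sum is not
-- zero.
theorem inner_normal_eq_zero (hp : PVecTangent G ι) {p : M}
    {S : TangentSpace (𝓡 7) (ι p) →ₗ[ℝ] TangentSpace (𝓡 7) (ι p)}
    (hS : ∀ x v, nabla (EuclideanSpace ℝ (Fin 7)) (fun q v => G.φ q v) (ι p) x v =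
      starForm (crossL (G.φ (ι p))) (S x) (v 0) (v 1) (v 2)) :
    ⟪n p, ∑ i, crossL (G.φ (ι p)) ((G.cayley (ι p)).choose i)
      (S ((G.cayley (ι p)).choose i))⟫ = 0 := by
  obtain ⟨x, hx⟩ := hp p
  have h1 := G.inner_pVec (ι p) hS (n p)
  rw [hx, real_inner_comm, hM.normal, ← sum_inner, eq_comm, real_inner_comm] at h1
  exact (mul_eq_zero.1 h1).resolve_left (mul_ne_zero (by norm_num) flipSign_ne_zero)

omit hM [IsContMDiffRiemannianBundle (𝓡 6) ∞ (EuclideanSpace ℝ (Fin 6))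
  fun p : M => TangentSpace (𝓡 6) p] in
theorem trace_shape {p : M} {A : TangentSpace (𝓡 6) p →ₗ[ℝ] TangentSpace (𝓡 6) p}
    (hA : ∀ x y, ⟪A x, y⟫ = secondFF ι n p x y) :
    LinearMap.trace ℝ _ A = 6 * meanCurv ι n p := by
  rw [LinearMap.trace_eq_sum_inner _ (stdOrthonormalBasis ℝ (TangentSpace (𝓡 6) p)), meanCurv,
    ← mul_assoc]
  simp only [← hA, real_inner_comm]
  norm_num

end IsHypersurface

end HypersurfaceGeometry

end G2Hyp

end

/-! ### Assembly of the three statements -/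

theorem theorem4p14
    {N : Type*} [TopologicalSpace N] [ChartedSpace (EuclideanSpace ℝ (Fin 7)) N]
    [IsManifold (𝓡 7) ∞ N] [RiemannianBundle (fun p : N => TangentSpace (𝓡 7) p)]
    [IsContMDiffRiemannianBundle (𝓡 7) ∞ (EuclideanSpace ℝ (Fin 7))
      (fun p : N => TangentSpace (𝓡 7) p)]
    {M : Type*} [TopologicalSpace M] [ChartedSpace (EuclideanSpace ℝ (Fin 6)) M]
    [IsManifold (𝓡 6) ∞ M] [RiemannianBundle (fun p : M => TangentSpace (𝓡 6) p)]
    [IsContMDiffRiemannianBundle (𝓡 6) ∞ (EuclideanSpace ℝ (Fin 6))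
      (fun p : M => TangentSpace (𝓡 6) p)]
    (G : G2Hyp.G2Structure N) (ι : M → N) (n : ∀ p : M, TangentSpace (𝓡 7) (ι p))
    (hM : G2Hyp.IsHypersurface ι n) (θ : M → ℝ) (hθ : ContMDiff (𝓡 6) 𝓘(ℝ, ℝ) ∞ θ) :
    (G.HasType {.X₁, .X₃} →
      G2Hyp.HasTypeSU3 (G2Hyp.indJ G ι n) (G2Hyp.indPsiPlus G ι n θ) (G2Hyp.indPsiMinus G ι n θ)
        {.W₁p, .W₁m, .W₂p, .W₂m, .W₃, .W₅}) ∧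
    (G.HasType {.X₂, .X₄} → G2Hyp.PVecTangent G ι →
      (G2Hyp.HasTypeSU3 (G2Hyp.indJ G ι n) (G2Hyp.indPsiPlus G ι n θ) (G2Hyp.indPsiMinus G ι n θ)
        {.W₂p, .W₂m, .W₃, .W₄, .W₅} ↔ G2Hyp.IsMinimal ι n)) ∧
    (G.HasType {.X₂, .X₄} →
      (G2Hyp.HasTypeSU3 (G2Hyp.indJ G ι n) (G2Hyp.indPsiPlus G ι n θ) (G2Hyp.indPsiMinus G ι n θ)
        {.W₁p, .W₁m, .W₂p, .W₂m, .W₄, .W₅} ↔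
        ∀ (p : M) (x y : TangentSpace (𝓡 6) p),
          G2Hyp.secondFF ι n p (G2Hyp.indJ G ι n p x) (G2Hyp.indJ G ι n p y) =
            G2Hyp.secondFF ι n p x y)) := by
  have hcs : ∀ p, Real.cos (θ p) ^ 2 + Real.sin (θ p) ^ 2 = 1 := fun p => Real.cos_sq_add_sin_sq _
  have hJ : ∀ p, G2Hyp.indJ G ι n p =
      G2Hyp.hypJ (G2Hyp.crossL (G.φ (ι p))) (G2Hyp.diffL ι p) (n p) := fun p =>
    funext fun x => G2Hyp.indJ_eq p x
  -- At each point the intrinsic torsion is encoded by `A`, `S` and a linear form, for the reference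
  -- product `hypQ` at phase zero; θ enters only through the modules and η.
  have hT : ∀ p (A : TangentSpace (𝓡 6) p →ₗ[ℝ] TangentSpace (𝓡 6) p)
      (_ : ∀ x y, inner ℝ (A x) y = G2Hyp.secondFF ι n p x y)
      (S : TangentSpace (𝓡 7) (ι p) →ₗ[ℝ] TangentSpace (𝓡 7) (ι p))
      (_ : ∀ x v, G2Hyp.nabla (EuclideanSpace ℝ (Fin 7)) (fun q v => G.φ q v) (ι p) x v =
        G2Hyp.starForm (G2Hyp.crossL (G.φ (ι p))) (S x) (v 0) (v 1) (v 2)),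
      ∃ η : TangentSpace (𝓡 6) p →ₗ[ℝ] ℝ, G2Hyp.torsionSU3 (G2Hyp.indJ G ι n)
          (G2Hyp.indPsiPlus G ι n θ) (G2Hyp.indPsiMinus G ι n θ) p =
        (G2Hyp.torsionForm (G2Hyp.hypQ (G2Hyp.crossL (G.φ (ι p))) (G2Hyp.diffL ι p))
          (G2Hyp.hypK (G2Hyp.crossL (G.φ (ι p))) (G2Hyp.diffL ι p) (n p) A S), (η : _ → ℝ)) := by
    intro p A hA S hS
    obtain ⟨η, hη⟩ := hM.exists_linear_eta (G := G) θ (G2Hyp.indPsiMinus G ι n θ) p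
    exact ⟨η, Prod.ext (hM.nabla_kahler hA hS) hη⟩
  have hsymm : ∀ p (A : TangentSpace (𝓡 6) p →ₗ[ℝ] TangentSpace (𝓡 6) p)
      (_ : ∀ x y, inner ℝ (A x) y = G2Hyp.secondFF ι n p x y) x y,
      inner ℝ (A x) y = inner ℝ x (A y) := fun p A hA x y => by
    rw [hA, hM.secondFF_symm, ← hA, real_inner_comm]
  have h7 := fun p : M => G2Hyp.finrank_tangentSpace (m := 7) (ι p)
  have h6 := fun p : M => G2Hyp.finrank_tangentSpace (m := 6) p
  have hP := fun p : M => G.isCross (ι p)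
  have hL := fun p : M => hM.isUnitNormal p
  refine ⟨fun hG p => ?_, fun hG hp => ⟨fun h p => ?_, fun hmin p => ?_⟩,
    fun hG => ⟨fun h p x y => ?_, fun hB p => ?_⟩⟩
  · obtain ⟨A, hA⟩ := hM.exists_shape p
    obtain ⟨S, hS, hS'⟩ := G2Hyp.exists_symm (hP p) (h7 p) (hG (ι p))
    obtain ⟨η, hη⟩ := hT p A hA S hS
    rw [hη, hJ, hM.indPsiPlus_eq]
    exact (hL p).mem_type_of_symm (hP p) (h7 p) (h6 p) (hsymm p A hA) hS' (hcs p) η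
  · obtain ⟨A, hA⟩ := hM.exists_shape p
    obtain ⟨S, hS, hS'⟩ := G2Hyp.exists_skew (hP p) (h7 p) (hG (ι p))
    obtain ⟨η, hη⟩ := hT p A hA S hS
    have h1 := h p
    rw [hη, hJ] at h1
    -- Absence of W₁ forces the trace of `K` to vanish, which is `tr B` once the normal component of
    -- `p_φ` is zero.
    have h2 := ((hL p).isSU3 (hP p) (h7 p) (h6 p)).trace_eq_zero (h6 p) h1
    rw [(hL p).trace_hypK (hP p) (h7 p) (h6 p) A S (G.cayley (ι p)).choose,
      hM.inner_normal_eq_zero hp hS, add_zero, G2Hyp.IsHypersurface.trace_shape hA] at h2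
    linarith
  · obtain ⟨A, hA⟩ := hM.exists_shape p
    obtain ⟨S, hS, hS'⟩ := G2Hyp.exists_skew (hP p) (h7 p) (hG (ι p))
    obtain ⟨η, hη⟩ := hT p A hA S hS
    rw [hη, hJ, hM.indPsiPlus_eq]
    refine (hL p).mem_type_of_trace (hP p) (h7 p) (h6 p) (hsymm p A hA) hS' ?_ (hcs p) η
    rw [(hL p).trace_hypK (hP p) (h7 p) (h6 p) A S (G.cayley (ι p)).choose,
      hM.inner_normal_eq_zero hp hS, add_zero, G2Hyp.IsHypersurface.trace_shape hA, hmin p, mul_zero]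
  · obtain ⟨A, hA⟩ := hM.exists_shape p
    obtain ⟨S, hS, hS'⟩ := G2Hyp.exists_skew (hP p) (h7 p) (hG (ι p))
    obtain ⟨η, hη⟩ := hT p A hA S hS
    have h1 := h p
    rw [hη, hJ] at h1
    rw [← hA, ← hA, hJ]
    exact (hL p).invariant_of_mem (hP p) (h7 p) (h6 p) (hsymm p A hA) hS' h1 x y
  · obtain ⟨A, hA⟩ := hM.exists_shape p
    obtain ⟨S, hS, hS'⟩ := G2Hyp.exists_skew (hP p) (h7 p) (hG (ι p))
    obtain ⟨η, hη⟩ := hT p A hA S hS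
    rw [hη, hJ, hM.indPsiPlus_eq]
    refine (hL p).mem_type_of_skew (hP p) (h7 p) (h6 p) (fun x y => ?_) hS' (hcs p) η
    have := hB p x y
    rw [← hA, ← hA, hJ] at this
    exact this
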